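/- **Setting.** Let $\tilde\tau_1\neq 0$ and $\tilde\mu_2\neq 8/5$ be real constants, $J\subset\mathbb R$ a nonempty open interval and $F:J\to(0,\infty)$ smooth. Put $F_1=F'/F$ and $F_2=(F_1'-F_1^2/8)/\sqrt F$, and assume $F_2'(s)\ne0$ for all $s\in J$. On $\{(a,b,s,t)\in\mathbb R^4: s\in J\}$ consider the metric $g=2\theta^1\theta^2-2\theta^3\theta^4$ with $$\theta^1=\overline{\theta^2}=\tfrac1{\tilde\tau_1}\Big(\tfrac12db+i(a\,db+da)-e^b\big(a+i(a^2+\tfrac{\tilde\mu_2}2-\tfrac54)\big)ds\Big),\qquad \theta^3=e^b\,ds,$$ $$\theta^4=e^{-3b}dt-\tfrac{\tilde\mu_2}{\tilde\tau_1^2}(da+a\,db)+\Big(F(s)e^{-3b}-6ae^{-2b}t+\tfrac{\tilde\mu_2}{\tilde\tau_1^2}\big(a^2+\tfrac{\tilde\mu_2}4-\tfrac58\big)e^b\Big)ds .$$ **The Karlhede algorithm** for a metric over an open set $W$, with $G_{-1}=O(\eta)$ (all $\eta$-orthogonal frames), or $G_{-1}=SO(\eta)$ (oriented ones), and $t_{-1}=0$: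 at stage $q=0,1,\dots$ bring $\nabla^{(q)}R$ into a standard form by means of the frames permitted so far; $G_q\subset G_{q-1}$ is the isotropy group of $\nabla^{(q)}R$ (the same at all points of $W$) and describes the remaining frame freedom; the components of $R,\dots,\nabla^{(q)}R$ in a smooth permitted frame field are then differential invariants, and $t_q$ is the number of functionally independent ones, i.e. the dimension of the span of their differentials, assumed constant on $W$. The algorithm terminates at the first $q$ for which neither $\dim G_q<\dim G_{q-1}$ nor $t_q>t_{q-1}$; this $q$ is the invariant-classification (IC) order. **Theorem.** 1. $g$ is a smooth Lorentzian metric. Its Weyl tensor is nonzero and of Petrov type N at every point, with quadruple principal null vector $k$, where $k^\flat=\theta^3$, and $\mathrm{Ric}=-6\tilde\tau_1^2\,g+(5\tilde\mu_2-8)\,\theta^3\otimes\theta^3$ (null radiation aligned with $k$ and a negative cosmological constant). 2. Over every nonempty open subset $W$ of the coordinate domain the algorithm can be carried out to termination with $G_{-1}=SO(\eta)$, and also with $G_{-1}=O(\eta)$ if $t\ne0$ on $W$. Whenever it can be carried out to termination, with either choice of $G_{-1}$ and for every choice of standard forms, $$(t_0,\dots,t_7)=(0,0,0,1,2,3,4,4),\qquad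 (\dim G_0,\dots,\dim G_7)=(2,1,0,0,0,0,0,0),$$ and the IC order is exactly $7$. 3. The bound $7$ for type N is sharp: with either choice of $G_{-1}$, the largest IC order that the algorithm yields for four-dimensional Lorentzian metrics whose Weyl tensor is everywhere of Petrov type N is $7$. 4. $F_2(J)$ is open, and there is a smooth function $\phi$ on $F_2(J)$ with $F_2'(s)F(s)^{-1/4}=\phi(F_2(s))$ for $s\in J$. The metric is classified by the essential constants $\tilde\tau_1^2$, $\tilde\mu_2$ and the essential function $\phi$: let $g$ and $g'$ be two metrics of the family, with data $(\tilde\tau_1,\tilde\mu_2,J,F,\phi)$ and $(\tilde\tau_1',\tilde\mu_2',J',F',\phi')$ (here primes denote the second set of data). Some point of the first has a neighbourhood isometric to an open subset of the second if and only if $\tilde\tau_1^2=\tilde\tau_1'^2$, $\tilde\mu_2=\tilde\mu_2'$ and, for some sign $\varepsilon=\pm1$, $\phi'=\varepsilon\phi$ near some point of the intersection of the (open) domains of $\phi$ and $\phi'$. More precisely, with $$I_1=e^{-3b}t,\quad I_2=\log F(s)-4b,\quad I_3=e^{-b}F_1(s)-8a,\quad I_4=F_2(s),$$ and $I_1',\dots,I_4'$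 the corresponding functions for $g'$, there is a local isometry taking the point $p$ to the point $p'$ if and only if $\tilde\tau_1^2=\tilde\tau_1'^2$, $\tilde\mu_2=\tilde\mu_2'$ and, for some $\varepsilon=\pm1$, $I_1'(p')=\varepsilon I_1(p)$, $I_2'(p')=I_2(p)$, $I_3'(p')=\varepsilon I_3(p)$, $I_4'(p')=I_4(p)$ and $\phi'=\varepsilon\phi$ near $I_4(p)$. -/

import Mathlib

open scoped ContDiff Topology

noncomputable section

namespace Karlhede

/-! ### Tensor calculus on open subsets of `ℝⁿ`

A metric is given by its matrix of coordinate components; a covariant `k`-tensor at a point is the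
array of its components, indexed by `Fin k → Fin n`. -/

/-- Arrays of components of covariant `k`-tensors in dimension `n`. -/
abbrev Arr (n k : ℕ) : Type := (Fin k → Fin n) → ℝ

/-- Fields of `n × n` matrices on `ℝⁿ`. -/
abbrev MatField (n : ℕ) : Type := (Fin n → ℝ) → Matrix (Fin n) (Fin n) ℝ

/-- The partial derivative `∂f/∂x^c`. -/
def pd {n : ℕ} (c : Fin n) (f : (Fin n → ℝ) → ℝ) (x : Fin n → ℝ) : ℝ :=
  fderiv ℝ f x (Pi.single c 1)

/-- Smoothness of a field of matrices on `W`, entry by entry. -/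
def SmoothOn {n : ℕ} (m : MatField n) (W : Set (Fin n → ℝ)) : Prop :=
  ∀ i j, ContDiffOn ℝ ∞ (fun x => m x i j) W

/-- `g` is a smooth pseudo-Riemannian metric on `W` with the signature of the form `η`. -/
def IsMetricOn {n : ℕ} (η : Matrix (Fin n) (Fin n) ℝ) (g : MatField n)
    (W : Set (Fin n → ℝ)) : Prop :=
  SmoothOn g W ∧ ∀ x ∈ W, ∃ e : Matrix (Fin n) (Fin n) ℝ,
    (g x).IsSymm ∧ IsUnit e.det ∧ e.transpose * g x * e = η

/-- The Christoffel symbol `Γ^d_{ca}` of the Levi-Civita connection. -/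
def christoffel {n : ℕ} (g : MatField n) (x : Fin n → ℝ) (d c a : Fin n) : ℝ :=
  (1 / 2) * ∑ k, (g x)⁻¹ d k *
    (pd c (fun y => g y k a) x + pd a (fun y => g y k c) x - pd k (fun y => g y c a) x)

/-- The curvature components `R^m_{bcd}`, where
`R(∂_c, ∂_d) ∂_b = ∇_c ∇_d ∂_b - ∇_d ∇_c ∂_b = R^m_{bcd} ∂_m`. -/
def riemUp {n : ℕ} (g : MatField n) (x : Fin n → ℝ) (m b c d : Fin n) : ℝ :=
  pd c (fun y => christoffel g y m d b) x - pd d (fun y => christoffel g y m c b) x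
    + ∑ e, (christoffel g x m c e * christoffel g x e d b
      - christoffel g x m d e * christoffel g x e c b)

/-- The curvature components `R_{abcd}`. -/
def riem {n : ℕ} (g : MatField n) (x : Fin n → ℝ) (a b c d : Fin n) : ℝ :=
  ∑ m, g x a m * riemUp g x m b c d

/-- The covariant derivative of a covariant tensor field; the new index comes last. -/
def covD {n : ℕ} (g : MatField n) {k : ℕ} (T : (Fin n → ℝ) → Arr n k) :
    (Fin n → ℝ) → Arr n (k + 1) := fun x i =>
  pd (i (Fin.last k)) (fun y => T y (fun j => i j.castSucc)) x
    - ∑ j : Fin k, ∑ d : Fin n, christoffel g x d (i (Fin.last k)) (i j.castSucc) *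
        T x (Function.update (fun l => i l.castSucc) j d)

/-- The `q`-th covariant derivative `∇^(q) R` of the curvature tensor. -/
def nablaR {n : ℕ} (g : MatField n) : (q : ℕ) → (Fin n → ℝ) → Arr n (4 + q)
  | 0 => fun x (i : Fin 4 → Fin n) => riem g x (i 0) (i 1) (i 2) (i 3)
  | q + 1 => covD g (nablaR g q)

/-- The Ricci tensor `R_{bd} = R^a_{bad}`. -/
def ricci {n : ℕ} (g : MatField n) (x : Fin n → ℝ) (b d : Fin n) : ℝ :=
  ∑ a, riemUp g x a b a d

/-- The scalar curvature. -/
def scal {n : ℕ} (g : MatField n) (x : Fin n → ℝ) : ℝ :=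
  ∑ b, ∑ d, (g x)⁻¹ b d * ricci g x b d

/-- The Weyl tensor in dimension four. -/
def weyl (g : MatField 4) (x : Fin 4 → ℝ) (a b c d : Fin 4) : ℝ :=
  riem g x a b c d
    - (1 / 2) * (g x a c * ricci g x b d - g x a d * ricci g x b c
        - g x b c * ricci g x a d + g x b d * ricci g x a c)
    + (scal g x / 6) * (g x a c * g x b d - g x a d * g x b c)

/-- The Weyl tensor is nonzero and of Petrov type N at `x`, with quadruple principal null
vector `k`. -/
def IsTypeNAlong (g : MatField 4) (x k : Fin 4 → ℝ) : Prop :=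
  k ≠ 0 ∧ ∑ i, ∑ j, g x i j * k i * k j = 0 ∧
    (∀ b c d, ∑ a, k a * weyl g x a b c d = 0) ∧ ∃ a b c d, weyl g x a b c d ≠ 0

/-- The Weyl tensor is of Petrov type N at `x`. -/
def IsTypeN (g : MatField 4) (x : Fin 4 → ℝ) : Prop := ∃ k, IsTypeNAlong g x k

/-! ### Frames, isotropy groups and the Karlhede algorithm -/

/-- The components of the tensor `T` in the frame whose `a`-th vector is the `a`-th column of `e`.
The same formula is the action of a matrix on arrays of frame components. -/
def comp {n k : ℕ} (T : Arr n k) (e : Matrix (Fin n) (Fin n) ℝ) : Arr n k := fun i =>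
  ∑ j : Fin k → Fin n, (∏ m, e (j m) (i m)) * T j

/-- The orthogonal group `O(η)` (for `o = false`), or `SO(η)` (for `o = true`). -/
def orthGroup {n : ℕ} (o : Bool) (η : Matrix (Fin n) (Fin n) ℝ) :
    Set (Matrix (Fin n) (Fin n) ℝ) :=
  {X | X.transpose * η * X = η ∧ (o = true → X.det = 1)}

/-- The `η`-orthogonal frames at `x`: all of them (for `o = false`), or those that are positively
oriented with respect to the coordinates (for `o = true`). -/
def orthFrames {n : ℕ} (o : Bool) (η : Matrix (Fin n) (Fin n) ℝ) (g : MatField n)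
    (x : Fin n → ℝ) : Set (Matrix (Fin n) (Fin n) ℝ) :=
  {e | e.transpose * g x * e = η ∧ (o = true → 0 < e.det)}

/-- The dimension of a closed matrix group, that is, the dimension of its Lie algebra. -/
def groupDim {n : ℕ} (G : Set (Matrix (Fin n) (Fin n) ℝ)) : ℕ :=
  Set.finrank ℝ {A : Matrix (Fin n) (Fin n) ℝ | ∀ s : ℝ, NormedSpace.exp (s • A) ∈ G}

/-- Given sets `std q` of standard forms for the components of `∇^(q) R`, the frames at `x` that
are permitted before stage `q` of the algorithm: those in which `∇^(j) R` is in standard form for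
all `j < q`. -/
def permitted {n : ℕ} (o : Bool) (η : Matrix (Fin n) (Fin n) ℝ) (g : MatField n)
    (std : (q : ℕ) → Set (Arr n (4 + q))) :
    ℕ → (Fin n → ℝ) → Set (Matrix (Fin n) (Fin n) ℝ)
  | 0, x => orthFrames o η g x
  | q + 1, x => {e ∈ permitted o η g std q x | comp (nablaR g q x) e ∈ std q}

/-- `before a u q` is `u_{q-1}`, with the convention `u_{-1} = a`. -/
def before {α : Type} (a : α) (u : ℕ → α) : ℕ → α
  | 0 => a
  | q + 1 => u q

/-- A run of the Karlhede algorithm on the metric `g` over `W`: the stages `q = 0, …, last` are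
carried out and the algorithm terminates at stage `last`, which is the invariant-classification
order found by the run. -/
structure KarlhedeRun {n : ℕ} (o : Bool) (η : Matrix (Fin n) (Fin n) ℝ) (g : MatField n)
    (W : Set (Fin n → ℝ)) where
  /-- The stage at which the algorithm terminates. -/
  last : ℕ
  /-- The standard forms chosen at stage `q`. -/
  std : (q : ℕ) → Set (Arr n (4 + q))
  /-- The isotropy groups `G_q`. -/
  G : ℕ → Set (Matrix (Fin n) (Fin n) ℝ)
  /-- A frame field over `W` that is permitted after the normalization at stage `q`. -/
  frame : ℕ → MatField n
  /-- The number `t_q` of independent functions among the components of `R, …, ∇^(q) R`. -/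
  t : ℕ → ℕ
  frame_smooth : ∀ q ≤ last, SmoothOn (frame q) W
  frame_mem : ∀ q ≤ last, ∀ x ∈ W, frame q x ∈ permitted o η g std (q + 1) x
  /-- The standard form of `∇^(q) R` at a point is unique. -/
  std_unique : ∀ q ≤ last, ∀ x ∈ W, ∀ e ∈ permitted o η g std (q + 1) x,
    ∀ e' ∈ permitted o η g std (q + 1) x, comp (nablaR g q x) e = comp (nablaR g q x) e'
  /-- `G_q` is the isotropy group of `∇^(q) R` in `G_{q-1}`, where `G_{-1}` is the whole group. -/
  isotropy : ∀ q ≤ last, ∀ x ∈ W, ∀ e ∈ permitted o η g std (q + 1) x,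
    G q = {X ∈ before (orthGroup o η) G q |
      comp (comp (nablaR g q x) e) X = comp (nablaR g q x) e}
  /-- The differentials of the components of `R, …, ∇^(q) R` span a space of dimension `t_q`. -/
  rank : ∀ q ≤ last, ∀ x ∈ W, Set.finrank ℝ
    {α : (Fin n → ℝ) →L[ℝ] ℝ | ∃ j ≤ q, ∃ i : Fin (4 + j) → Fin n,
      α = fderiv ℝ (fun y => comp (nablaR g j y) (frame q y) i) x} = t q
  continues : ∀ q < last, groupDim (G q) < groupDim (before (orthGroup o η) G q) ∨
    before 0 t q < t q
  terminates : ¬ (groupDim (G last) < groupDim (before (orthGroup o η) G last) ∨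
    before 0 t last < t last)

/-- The Lorentzian form `(E¹)² + (E²)² - 2 E³ E⁴`; with `θ¹ = (E¹ + i E²)/√2`, `θ² = (E¹ - i E²)/√2`,
`θ³ = E³`, `θ⁴ = E⁴` it is `2 θ¹ θ² - 2 θ³ θ⁴`. -/
def etaNull : Matrix (Fin 4) (Fin 4) ℝ :=
  !![1, 0, 0, 0; 0, 1, 0, 0; 0, 0, 0, -1; 0, 0, -1, 0]

/-- The orders at which the algorithm terminates for Lorentzian metrics of Petrov type N. -/
def typeNOrders (o : Bool) : Set ℕ :=
  {N | ∃ (W : Set (Fin 4 → ℝ)) (g : MatField 4), IsOpen W ∧ W.Nonempty ∧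
    IsMetricOn etaNull g W ∧ (∀ x ∈ W, IsTypeN g x) ∧
    ∃ r : KarlhedeRun o etaNull g W, r.last = N}

/-- There is a local isometry from `(W, g)` to `(W', g')` that takes `p` to `p'`. -/
def LocallyIsometricAt (g : MatField 4) (W : Set (Fin 4 → ℝ)) (p : Fin 4 → ℝ)
    (g' : MatField 4) (W' : Set (Fin 4 → ℝ)) (p' : Fin 4 → ℝ) : Prop :=
  ∃ ψ : OpenPartialHomeomorph (Fin 4 → ℝ) (Fin 4 → ℝ),
    p ∈ ψ.source ∧ ψ.source ⊆ W ∧ ψ.target ⊆ W' ∧ ψ p = p' ∧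
    ContDiffOn ℝ ∞ ψ ψ.source ∧ ContDiffOn ℝ ∞ ψ.symm ψ.target ∧
    ∀ x ∈ ψ.source, ∀ i j, g x i j =
      ∑ k, ∑ l, pd i (fun y => ψ y k) x * pd j (fun y => ψ y l) x * g' (ψ x) k l

/-! ### The family of metrics; the coordinates are `(a, b, s, t) = (x 0, x 1, x 2, x 3)` -/

/-- `F₁ = F'/F`. -/
def F₁ (F : ℝ → ℝ) (s : ℝ) : ℝ := deriv F s / F s

/-- `F₂ = (F₁' - F₁²/8)/√F`. -/
def F₂ (F : ℝ → ℝ) (s : ℝ) : ℝ := (deriv (F₁ F) s - F₁ F s ^ 2 / 8) / √(F s)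

/-- The admissible parameters: constants `τ ≠ 0`, `μ ≠ 8/5` and a smooth positive function `F` with
nowhere vanishing `F₂'` on an open interval `J`. -/
structure Admissible (τ μ : ℝ) (J : Set ℝ) (F : ℝ → ℝ) : Prop where
  tau_ne : τ ≠ 0
  mu_ne : μ ≠ 8 / 5
  isOpen : IsOpen J
  nonempty : J.Nonempty
  interval : J.OrdConnected
  smooth : ContDiffOn ℝ ∞ F J
  pos : ∀ s ∈ J, 0 < F s
  deriv_ne : ∀ s ∈ J, deriv (F₂ F) s ≠ 0

/-- The coordinate domain. -/
def domain (J : Set ℝ) : Set (Fin 4 → ℝ) := {x | x 2 ∈ J}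

/-- The null coframe: `coframe τ μ F x A` lists the coefficients of `θ^{A+1}` with respect to
`da, db, ds, dt`. -/
def coframe (τ μ : ℝ) (F : ℝ → ℝ) (x : Fin 4 → ℝ) : Fin 4 → Fin 4 → ℂ :=
  let a := x 0
  let b := x 1
  let s := x 2
  let t := x 3
  ![![Complex.I / τ, (1 / 2 + Complex.I * a) / τ,
      -(Real.exp b * (a + Complex.I * (a ^ 2 + μ / 2 - 5 / 4))) / τ, 0],
    ![-Complex.I / τ, (1 / 2 - Complex.I * a) / τ,
      -(Real.exp b * (a - Complex.I * (a ^ 2 + μ / 2 - 5 / 4))) / τ, 0],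
    ![0, 0, Real.exp b, 0],
    ![-(μ / τ ^ 2), -(μ / τ ^ 2 * a),
      F s * Real.exp (-3 * b) - 6 * a * Real.exp (-2 * b) * t
        + μ / τ ^ 2 * (a ^ 2 + μ / 4 - 5 / 8) * Real.exp b,
      Real.exp (-3 * b)]]

/-- The metric `g = 2 θ¹ θ² - 2 θ³ θ⁴` (a symmetric product, whose values are real). -/
def metric (τ μ : ℝ) (F : ℝ → ℝ) : MatField 4 := fun x => Matrix.of fun i j =>
  (coframe τ μ F x 0 i * coframe τ μ F x 1 j + coframe τ μ F x 1 i * coframe τ μ F x 0 j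
    - coframe τ μ F x 2 i * coframe τ μ F x 3 j - coframe τ μ F x 3 i * coframe τ μ F x 2 j).re

/-- The invariant `I₁ = e^{-3b} t`. -/
def I₁ (x : Fin 4 → ℝ) : ℝ := Real.exp (-3 * x 1) * x 3

/-- The invariant `I₂ = log F(s) - 4b`. -/
def I₂ (F : ℝ → ℝ) (x : Fin 4 → ℝ) : ℝ := Real.log (F (x 2)) - 4 * x 1

/-- The invariant `I₃ = e^{-b} F₁(s) - 8a`. -/
def I₃ (F : ℝ → ℝ) (x : Fin 4 → ℝ) : ℝ := Real.exp (-x 1) * F₁ F (x 2) - 8 * x 0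

/-- The invariant `I₄ = F₂(s)`. -/
def I₄ (F : ℝ → ℝ) (x : Fin 4 → ℝ) : ℝ := F₂ F (x 2)

/-- `φ` is the essential function: `F₂' F^{-1/4} = φ(F₂)` on `J`. -/
def IsEssentialFunction (J : Set ℝ) (F φ : ℝ → ℝ) : Prop :=
  ∀ s ∈ J, deriv (F₂ F) s * F s ^ (-(1 / 4) : ℝ) = φ (F₂ F s)

end Karlhede

end

noncomputable section

namespace Karlhede

/-! ### Linear and infinitesimal substitutions in arrays -/

section Arrays

variable {n k : ℕ}

open Matrix

/-! Put κ = |τ|/√2. Write e₁, …, e₄ for the real null frame `frm`, dual to `cof`. Its connection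
coefficients `gam` are constants plus I₁ times one fixed matrix, and that matrix is the generator N
= `nul 0 1` of a null rotation about e₄, occurring in the direction e₃ only (`dgam_eq`). The
curvature components are constants `C₀` not involving F (`Om_eq`). For constant components the
covariant derivative is purely algebraic (`covC`). Since N annihilates `C₀` and `C₁` but not `C₂`
(`act_nul_C₀`, `act_nul_C₁`, `act_nul_C₂`), the components of R, ∇R, ∇²R are constant, and I₁ enters
for the first time in ∇³R, affinely.

The stabilizers shrink one dimension per order: null rotations about e₄, then one of the two
parameters, then only the reflection diag(1,-1,-1,-1) (`stabilizer_C₀`, `stabilizer_C₁`,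
`stabilizer_C₂`). This gives the dimensions 2, 1, 0. The reflection changes the sign of I₁ and is
first seen by ∇³R.

From then on each order produces one new function. With J = exp I₂, the derivative along e₃ takes I₁
to -J plus a constant, J to J·I₃, and I₃ to √J·I₄ plus a polynomial in I₃. Components of ∇³R, ∇⁴R,
∇⁵R are polynomials in the first one, two, three of I₁, J, I₃ (`pol_frameC`), and suitable
components contain the next invariant as a leading term (`exists_leading`). As the four
differentials are independent, t_q = min(q - 2, 4) with truncated subtraction (`finrank_cspan`).

An arbitrary run uses frames `frm * Y`. Constancy of `C₀`, `C₁`, `C₂` and uniqueness of the standard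
forms determine Y up to the reflection once q ≥ 2, and continuity makes Y locally constant; so ranks
and group dimensions do not depend on the choices (`KarlhedeRun.t_eq`, `KarlhedeRun.groupDim_eq`). A
run exists as soon as the reflection can be excluded: by orientation, or by requiring I₁ > 0 after a
reflection where t ≠ 0 (`nonempty_run`).

The general bound is a count. The isotropy algebra of a type N curvature tensor consists, in an
adapted frame, of null rotations, so dim G₀ ≤ 2 (`groupDim_isotropy_le_two`); every later stage that
does not terminate lowers the dimension or raises t ≤ 4, and one further stage ends the algorithm: 2
+ 4 + 1 = 7 (`KarlhedeRun.last_le`).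

For the classification, naturality of ∇^(q)R (`nablaR_natural`) and the stabilizers show that an
isometry matches the constants and maps the frame to the frame up to the reflection
(`isometry_frame`); differentiating the relation between the values of I₁ yields the relations for
J, I₃, I₄ and φ. Conversely I₁, J, I₃, I₄ are local coordinates whose frame derivatives are
functions of themselves and φ, so the map that matches them matches the coframes up to sign and
hence the metrics (`metric_eq_of_inv`). -/

theorem comp_one (T : Arr n k) : comp T 1 = T := by
  funext i
  unfold comp
  rw [Finset.sum_eq_single i]
  · simp
  · intro j _ hj
    obtain ⟨m, hm⟩ := Function.ne_iff.mp hj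
    have h : ∏ m, (1 : Matrix (Fin n) (Fin n) ℝ) (j m) (i m) = 0 :=
      Finset.prod_eq_zero (Finset.mem_univ m) (Matrix.one_apply_ne hm)
    rw [h, zero_mul]
  · simp

theorem comp_comp (T : Arr n k) (X Y : Matrix (Fin n) (Fin n) ℝ) :
    comp (comp T X) Y = comp T (X * Y) := by
  funext i
  simp only [comp, Matrix.mul_apply, Finset.mul_sum]
  rw [Finset.sum_comm]
  refine Finset.sum_congr rfl fun j _ => ?_
  rw [Finset.prod_univ_sum, Fintype.piFinset_univ, Finset.sum_mul]
  refine Finset.sum_congr rfl fun l _ => ?_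
  rw [Finset.prod_mul_distrib]
  ring

theorem comp_add (T S : Arr n k) (X : Matrix (Fin n) (Fin n) ℝ) :
    comp (T + S) X = comp T X + comp S X := by
  funext i
  simp [comp, mul_add, Finset.sum_add_distrib]

theorem comp_smul (r : ℝ) (T : Arr n k) (X : Matrix (Fin n) (Fin n) ℝ) :
    comp (r • T) X = r • comp T X := by
  funext i
  simp only [comp, Pi.smul_apply, smul_eq_mul, Finset.mul_sum]
  exact Finset.sum_congr rfl fun j _ => by ring

theorem comp_zero (X : Matrix (Fin n) (Fin n) ℝ) : comp (0 : Arr n k) X = 0 := by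
  funext i
  simp [comp]

theorem comp_neg (T : Arr n k) (X : Matrix (Fin n) (Fin n) ℝ) :
    comp (-T) X = -comp T X := by
  funext i
  simp [comp, Finset.sum_neg_distrib]

theorem comp_sum {ι : Type*} (s : Finset ι) (T : ι → Arr n k) (X : Matrix (Fin n) (Fin n) ℝ) :
    comp (∑ a ∈ s, T a) X = ∑ a ∈ s, comp (T a) X := by
  classical
  induction s using Finset.induction_on with
  | empty => simp [comp_zero]
  | insert a s ha ih => rw [Finset.sum_insert ha, Finset.sum_insert ha, comp_add, ih]

theorem comp_injective {X : Matrix (Fin n) (Fin n) ℝ} (hX : IsUnit X.det) :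
    Function.Injective (fun T : Arr n k => comp T X) := by
  intro T S h
  have h2 : comp (comp T X) X⁻¹ = comp (comp S X) X⁻¹ := congrArg (fun U => comp U X⁻¹) h
  rwa [comp_comp, comp_comp, Matrix.mul_nonsing_inv _ hX, comp_one, comp_one] at h2

/-- The derivative of `comp T` at `M` in the direction `B`. -/
def dcomp (T : Arr n k) (M B : Matrix (Fin n) (Fin n) ℝ) : Arr n k := fun i =>
  ∑ j : Fin k → Fin n,
    (∑ m, (∏ l ∈ Finset.univ.erase m, M (j l) (i l)) * B (j m) (i m)) * T j

/-- The infinitesimal action of a matrix on arrays. -/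
def act (A : Matrix (Fin n) (Fin n) ℝ) (T : Arr n k) : Arr n k := fun i =>
  ∑ m, ∑ d, A d (i m) * T (Function.update i m d)

/-- Product rule, stated entry by entry so that it serves both for one-parameter groups of matrices
and for frame fields along coordinate lines. -/
theorem hasDerivAt_comp {C : ℝ → Arr n k} {C' : Arr n k} {M : ℝ → Matrix (Fin n) (Fin n) ℝ}
    {M' : Matrix (Fin n) (Fin n) ℝ} {t : ℝ} (hC : ∀ j, HasDerivAt (fun s => C s j) (C' j) t)
    (hM : ∀ a b, HasDerivAt (fun s => M s a b) (M' a b) t) (i : Fin k → Fin n) :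
    HasDerivAt (fun s => comp (C s) (M s) i) (comp C' (M t) i + dcomp (C t) (M t) M' i) t := by
  have h : ∀ j : Fin k → Fin n, HasDerivAt (fun s => (∏ m, M s (j m) (i m)) * C s j)
      ((∑ m, (∏ l ∈ Finset.univ.erase m, M t (j l) (i l)) * M' (j m) (i m)) * C t j
        + (∏ m, M t (j m) (i m)) * C' j) t := fun j => by
    have := (HasDerivAt.fun_finsetProd (u := Finset.univ)
      (f := fun m s => M s (j m) (i m)) fun m _ => hM (j m) (i m)).mul (hC j)
    simp only [smul_eq_mul] at this
    exact this
  have h2 := HasDerivAt.fun_sum (u := Finset.univ) fun j _ => h j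
  refine h2.congr_deriv ?_
  rw [Finset.sum_add_distrib, add_comm]
  rfl

theorem dcomp_add (T : Arr n k) (M B B' : Matrix (Fin n) (Fin n) ℝ) :
    dcomp T M (B + B') = dcomp T M B + dcomp T M B' := by
  funext i
  simp [dcomp, mul_add, add_mul, Finset.sum_add_distrib]

theorem dcomp_neg (T : Arr n k) (M B : Matrix (Fin n) (Fin n) ℝ) :
    dcomp T M (-B) = -dcomp T M B := by
  funext i
  simp [dcomp, Finset.sum_neg_distrib]

/-- At the identity the product over the slots other than `m` vanishes unless `j` agrees with `i`
there, so only the modifications of `i` in a single slot survive. -/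
theorem dcomp_one (T : Arr n k) (A : Matrix (Fin n) (Fin n) ℝ) : dcomp T 1 A = act A T := by
  funext i
  simp only [dcomp, act, Finset.sum_mul]
  rw [Finset.sum_comm]
  refine Finset.sum_congr rfl fun m _ => ?_
  symm
  refine Finset.sum_of_injOn (fun d => Function.update i m d)
    (fun a _ b _ h => Function.update_injective i m h) (fun _ _ => Finset.mem_univ _) ?_ ?_
  · intro j _ hj
    have : ∃ l, l ≠ m ∧ j l ≠ i l := by
      by_contra hcon
      push Not at hcon
      refine hj ⟨j m, Finset.mem_coe.mpr (Finset.mem_univ _), ?_⟩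
      funext l
      by_cases hl : l = m
      · subst hl; simp
      · simp [Function.update_of_ne hl, hcon l hl]
    obtain ⟨l, hl, hjl⟩ := this
    have h : ∏ l ∈ Finset.univ.erase m, (1 : Matrix (Fin n) (Fin n) ℝ) (j l) (i l) = 0 :=
      Finset.prod_eq_zero (Finset.mem_erase.mpr ⟨hl, Finset.mem_univ l⟩)
        (Matrix.one_apply_ne hjl)
    rw [h]
    ring
  · intro d _
    rw [Finset.prod_eq_one, Function.update_self]
    · ring
    · intro l hl
      rw [Function.update_of_ne (Finset.ne_of_mem_erase hl), Matrix.one_apply_eq]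

theorem hasDerivAt_one_add_smul (A : Matrix (Fin n) (Fin n) ℝ) (a b : Fin n) :
    HasDerivAt (fun s : ℝ => (1 + s • A) a b) (A a b) 0 := by
  have := ((hasDerivAt_id (0 : ℝ)).mul_const (A a b)).const_add ((1 : Matrix _ _ ℝ) a b)
  simpa using this

theorem hasDerivAt_comp_const (T : Arr n k) {M : ℝ → Matrix (Fin n) (Fin n) ℝ}
    {M' : Matrix (Fin n) (Fin n) ℝ} {t : ℝ}
    (hM : ∀ a b, HasDerivAt (fun s => M s a b) (M' a b) t) (i : Fin k → Fin n) :
    HasDerivAt (fun s => comp T (M s) i) (dcomp T (M t) M' i) t := by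
  have := hasDerivAt_comp (C := fun _ => T) (C' := 0) (fun j => hasDerivAt_const _ _) hM i
  simpa [comp_zero] using this

/-- Both sides are the derivative at 0 of s ↦ `comp T (X * (1 + s B))`, computed directly and
through `comp_comp`. The left-handed version uses `(1 + s B) * X`. -/
theorem dcomp_mul_right (T : Arr n k) (X B : Matrix (Fin n) (Fin n) ℝ) :
    dcomp T X (X * B) = act B (comp T X) := by
  funext i
  have h1 := hasDerivAt_comp_const (comp T X) (hasDerivAt_one_add_smul B) i
  have h2 := hasDerivAt_comp_const T (M := fun s : ℝ => X + s • (X * B)) (M' := X * B) (t := 0)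
    (fun a b => by
      simpa using ((hasDerivAt_id (0 : ℝ)).mul_const ((X * B) a b)).const_add (X a b)) i
  have h3 : (fun s : ℝ => comp (comp T X) (1 + s • B) i) =
      fun s : ℝ => comp T (X + s • (X * B)) i := by
    funext s
    rw [comp_comp, Matrix.mul_add, Matrix.mul_smul, Matrix.mul_one]
  rw [h3] at h1
  have := h2.unique h1
  simpa [dcomp_one] using this

theorem dcomp_mul_left (T : Arr n k) (X B : Matrix (Fin n) (Fin n) ℝ) :
    dcomp T X (B * X) = comp (act B T) X := by
  funext i
  have h1 := hasDerivAt_comp (C := fun s : ℝ => comp T (1 + s • B)) (C' := act B T)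
    (M := fun _ => X) (M' := 0) (t := 0)
    (fun j => by
      have := hasDerivAt_comp_const T (hasDerivAt_one_add_smul B) j
      simpa [dcomp_one] using this) (fun a b => hasDerivAt_const _ _) i
  have h2 := hasDerivAt_comp_const T (M := fun s : ℝ => X + s • (B * X)) (M' := B * X) (t := 0)
    (fun a b => by
      simpa using ((hasDerivAt_id (0 : ℝ)).mul_const ((B * X) a b)).const_add (X a b)) i
  have h3 : (fun s : ℝ => comp (comp T (1 + s • B)) X i) =
      fun s : ℝ => comp T (X + s • (B * X)) i := by
    funext s
    rw [comp_comp, Matrix.add_mul, Matrix.smul_mul, Matrix.one_mul]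
  rw [h3] at h1
  have h4 := h2.unique h1
  have h5 : dcomp (comp T (1 + (0 : ℝ) • B)) X 0 i = 0 := by simp [dcomp]
  rw [h5, add_zero] at h4
  simpa using h4

/-- Infinitesimal form of `comp_comp`: a change of frame turns the action of a generator into that
of its conjugate. -/
theorem comp_act {A B X : Matrix (Fin n) (Fin n) ℝ} (h : A * X = X * B) (T : Arr n k) :
    comp (act A T) X = act B (comp T X) := by
  rw [← dcomp_mul_left, h, dcomp_mul_right]

theorem act_add (A B : Matrix (Fin n) (Fin n) ℝ) (T : Arr n k) :
    act (A + B) T = act A T + act B T := by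
  rw [← dcomp_one, dcomp_add, dcomp_one, dcomp_one]

theorem act_neg (A : Matrix (Fin n) (Fin n) ℝ) (T : Arr n k) : act (-A) T = -act A T := by
  rw [← dcomp_one, dcomp_neg, dcomp_one]

theorem act_sub (A B : Matrix (Fin n) (Fin n) ℝ) (T : Arr n k) :
    act (A - B) T = act A T - act B T := by
  rw [sub_eq_add_neg, act_add, act_neg, sub_eq_add_neg]

theorem act_smul (r : ℝ) (A : Matrix (Fin n) (Fin n) ℝ) (T : Arr n k) :
    act (r • A) T = r • act A T := by
  funext i
  simp [act, Finset.mul_sum, mul_assoc]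

theorem act_zero_left (T : Arr n k) : act 0 T = 0 := by
  funext i
  simp [act]

theorem act_sum {ι : Type*} (s : Finset ι) (A : ι → Matrix (Fin n) (Fin n) ℝ) (T : Arr n k) :
    act (∑ a ∈ s, A a) T = ∑ a ∈ s, act (A a) T := by
  classical
  induction s using Finset.induction_on with
  | empty => simp [act_zero_left]
  | insert a s ha ih => rw [Finset.sum_insert ha, Finset.sum_insert ha, act_add, ih]

end Arrays

/-! ### One-parameter groups -/

section Exponential

variable {n k : ℕ}

attribute [local instance] Matrix.linftyOpNormedRing Matrix.linftyOpNormedAlgebra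

theorem hasDerivAt_exp_smul (A : Matrix (Fin n) (Fin n) ℝ) (t : ℝ) (a b : Fin n) :
    HasDerivAt (fun s : ℝ => NormedSpace.exp (s • A) a b)
      ((NormedSpace.exp (t • A) * A) a b) t := by
  have h : HasDerivAt (fun s : ℝ => NormedSpace.exp (s • A)) (NormedSpace.exp (t • A) * A) t :=
    hasDerivAt_exp_smul_const A t
  have h2 := (hasDerivAt_pi.mp (hasDerivAt_pi.mp h a)) b
  exact h2

end Exponential

section Exponential

variable {n k : ℕ}

/-- Since `A` commutes with its exponential, the derivative in s is the transform of `act A T`,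
which is zero. Together with the converse below it translates stabilizers into Lie algebras. -/
theorem comp_exp_smul {A : Matrix (Fin n) (Fin n) ℝ} {T : Arr n k} (h : act A T = 0) (s : ℝ) :
    comp T (NormedSpace.exp (s • A)) = T := by
  funext i
  have hd : ∀ t : ℝ, HasDerivAt (fun s : ℝ => comp T (NormedSpace.exp (s • A)) i) 0 t := fun t => by
    have h1 := hasDerivAt_comp_const T (fun a b => hasDerivAt_exp_smul A t a b) i
    have hc : NormedSpace.exp (t • A) * A = A * NormedSpace.exp (t • A) :=
      (((Commute.refl A).smul_right t).exp_right).eq.symm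
    rwa [hc, dcomp_mul_left, h, comp_zero] at h1
  have := is_const_of_deriv_eq_zero (fun t => (hd t).differentiableAt) (fun t => (hd t).deriv) s 0
  simpa [comp_one] using this

theorem act_eq_zero_of_comp_exp {A : Matrix (Fin n) (Fin n) ℝ} {T : Arr n k}
    (h : ∀ s : ℝ, comp T (NormedSpace.exp (s • A)) = T) : act A T = 0 := by
  funext i
  have h1 := hasDerivAt_comp_const T (fun a b => hasDerivAt_exp_smul A 0 a b) i
  simp only [h] at h1
  have h2 := h1.unique (hasDerivAt_const (0 : ℝ) (T i))
  simpa [dcomp_one] using h2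

/-- Transfers information on the shape of the elements of a group to its generators. -/
theorem deriv_entry_of_exp {A : Matrix (Fin n) (Fin n) ℝ} {a b : Fin n} {r : ℝ}
    (h : ∀ s : ℝ, NormedSpace.exp (s • A) a b = r) : A a b = 0 := by
  have h1 := hasDerivAt_exp_smul A 0 a b
  simp only [h] at h1
  have h2 := h1.unique (hasDerivAt_const (0 : ℝ) r)
  simpa using h2

end Exponential

/-! ### Groups and their dimensions -/

section Groups

variable {n k : ℕ}

/-- The dimension is that of the linear span of the generators, so an enclosing subspace bounds it
without any proof that the generators themselves form a subspace. -/
theorem groupDim_le {G : Set (Matrix (Fin n) (Fin n) ℝ)}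
    (p : Submodule ℝ (Matrix (Fin n) (Fin n) ℝ))
    (h : ∀ A, (∀ s : ℝ, NormedSpace.exp (s • A) ∈ G) → A ∈ p) :
    groupDim G ≤ Module.finrank ℝ p :=
  Submodule.finrank_mono (Submodule.span_le.mpr h)

theorem le_groupDim {G : Set (Matrix (Fin n) (Fin n) ℝ)}
    (p : Submodule ℝ (Matrix (Fin n) (Fin n) ℝ))
    (h : ∀ A ∈ p, ∀ s : ℝ, NormedSpace.exp (s • A) ∈ G) :
    Module.finrank ℝ p ≤ groupDim G :=
  Submodule.finrank_mono fun A hA => Submodule.subset_span (h A hA)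

theorem groupDim_mono {G H : Set (Matrix (Fin n) (Fin n) ℝ)} (h : G ⊆ H) :
    groupDim G ≤ groupDim H :=
  Submodule.finrank_mono (Submodule.span_mono fun _ hA s => h (hA s))

/-- Exponentials commute with conjugation, so A ↦ Y A Y⁻¹ is a linear bijection between the two sets
of generators. Isotropy groups can therefore be computed in any convenient frame. -/
theorem groupDim_conj {Y : Matrix (Fin n) (Fin n) ℝ} (hY : IsUnit Y.det)
    (G : Set (Matrix (Fin n) (Fin n) ℝ)) :
    groupDim {X | Y * X * Y⁻¹ ∈ G} = groupDim G := by
  have hU : IsUnit Y := (Matrix.isUnit_iff_isUnit_det Y).mpr hY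
  let f : Matrix (Fin n) (Fin n) ℝ →ₗ[ℝ] Matrix (Fin n) (Fin n) ℝ :=
    (LinearMap.mulLeft ℝ Y).comp (LinearMap.mulRight ℝ Y⁻¹)
  have hf : ∀ A, f A = Y * A * Y⁻¹ := fun A => by simp [f, Matrix.mul_assoc]
  have hinj : Function.Injective f := fun A B h => by
    rw [hf, hf] at h
    have h2 : Y⁻¹ * (Y * A * Y⁻¹) * Y = Y⁻¹ * (Y * B * Y⁻¹) * Y := by rw [h]
    simpa [Matrix.mul_assoc, Matrix.nonsing_inv_mul _ hY,
      Matrix.nonsing_inv_mul_cancel_left _ _ hY] using h2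
  have hset : f '' {A | ∀ s : ℝ, NormedSpace.exp (s • A) ∈ {X | Y * X * Y⁻¹ ∈ G}} =
      {A | ∀ s : ℝ, NormedSpace.exp (s • A) ∈ G} := by
    ext B
    constructor
    · rintro ⟨A, hA, rfl⟩ s
      rw [hf, ← Matrix.smul_mul, ← Matrix.mul_smul, Matrix.exp_conj _ _ hU]
      exact hA s
    · intro hB
      refine ⟨Y⁻¹ * B * Y, fun s => ?_, ?_⟩
      · change Y * NormedSpace.exp (s • (Y⁻¹ * B * Y)) * Y⁻¹ ∈ G
        rw [← Matrix.exp_conj _ _ hU]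
        have : Y * s • (Y⁻¹ * B * Y) * Y⁻¹ = s • B := by
          simp [Matrix.mul_assoc, Matrix.mul_nonsing_inv _ hY,
            Matrix.mul_nonsing_inv_cancel_left _ _ hY]
        rw [this]
        exact hB s
      · rw [hf]
        simp [Matrix.mul_assoc, Matrix.mul_nonsing_inv _ hY,
            Matrix.mul_nonsing_inv_cancel_left _ _ hY]
  unfold groupDim
  rw [← hset]
  unfold Set.finrank
  rw [Submodule.span_image]
  exact (Submodule.equivMapOfInjective f hinj _).finrank_eq

/-- exp(sA) is the square of exp((s/2)A), hence the identity for every s. This covers the trivial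
group and the group generated by the residual reflection. -/
theorem groupDim_eq_zero_of_involutive {G : Set (Matrix (Fin n) (Fin n) ℝ)}
    (h : ∀ X ∈ G, X * X = 1) : groupDim G = 0 := by
  have h1 : ∀ A, (∀ s : ℝ, NormedSpace.exp (s • A) ∈ G) → A ∈ (⊥ : Submodule ℝ _) := by
    intro A hA
    rw [Submodule.mem_bot]
    have h2 : ∀ s : ℝ, NormedSpace.exp (s • A) = 1 := fun s => by
      have h3 := h _ (hA (s / 2))
      rw [← Matrix.exp_add_of_commute _ _ (Commute.refl _), ← add_smul, add_halves] at h3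
      exact h3
    ext a b
    exact deriv_entry_of_exp (r := (1 : Matrix _ _ ℝ) a b) fun s => by rw [h2 s]
  have := groupDim_le ⊥ h1
  simpa using this

end Groups

/-! ### Arrays with two and four indices -/

section LowRank

variable {n : ℕ}

/-- A matrix as an array with two indices. -/
def arr2 (P : Matrix (Fin n) (Fin n) ℝ) : Arr n 2 := fun i => P (i 0) (i 1)

/-- The outer product of two matrices, as an array with four indices. -/
def arr4 (P Q : Matrix (Fin n) (Fin n) ℝ) : Arr n 4 := fun i => P (i 0) (i 1) * Q (i 2) (i 3)

theorem sum_fin_two_fun {M : Type*} [AddCommMonoid M] (f : (Fin 2 → Fin n) → M) :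
    ∑ j, f j = ∑ a, ∑ b, f ![a, b] := by
  rw [← Fintype.sum_prod_type']
  refine Fintype.sum_equiv (finTwoArrowEquiv (Fin n)) _ _ fun j => ?_
  congr 1
  funext i
  fin_cases i <;> rfl

theorem sum_fin_four_fun {M : Type*} [AddCommMonoid M] (f : (Fin 4 → Fin n) → M) :
    ∑ j, f j = ∑ a, ∑ b, ∑ c, ∑ d, f ![a, b, c, d] := by
  have h : ∀ a b, ∑ c, ∑ d, f ![a, b, c, d] = ∑ p : Fin n × Fin n, f ![a, b, p.1, p.2] :=
    fun a b => (Fintype.sum_prod_type' (fun c d => f ![a, b, c, d])).symm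
  simp only [h]
  have h2 : ∀ a, ∑ b, ∑ p : Fin n × Fin n, f ![a, b, p.1, p.2] =
      ∑ p : Fin n × Fin n × Fin n, f ![a, p.1, p.2.1, p.2.2] :=
    fun a => (Fintype.sum_prod_type' (fun b (p : Fin n × Fin n) => f ![a, b, p.1, p.2])).symm
  simp only [h2]
  rw [← Fintype.sum_prod_type' (fun a (p : Fin n × Fin n × Fin n) => f ![a, p.1, p.2.1, p.2.2])]
  refine Fintype.sum_equiv ⟨fun j => (j 0, j 1, j 2, j 3), fun p => ![p.1, p.2.1, p.2.2.1, p.2.2.2],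
    fun j => ?_, fun p => rfl⟩ _ _ fun j => ?_
  · funext i
    fin_cases i <;> rfl
  · congr 1
    funext i
    fin_cases i <;> rfl

theorem comp_arr2 (P X : Matrix (Fin n) (Fin n) ℝ) :
    comp (arr2 P) X = arr2 (X.transpose * P * X) := by
  funext i
  simp only [comp, arr2, sum_fin_two_fun, Fin.prod_univ_two, Matrix.mul_apply,
    Matrix.transpose_apply, Matrix.cons_val_zero, Matrix.cons_val_one, Finset.sum_mul]
  rw [Finset.sum_comm]
  exact Finset.sum_congr rfl fun _ _ => Finset.sum_congr rfl fun _ _ => by ring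

theorem comp_arr4 (P Q X : Matrix (Fin n) (Fin n) ℝ) :
    comp (arr4 P Q) X = arr4 (X.transpose * P * X) (X.transpose * Q * X) := by
  funext i
  have h : ∀ (P : Matrix (Fin n) (Fin n) ℝ) a b, (X.transpose * P * X) a b =
      ∑ c, ∑ d, X c a * X d b * P c d := fun P a b => by
    simp only [Matrix.mul_apply, Matrix.transpose_apply, Finset.sum_mul]
    rw [Finset.sum_comm]
    exact Finset.sum_congr rfl fun _ _ => Finset.sum_congr rfl fun _ _ => by ring
  simp only [comp, arr4, sum_fin_four_fun, Fin.prod_univ_four, h]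
  rw [Finset.sum_mul]
  refine Finset.sum_congr rfl fun a _ => ?_
  rw [Finset.sum_mul]
  refine Finset.sum_congr rfl fun b _ => ?_
  rw [Finset.mul_sum]
  refine Finset.sum_congr rfl fun c _ => ?_
  rw [Finset.mul_sum]
  refine Finset.sum_congr rfl fun d _ => ?_
  change X a (i 0) * X b (i 1) * X c (i 2) * X d (i 3) * (P a b * Q c d) = _
  ring

theorem act_arr2 (P A : Matrix (Fin n) (Fin n) ℝ) :
    act A (arr2 P) = arr2 (A.transpose * P + P * A) := by
  funext i
  simp only [act, arr2, Fin.sum_univ_two, Matrix.add_apply, Matrix.mul_apply,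
    Matrix.transpose_apply]
  simp [mul_comm]

theorem arr2_injective : Function.Injective (arr2 (n := n)) := fun P Q h => by
  ext a b
  exact congrFun h ![a, b]

/-- Preserving η means stabilizing the two-index array of η, so the statements on stabilizers of
arrays apply. -/
theorem exp_smul_preserves {η A : Matrix (Fin n) (Fin n) ℝ} (h : A.transpose * η + η * A = 0)
    (s : ℝ) : (NormedSpace.exp (s • A)).transpose * η * NormedSpace.exp (s • A) = η := by
  apply arr2_injective
  rw [← comp_arr2]
  exact comp_exp_smul (by rw [act_arr2, h]; rfl) s

theorem skew_of_exp_smul {η A : Matrix (Fin n) (Fin n) ℝ}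
    (h : ∀ s : ℝ, (NormedSpace.exp (s • A)).transpose * η * NormedSpace.exp (s • A) = η) :
    A.transpose * η + η * A = 0 := by
  apply arr2_injective
  rw [← act_arr2]
  exact act_eq_zero_of_comp_exp fun s => by rw [comp_arr2, h s]

theorem det_sq_of_preserves {η X : Matrix (Fin n) (Fin n) ℝ} (hη : IsUnit η.det)
    (h : X.transpose * η * X = η) : X.det * X.det = 1 := by
  have h2 := congrArg Matrix.det h
  rw [Matrix.det_mul, Matrix.det_mul, Matrix.det_transpose] at h2
  have h3 : η.det * (X.det * X.det - 1) = 0 := by linear_combination h2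
  rcases mul_eq_zero.mp h3 with h4 | h4
  · exact absurd h4 hη.ne_zero
  · linarith

/-- The determinant squares to 1, and it is nonnegative because exp(sA) is a square; so the group
may be O(η) or SO(η). -/
theorem exp_smul_mem_orthGroup (o : Bool) {η A : Matrix (Fin n) (Fin n) ℝ} (hη : IsUnit η.det)
    (h : A.transpose * η + η * A = 0) (s : ℝ) : NormedSpace.exp (s • A) ∈ orthGroup o η := by
  refine ⟨exp_smul_preserves h s, fun _ => ?_⟩
  have h1 := det_sq_of_preserves hη (exp_smul_preserves h s)
  have h2 : 0 ≤ (NormedSpace.exp (s • A)).det := by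
    have h3 : NormedSpace.exp (s • A) =
        NormedSpace.exp ((s / 2) • A) * NormedSpace.exp ((s / 2) • A) := by
      rw [← Matrix.exp_add_of_commute _ _ (Commute.refl _), ← add_smul, add_halves]
    rw [h3, Matrix.det_mul]
    exact mul_self_nonneg _
  nlinarith

end LowRank

/-! ### The algebraic part of the covariant derivative -/

section CovC

variable {n k : ℕ}

/-- The algebraic part of the covariant derivative with connection coefficients `Γ`. -/
def covC (Γ : Fin n → Matrix (Fin n) (Fin n) ℝ) (T : Arr n k) : Arr n (k + 1) := fun i =>
  -act (Γ (i (Fin.last k))) T (fun j => i j.castSucc)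

/-- The transformation of connection coefficients under a constant change of frame. -/
def conjC (X : Matrix (Fin n) (Fin n) ℝ) (Γ : Fin n → Matrix (Fin n) (Fin n) ℝ) :
    Fin n → Matrix (Fin n) (Fin n) ℝ := fun c => ∑ d, X d c • (X⁻¹ * Γ d * X)

/-- Splits off the last slot, which carries the direction of differentiation and transforms
separately from the tensor being differentiated. -/
theorem comp_snoc (T : Arr n (k + 1)) (X : Matrix (Fin n) (Fin n) ℝ) (i : Fin (k + 1) → Fin n) :
    comp T X i = ∑ c, X c (i (Fin.last k)) *
      comp (fun j : Fin k → Fin n => T (Fin.snoc (α := fun _ => Fin n) j c)) X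
        (fun j => i j.castSucc) := by
  simp only [comp]
  rw [← (Fin.snocEquiv fun _ : Fin (k + 1) => Fin n).sum_comp, Fintype.sum_prod_type]
  refine Finset.sum_congr rfl fun c _ => ?_
  rw [Finset.mul_sum]
  refine Finset.sum_congr rfl fun j _ => ?_
  rw [Fin.prod_univ_castSucc]
  simp only [Fin.snocEquiv_apply, Fin.snoc_castSucc, Fin.snoc_last]
  rw [mul_comm (∏ l, X (j l) (i l.castSucc)), mul_assoc]
  rfl

/-- Equivariance: the direction slot mixes the coefficients linearly, and `comp_act` conjugates each
of them. Under a constant change of frame there is no inhomogeneous term. -/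
theorem comp_covC {X : Matrix (Fin n) (Fin n) ℝ} (hX : IsUnit X.det)
    (Γ : Fin n → Matrix (Fin n) (Fin n) ℝ) (T : Arr n k) :
    comp (covC Γ T) X = covC (conjC X Γ) (comp T X) := by
  funext i
  rw [comp_snoc]
  simp only [covC, conjC, Fin.snoc_castSucc, Fin.snoc_last]
  rw [act_sum, Finset.sum_apply, ← Finset.sum_neg_distrib]
  refine Finset.sum_congr rfl fun c _ => ?_
  have h : (fun j : Fin k → Fin n => -act (Γ c) T fun l => j l) = -act (Γ c) T := rfl
  rw [h, comp_neg, act_smul, comp_act (B := X⁻¹ * Γ c * X)]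
  · simp
  · rw [Matrix.mul_assoc, Matrix.mul_nonsing_inv_cancel_left _ _ hX]

theorem covC_sub (Γ Δ : Fin n → Matrix (Fin n) (Fin n) ℝ) (T : Arr n k) :
    covC (Γ - Δ) T = covC Γ T - covC Δ T := by
  funext i
  simp [covC, act_sub]
  abel

theorem covC_eq_zero_iff (Γ : Fin n → Matrix (Fin n) (Fin n) ℝ) (T : Arr n k) :
    covC Γ T = 0 ↔ ∀ c, act (Γ c) T = 0 := by
  constructor
  · intro h c
    funext j
    have := congrFun h (Fin.snoc (α := fun _ => Fin n) j c)
    simpa [covC] using this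
  · intro h
    funext i
    simp [covC, h]

/-- If `X` maps `T` to `T'`, it maps `covC Γ T` to `covC Γ' T'` exactly if `conjC X Γ - Γ'`
annihilates `T'`. -/
theorem comp_covC_eq_iff {X : Matrix (Fin n) (Fin n) ℝ} (hX : IsUnit X.det)
    {Γ Γ' : Fin n → Matrix (Fin n) (Fin n) ℝ} {T T' : Arr n k} (hT : comp T X = T') :
    comp (covC Γ T) X = covC Γ' T' ↔ ∀ c, act ((conjC X Γ - Γ') c) T' = 0 := by
  rw [comp_covC hX, hT, ← covC_eq_zero_iff, covC_sub, sub_eq_zero]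

end CovC

/-! ### Partial derivatives -/

section PartialDerivatives

variable {n : ℕ} {c : Fin n} {f f' : (Fin n → ℝ) → ℝ} {x : Fin n → ℝ} {U : Set (Fin n → ℝ)}

theorem pd_congr (h : f =ᶠ[𝓝 x] f') : pd c f x = pd c f' x := by
  unfold pd
  rw [h.fderiv_eq]

theorem pd_congr_on (hU : IsOpen U) (h : Set.EqOn f f' U) (hx : x ∈ U) : pd c f x = pd c f' x :=
  pd_congr (h.eventuallyEq_of_mem (hU.mem_nhds hx))

theorem pd_const (r : ℝ) : pd c (fun _ : Fin n → ℝ => r) x = 0 := by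
  simp [pd]

theorem pd_add (hf : DifferentiableAt ℝ f x) (hf' : DifferentiableAt ℝ f' x) :
    pd c (fun y => f y + f' y) x = pd c f x + pd c f' x := by
  simp [pd, fderiv_fun_add hf hf']

theorem pd_mul (hf : DifferentiableAt ℝ f x) (hf' : DifferentiableAt ℝ f' x) :
    pd c (fun y => f y * f' y) x = pd c f x * f' x + f x * pd c f' x := by
  simp [pd, fderiv_fun_mul hf hf']
  ring

theorem pd_sum {ι : Type*} {s : Finset ι} {f : ι → (Fin n → ℝ) → ℝ}
    (hf : ∀ a ∈ s, DifferentiableAt ℝ (f a) x) :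
    pd c (fun y => ∑ a ∈ s, f a y) x = ∑ a ∈ s, pd c (f a) x := by
  simp [pd, fderiv_fun_sum hf]

theorem fderiv_eq_sum_pd (f : (Fin n → ℝ) → ℝ) (x v : Fin n → ℝ) :
    fderiv ℝ f x v = ∑ k, v k * pd k f x := by
  conv_lhs => rw [pi_eq_sum_univ' v]
  simp [pd]

theorem pd_comp {ψ : (Fin n → ℝ) → (Fin n → ℝ)} (hf : DifferentiableAt ℝ f (ψ x))
    (hψ : ∀ k, DifferentiableAt ℝ (fun y => ψ y k) x) :
    pd c (fun y => f (ψ y)) x = ∑ k, pd c (fun y => ψ y k) x * pd k f (ψ x) := by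
  have h1 : HasFDerivAt ψ (ContinuousLinearMap.pi fun k => fderiv ℝ (fun y => ψ y k) x) x :=
    hasFDerivAt_pi.mpr fun k => (hψ k).hasFDerivAt
  have h2 := hf.hasFDerivAt.comp x h1
  have h3 : fderiv ℝ (fun y => f (ψ y)) x = _ := h2.fderiv
  rw [pd, h3, ContinuousLinearMap.comp_apply, fderiv_eq_sum_pd]
  rfl

theorem hasDerivAt_pd (hf : DifferentiableAt ℝ f x) :
    HasDerivAt (fun s : ℝ => f (x + s • Pi.single c 1)) (pd c f x) 0 := by
  have h1 : HasDerivAt (fun s : ℝ => x + s • (Pi.single c 1 : Fin n → ℝ)) (Pi.single c 1) 0 := by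
    have := ((hasDerivAt_id (0 : ℝ)).smul_const (Pi.single c 1 : Fin n → ℝ)).const_add x
    simpa using this
  have h2 : HasFDerivAt f (fderiv ℝ f x) (x + (0 : ℝ) • (Pi.single c 1 : Fin n → ℝ)) := by
    simpa using hf.hasFDerivAt
  exact h2.comp_hasDerivAt 0 h1

theorem contDiffOn_pd (hU : IsOpen U) (hf : ContDiffOn ℝ ∞ f U) (c : Fin n) :
    ContDiffOn ℝ ∞ (pd c f) U :=
  (hf.fderiv_of_isOpen hU (by simp)).clm_apply contDiffOn_const

theorem differentiableAt_of_contDiffOn (hU : IsOpen U) (hf : ContDiffOn ℝ ∞ f U) (hx : x ∈ U) :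
    DifferentiableAt ℝ f x :=
  (hf.contDiffAt (hU.mem_nhds hx)).differentiableAt (by simp)

theorem pd_comm (hU : IsOpen U) (hf : ContDiffOn ℝ ∞ f U) (hx : x ∈ U) (c d : Fin n) :
    pd c (pd d f) x = pd d (pd c f) x := by
  have h1 : ContDiffAt ℝ ∞ f x := hf.contDiffAt (hU.mem_nhds hx)
  have h2 : DifferentiableAt ℝ (fderiv ℝ f) x :=
    (h1.fderiv_right (m := 1) (WithTop.coe_le_coe.mpr le_top)).differentiableAt (by simp)
  have h3 : ∀ a b : Fin n, pd a (pd b f) x =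
      fderiv ℝ (fderiv ℝ f) x (Pi.single a 1) (Pi.single b 1) := fun a b => by
    have : fderiv ℝ (fun y => fderiv ℝ f y (Pi.single b 1)) x =
        (fderiv ℝ (fderiv ℝ f) x).flip (Pi.single b 1) := by
      have := h2.hasFDerivAt.clm_apply (hasFDerivAt_const (Pi.single b 1 : Fin n → ℝ) x)
      rw [this.fderiv]
      ext v
      simp
    change fderiv ℝ (fun y => fderiv ℝ f y (Pi.single b 1)) x (Pi.single a 1) = _
    rw [this]
    rfl
  rw [h3, h3]
  exact h1.isSymmSndFDerivAt (by simpa using WithTop.coe_le_coe.mpr (le_top : (2 : ℕ∞) ≤ ⊤)) _ _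

/-- The entrywise partial derivative of a field of matrices. -/
def pdM (c : Fin n) (m : MatField n) (x : Fin n → ℝ) : Matrix (Fin n) (Fin n) ℝ :=
  Matrix.of fun i j => pd c (fun y => m y i j) x

theorem pdM_congr_on {m m' : MatField n} (hU : IsOpen U) (h : Set.EqOn m m' U) (hx : x ∈ U) :
    pdM c m x = pdM c m' x := by
  ext i j
  exact pd_congr_on hU (fun y hy => by rw [h hy]) hx

/-- Entrywise differentiability of a field of matrices. -/
def DiffAt (m : MatField n) (x : Fin n → ℝ) : Prop :=
  ∀ i j, DifferentiableAt ℝ (fun y => m y i j) x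

theorem SmoothOn.diffAt {m : MatField n} (hU : IsOpen U) (h : SmoothOn m U) (hx : x ∈ U) :
    DiffAt m x := fun i j => differentiableAt_of_contDiffOn hU (h i j) hx

theorem SmoothOn.mul {m m' : MatField n} (h : SmoothOn m U) (h' : SmoothOn m' U) :
    SmoothOn (fun y => m y * m' y) U := fun i j => by
  simp only [Matrix.mul_apply]
  exact ContDiffOn.sum fun k _ => (h i k).mul (h' k j)

theorem SmoothOn.transpose {m : MatField n} (h : SmoothOn m U) :
    SmoothOn (fun y => (m y).transpose) U := fun i j => h j i

theorem SmoothOn.const (m : Matrix (Fin n) (Fin n) ℝ) : SmoothOn (fun _ => m) U :=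
  fun _ _ => contDiffOn_const

theorem SmoothOn.mono {m : MatField n} {V : Set (Fin n → ℝ)} (h : SmoothOn m U) (hV : V ⊆ U) :
    SmoothOn m V := fun i j => (h i j).mono hV

theorem SmoothOn.congr {m m' : MatField n} (h : SmoothOn m U) (h' : ∀ x ∈ U, m' x = m x) :
    SmoothOn m' U := fun i j => (h i j).congr fun x hx => by rw [h' x hx]

theorem SmoothOn.det {m : MatField n} (h : SmoothOn m U) :
    ContDiffOn ℝ ∞ (fun y => (m y).det) U := by
  simp only [Matrix.det_apply']
  exact ContDiffOn.sum fun σ _ => contDiffOn_const.mul (contDiffOn_prod fun k _ => h _ _)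

theorem SmoothOn.inv {m : MatField n} (h : SmoothOn m U) (hu : ∀ x ∈ U, IsUnit (m x).det) :
    SmoothOn (fun y => (m y)⁻¹) U := by
  intro i j
  simp only [Matrix.inv_def, Matrix.smul_apply, smul_eq_mul, Ring.inverse_eq_inv']
  refine ContDiffOn.mul (h.det.inv fun x hx => (hu x hx).ne_zero) ?_
  simp only [Matrix.adjugate_apply]
  refine SmoothOn.det (m := fun y => (m y).updateRow j (Pi.single i 1)) fun a b => ?_
  by_cases hab : a = j
  · subst hab
    simp only [Matrix.updateRow_self]
    exact contDiffOn_const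
  · simp only [Matrix.updateRow_ne hab]
    exact h a b

theorem SmoothOn.pdM {m : MatField n} (hU : IsOpen U) (h : SmoothOn m U) (c : Fin n) :
    SmoothOn (pdM c m) U := fun i j => contDiffOn_pd hU (h i j) c

theorem pdM_mul {m m' : MatField n} (h : DiffAt m x) (h' : DiffAt m' x) :
    pdM c (fun y => m y * m' y) x = pdM c m x * m' x + m x * pdM c m' x := by
  ext i j
  simp only [pdM, Matrix.of_apply, Matrix.mul_apply, Matrix.add_apply]
  rw [pd_sum fun k _ => (h i k).fun_mul (h' k j), ← Finset.sum_add_distrib]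
  exact Finset.sum_congr rfl fun k _ => pd_mul (h i k) (h' k j)

theorem pdM_add {m m' : MatField n} (h : DiffAt m x) (h' : DiffAt m' x) :
    pdM c (fun y => m y + m' y) x = pdM c m x + pdM c m' x := by
  ext i j
  exact pd_add (h i j) (h' i j)

theorem pdM_transpose (m : MatField n) :
    pdM c (fun y => (m y).transpose) x = (pdM c m x).transpose := rfl

theorem pdM_const (m : Matrix (Fin n) (Fin n) ℝ) : pdM c (fun _ => m) x = 0 := by
  ext i j
  exact pd_const _

theorem DiffAt.mul {m m' : MatField n} (h : DiffAt m x) (h' : DiffAt m' x) :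
    DiffAt (fun y => m y * m' y) x := fun i j => by
  simp only [Matrix.mul_apply]
  exact DifferentiableAt.fun_sum fun k _ => (h i k).mul (h' k j)

theorem DiffAt.transpose {m : MatField n} (h : DiffAt m x) :
    DiffAt (fun y => (m y).transpose) x := fun i j => h j i

end PartialDerivatives

/-! ### Connections in moving frames -/

section Connections

variable {n : ℕ} {g : MatField n} {x : Fin n → ℝ} {U : Set (Fin n → ℝ)}

/-- The matrix `(Γ^d_{ca})_{da}` of the Levi-Civita connection in the direction `∂_c`. -/
def chr (g : MatField n) (c : Fin n) (x : Fin n → ℝ) : Matrix (Fin n) (Fin n) ℝ :=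
  Matrix.of fun d a => christoffel g x d c a

/-- The curvature endomorphism `R(∂_c, ∂_d)`. -/
def curv (g : MatField n) (c d : Fin n) (x : Fin n → ℝ) : Matrix (Fin n) (Fin n) ℝ :=
  Matrix.of fun m b => riemUp g x m b c d

theorem curv_eq (c d : Fin n) : curv g c d x =
    pdM c (chr g d) x - pdM d (chr g c) x + (chr g c x * chr g d x - chr g d x * chr g c x) := by
  ext m b
  simp only [curv, riemUp, chr, pdM, Matrix.of_apply, Matrix.add_apply, Matrix.sub_apply,
    Matrix.mul_apply, Finset.sum_sub_distrib]

/-- The Levi-Civita connection is the only symmetric metric connection. -/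
theorem chr_unique (hs : (g x).IsSymm) (hu : IsUnit (g x).det)
    (Γ : Fin n → Matrix (Fin n) (Fin n) ℝ) (hΓ : ∀ c a d, Γ c d a = Γ a d c)
    (hm : ∀ c, pdM c g x = (Γ c).transpose * g x + g x * Γ c) (c : Fin n) : chr g c x = Γ c := by
  have h1 : ∀ c k a, pd c (fun y => g y k a) x = (g x * Γ c) a k + (g x * Γ c) k a := by
    intro c k a
    have h := congrFun (congrFun (hm c) k) a
    rw [Matrix.add_apply] at h
    have h2 : ((Γ c).transpose * g x) k a = (g x * Γ c) a k := by
      rw [← Matrix.transpose_apply (g x * Γ c), Matrix.transpose_mul, hs.eq]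
    rw [h2] at h
    exact h
  have h2 : ∀ c k a, (g x * Γ c) k a = (g x * Γ a) k c := fun c k a => by
    simp only [Matrix.mul_apply, hΓ c a]
  have h3 : chr g c x = (g x)⁻¹ * (g x * Γ c) := by
    ext d a
    simp only [chr, christoffel, Matrix.of_apply, h1]
    rw [Matrix.mul_apply, Finset.mul_sum]
    -- Of the six terms of the Koszul formula four cancel by the symmetry of the lowered connection;
    -- the remaining two are equal.
    refine Finset.sum_congr rfl fun k _ => ?_
    rw [h2 c a k, h2 a c k, h2 c k a]
    rw [h2 k a c]
    ring
  rw [h3, Matrix.nonsing_inv_mul_cancel_left _ _ hu]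

theorem chr_symm (hU : IsOpen U) (hs : ∀ x ∈ U, (g x).IsSymm) (hx : x ∈ U) (c a d : Fin n) :
    chr g c x d a = chr g a x d c := by
  simp only [chr, christoffel, Matrix.of_apply]
  congr 1
  refine Finset.sum_congr rfl fun k _ => ?_
  rw [pd_congr_on (c := k) (f := fun y => g y c a) (f' := fun y => g y a c) hU
    (fun y hy => (hs y hy).apply _ _) hx]
  ring

theorem pdM_metric (hU : IsOpen U) (hs : ∀ x ∈ U, (g x).IsSymm) (hu : IsUnit (g x).det)
    (hx : x ∈ U) (c : Fin n) :
    pdM c g x = (chr g c x).transpose * g x + g x * chr g c x := by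
  have h1 : g x * chr g c x = Matrix.of fun k a =>
      (1 / 2) * (pd c (fun y => g y k a) x + pd a (fun y => g y k c) x -
        pd k (fun y => g y c a) x) := by
    have : chr g c x = (g x)⁻¹ * Matrix.of fun k a =>
      (1 / 2) * (pd c (fun y => g y k a) x + pd a (fun y => g y k c) x -
        pd k (fun y => g y c a) x) := by
      ext d a
      simp only [chr, christoffel, Matrix.of_apply, Matrix.mul_apply, Finset.mul_sum]
      exact Finset.sum_congr rfl fun k _ => by ring
    rw [this, Matrix.mul_nonsing_inv_cancel_left _ _ hu]
  have h2 : (chr g c x).transpose * g x = (g x * chr g c x).transpose := by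
    rw [Matrix.transpose_mul, (hs x hx).eq]
  have h3 : ∀ c i j, pd c (fun y => g y i j) x = pd c (fun y => g y j i) x := fun c i j =>
    pd_congr_on hU (fun y hy => (hs y hy).apply _ _) hx
  rw [h2, h1]
  ext i j
  simp only [pdM, Matrix.of_apply, Matrix.add_apply, Matrix.transpose_apply]
  rw [h3 c j i, h3 i j c, h3 j c i]
  ring

/-- If `θ` and `om` satisfy the structure equations for `g = θᵀ h θ`, then `om` is the Levi-Civita
connection in the frame `θ`. -/
theorem mul_chr_of_structure {θ h : MatField n} {om : Fin n → Matrix (Fin n) (Fin n) ℝ}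
    (hU : IsOpen U) (hx : x ∈ U) (hg : ∀ y ∈ U, g y = (θ y).transpose * h y * θ y)
    (hs : (h x).IsSymm) (hu : IsUnit (g x).det) (hθu : IsUnit (θ x).det) (hθ : DiffAt θ x)
    (hh : DiffAt h x) (hm : ∀ c, pdM c h x = (om c).transpose * h x + h x * om c)
    (ht : ∀ c a d, (pdM c θ x + om c * θ x) d a = (pdM a θ x + om a * θ x) d c) (c : Fin n) :
    θ x * chr g c x = pdM c θ x + om c * θ x := by
  -- The candidate is the gauge transform θ⁻¹(∂θ + ωθ): the structure equation is its symmetry, and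
  -- compatibility of ω with h is its compatibility with g. A variable h is needed when θ is the
  -- Jacobian of a map.
  have h1 := chr_unique (g := g) (x := x) ?_ hu
    (fun c => (θ x)⁻¹ * (pdM c θ x + om c * θ x)) ?_ ?_ c
  · rw [h1, Matrix.mul_nonsing_inv_cancel_left _ _ hθu]
  · rw [Matrix.IsSymm, hg x hx, Matrix.transpose_mul, Matrix.transpose_mul, hs.eq,
      Matrix.transpose_transpose, Matrix.mul_assoc]
  · intro c a d
    simp only [Matrix.mul_apply (M := (θ x)⁻¹), ht c a]
  · intro c
    rw [pdM_congr_on hU (fun y hy => hg y hy) hx,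
      pdM_mul (hθ.transpose.mul hh) hθ, pdM_mul hθ.transpose hh, pdM_transpose, hm, hg x hx]
    have e1 : (θ x).transpose * h x * θ x * ((θ x)⁻¹ * (pdM c θ x + om c * θ x)) =
        (θ x).transpose * h x * (pdM c θ x + om c * θ x) := by
      rw [Matrix.mul_assoc _ (θ x), Matrix.mul_nonsing_inv_cancel_left _ _ hθu]
    have e2 : ((θ x)⁻¹ * (pdM c θ x + om c * θ x)).transpose * ((θ x).transpose * h x * θ x) =
        (pdM c θ x + om c * θ x).transpose * h x * θ x := by
      rw [Matrix.mul_assoc (θ x).transpose, ← Matrix.mul_assoc _ (θ x).transpose,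
        ← Matrix.transpose_mul,
        Matrix.mul_nonsing_inv_cancel_left _ _ hθu]
      simp only [Matrix.mul_assoc]
    rw [e1, e2, Matrix.transpose_add, Matrix.transpose_mul]
    noncomm_ring

/-- Write ∂θ = θΓ - ωθ. When `comp (C y) (θ y)` is differentiated, the part θΓ cancels the
Christoffel terms by `dcomp_mul_right`, and the part ωθ becomes the action of ω on the components by
`dcomp_mul_left`. -/
theorem covD_of_gauge {k : ℕ} {θ : MatField n} {om : Fin n → Matrix (Fin n) (Fin n) ℝ}
    (hU : IsOpen U) (hx : x ∈ U) (hθ : DiffAt θ x)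
    (hc : ∀ c, θ x * chr g c x = pdM c θ x + om c * θ x)
    {T C : (Fin n → ℝ) → Arr n k} (hT : ∀ y ∈ U, T y = comp (C y) (θ y))
    (hC : ∀ j, DifferentiableAt ℝ (fun y => C y j) x) (i : Fin (k + 1) → Fin n) :
    covD g T x i = comp (fun j => pd (i (Fin.last k)) (fun y => C y j) x
      - act (om (i (Fin.last k))) (C x) j) (θ x) (fun l => i l.castSucc) := by
  set c := i (Fin.last k)
  set i' : Fin k → Fin n := fun l => i l.castSucc
  have h1 : covD g T x i = pd c (fun y => T y i') x - act (chr g c x) (T x) i' := rfl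
  have hd : DifferentiableAt ℝ (fun y => comp (C y) (θ y) i') x := by
    simp only [comp]
    refine DifferentiableAt.fun_sum fun j _ => DifferentiableAt.fun_mul ?_ (hC j)
    exact (HasFDerivAt.finsetProd (u := Finset.univ) (g := fun m y => θ y (j m) (i' m))
      fun m _ => (hθ (j m) (i' m)).hasFDerivAt).differentiableAt
  have h2 : pd c (fun y => T y i') x = pd c (fun y => comp (C y) (θ y) i') x :=
    pd_congr_on hU (fun y hy => by simp only [hT y hy]) hx
  have h3 : pd c (fun y => comp (C y) (θ y) i') x =
      comp (fun j => pd c (fun y => C y j) x) (θ x) i' + dcomp (C x) (θ x) (pdM c θ x) i' := by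
    have e1 := hasDerivAt_pd (c := c) hd
    have e2 := hasDerivAt_comp (C := fun s : ℝ => C (x + s • Pi.single c 1))
      (C' := fun j => pd c (fun y => C y j) x) (M := fun s : ℝ => θ (x + s • Pi.single c 1))
      (M' := pdM c θ x) (t := 0) (fun j => hasDerivAt_pd (c := c) (hC j))
      (fun a b => hasDerivAt_pd (c := c) (hθ a b)) i'
    simpa using e1.unique e2
  have h4 : pdM c θ x = θ x * chr g c x + -(om c * θ x) := by rw [hc c]; abel
  rw [h1, h2, h3, h4, dcomp_add, dcomp_neg, dcomp_mul_right, dcomp_mul_left, hT x hx]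
  have h5 : (fun j => pd c (fun y => C y j) x - act (om c) (C x) j) =
      (fun j => pd c (fun y => C y j) x) + -act (om c) (C x) := by
    funext j
    simp [sub_eq_add_neg]
  rw [h5, comp_add, comp_neg]
  simp only [Pi.add_apply, Pi.neg_apply]
  ring

/-- Differentiate θΓ_d = ∂_dθ + ω_dθ in the direction c and antisymmetrize: the second derivatives
of θ cancel and the Cartan formula for the curvature of ω remains. -/
theorem curv_of_gauge {θ : MatField n} {om : Fin n → MatField n}
    (hU : IsOpen U) (hx : x ∈ U) (hθ : SmoothOn θ U) (hom : ∀ c, DiffAt (om c) x)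
    (hΓ : ∀ c, DiffAt (chr g c) x)
    (hc : ∀ y ∈ U, ∀ c, θ y * chr g c y = pdM c θ y + om c y * θ y) (c d : Fin n) :
    θ x * curv g c d x = (pdM c (om d) x - pdM d (om c) x + (om c x * om d x - om d x * om c x)) *
      θ x := by
  have hθx := hθ.diffAt hU hx
  have h1 : ∀ c d, pdM c θ x * chr g d x + θ x * pdM c (chr g d) x =
      pdM c (pdM d θ) x + (pdM c (om d) x * θ x + om d x * pdM c θ x) := by
    intro c d
    rw [← pdM_mul hθx (hΓ d), ← pdM_mul (hom d) hθx,
      ← pdM_add ((hθ.pdM hU d).diffAt hU hx) ((hom d).mul hθx)]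
    exact pdM_congr_on hU (fun y hy => hc y hy d) hx
  have h2 : pdM c (pdM d θ) x = pdM d (pdM c θ) x := by
    ext i j
    exact pd_comm hU (hθ i j) hx c d
  have h3 : ∀ c, pdM c θ x = θ x * chr g c x - om c x * θ x := fun c => by rw [hc x hx c]; abel
  have h4 : ∀ c d, θ x * pdM c (chr g d) x = pdM c (pdM d θ) x + (pdM c (om d) x * θ x +
      om d x * (θ x * chr g c x - om c x * θ x)) - (θ x * chr g c x - om c x * θ x) * chr g d x :=
    fun c d => by rw [← h3 c, ← h1 c d]; abel
  rw [curv_eq, Matrix.mul_add, Matrix.mul_sub, h4 c d, h4 d c, h2]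
  noncomm_ring

end Connections

/-! ### Smoothness of the curvature and its derivatives -/

section Smoothness

variable {n : ℕ} {g : MatField n} {x : Fin n → ℝ} {U : Set (Fin n → ℝ)}

theorem smoothOn_chr (hU : IsOpen U) (hg : SmoothOn g U) (hu : ∀ x ∈ U, IsUnit (g x).det)
    (c : Fin n) : SmoothOn (chr g c) U := fun d a => by
  simp only [chr, christoffel, Matrix.of_apply]
  refine contDiffOn_const.mul (ContDiffOn.sum fun k _ => (hg.inv hu d k).mul ?_)
  exact ((contDiffOn_pd hU (hg k a) c).add (contDiffOn_pd hU (hg k c) a)).sub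
    (contDiffOn_pd hU (hg c a) k)

theorem contDiffOn_nablaR (hU : IsOpen U) (hg : SmoothOn g U) (hu : ∀ x ∈ U, IsUnit (g x).det)
    (q : ℕ) : ∀ i, ContDiffOn ℝ ∞ (fun x => nablaR g q x i) U := by
  have hΓ := smoothOn_chr hU hg hu
  induction q with
  | zero =>
    intro i
    simp only [nablaR, riem, riemUp]
    refine ContDiffOn.sum fun m _ => (hg _ _).mul ?_
    refine ((contDiffOn_pd hU (hΓ _ m _) _).sub (contDiffOn_pd hU (hΓ _ m _) _)).add ?_
    exact ContDiffOn.sum fun e _ => ((hΓ _ m e).mul (hΓ _ e _)).sub ((hΓ _ m e).mul (hΓ _ e _))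
  | succ q ih =>
    intro i
    simp only [nablaR, covD]
    refine (contDiffOn_pd hU (ih _) _).sub (ContDiffOn.sum fun j _ => ContDiffOn.sum fun d _ => ?_)
    exact (hΓ _ d _).mul (ih _)

end Smoothness

/-! ### Naturality of the curvature -/

section Naturality

variable {n : ℕ} {g g' : MatField n} {x : Fin n → ℝ} {U W : Set (Fin n → ℝ)}

/-- The Jacobian matrix. -/
def jac (ψ : (Fin n → ℝ) → (Fin n → ℝ)) : MatField n := fun x =>
  Matrix.of fun k c => pd c (fun y => ψ y k) x

theorem riem_eq_mul (a b c d : Fin n) : riem g x a b c d = (g x * curv g c d x) a b := by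
  simp [riem, curv, Matrix.mul_apply]

theorem riem_of_gauge {θ h : MatField n} {c d : Fin n} {Ω : Matrix (Fin n) (Fin n) ℝ}
    (hg : g x = (θ x).transpose * h x * θ x) (hΩ : θ x * curv g c d x = Ω * θ x) (a b : Fin n) :
    riem g x a b c d = ((θ x).transpose * (h x * Ω) * θ x) a b := by
  rw [riem_eq_mul, hg, Matrix.mul_assoc, hΩ]
  simp only [Matrix.mul_assoc]

/-- The Jacobian of ψ plays the role of a coframe with Gram matrix g' ∘ ψ, and the pulled-back
connection of g' satisfies the structure equations: torsion-freeness is the symmetry of the second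
derivatives of ψ and of Γ'. The gauge formulas then give the curvature and, by induction, all its
derivatives. -/
theorem nablaR_natural {ψ : (Fin n → ℝ) → (Fin n → ℝ)} (hU : IsOpen U) (hW : IsOpen W)
    (hψ : ∀ k, ContDiffOn ℝ ∞ (fun y => ψ y k) U) (hmaps : Set.MapsTo ψ U W)
    (hg : SmoothOn g U) (hgu : ∀ x ∈ U, IsUnit (g x).det)
    (hg' : SmoothOn g' W) (hs' : ∀ x ∈ W, (g' x).IsSymm) (hu' : ∀ x ∈ W, IsUnit (g' x).det)
    (hJ : ∀ x ∈ U, IsUnit (jac ψ x).det)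
    (hiso : ∀ x ∈ U, g x = (jac ψ x).transpose * g' (ψ x) * jac ψ x) (q : ℕ) :
    ∀ x ∈ U, nablaR g q x = comp (nablaR g' q (ψ x)) (jac ψ x) := by
  have hMs : SmoothOn (jac ψ) U := fun k c => contDiffOn_pd hU (hψ k) c
  have hψd : ∀ x ∈ U, ∀ k, DifferentiableAt ℝ (fun y => ψ y k) x := fun x hx k =>
    differentiableAt_of_contDiffOn hU (hψ k) hx
  have hψD : ∀ x ∈ U, DifferentiableAt ℝ ψ x := fun x hx => differentiableAt_pi.mpr (hψd x hx)
  have hΓs := smoothOn_chr hW hg' hu'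
  set om : Fin n → MatField n := fun c y => ∑ k, jac ψ y k c • chr g' k (ψ y) with hom
  have hcompd : ∀ {m : MatField n}, (∀ y ∈ W, DiffAt m y) → ∀ x ∈ U,
      DiffAt (fun y => m (ψ y)) x := fun hm x hx i j =>
    DifferentiableAt.comp (f := ψ) (g := fun z => _) x (hm (ψ x) (hmaps hx) i j) (hψD x hx)
  have hcompm : ∀ {m : MatField n}, (∀ y ∈ W, DiffAt m y) → ∀ x ∈ U, ∀ c,
      pdM c (fun y => m (ψ y)) x = ∑ k, jac ψ x k c • pdM k m (ψ x) := fun hm x hx c => by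
    ext i j
    rw [Matrix.sum_apply]
    exact pd_comp (hm (ψ x) (hmaps hx) i j) (hψd x hx)
  have hg'd : ∀ y ∈ W, DiffAt g' y := fun y hy => hg'.diffAt hW hy
  have hgauge : ∀ y ∈ U, ∀ c, jac ψ y * chr g c y = pdM c (jac ψ) y + om c y * jac ψ y := by
    intro y hy
    refine mul_chr_of_structure (h := fun z => g' (ψ z)) (om := fun c => om c y) hU hy hiso
      (hs' _ (hmaps hy)) (hgu y hy) (hJ y hy) (hMs.diffAt hU hy) (hcompd hg'd y hy) ?_ ?_
    · intro c
      rw [hcompm hg'd y hy c]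
      simp only [hom, Matrix.transpose_sum, Matrix.sum_mul, Matrix.mul_sum, ← Finset.sum_add_distrib]
      refine Finset.sum_congr rfl fun k _ => ?_
      rw [pdM_metric hW hs' (hu' _ (hmaps hy)) (hmaps hy) k, Matrix.transpose_smul,
        Matrix.smul_mul, Matrix.mul_smul, smul_add]
    · intro c a d
      rw [Matrix.add_apply, Matrix.add_apply]
      congr 1
      · exact pd_comm hU (hψ d) hy c a
      · simp only [hom, Matrix.mul_apply, Matrix.sum_apply, Matrix.smul_apply, smul_eq_mul,
          Finset.sum_mul]
        rw [Finset.sum_comm]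
        refine Finset.sum_congr rfl fun k _ => Finset.sum_congr rfl fun l _ => ?_
        rw [chr_symm hW hs' (hmaps hy) k l d]
        ring
  have hΓd : ∀ c, ∀ y ∈ W, DiffAt (chr g' c) y := fun c y hy => (hΓs c).diffAt hW hy
  have homd : ∀ c, ∀ y ∈ U, DiffAt (om c) y := by
    intro c y hy i j
    simp only [hom, Matrix.sum_apply, Matrix.smul_apply, smul_eq_mul]
    exact DifferentiableAt.fun_sum fun k _ =>
      ((hMs.diffAt hU hy) k c).fun_mul (hcompd (hΓd k) y hy i j)
  induction q with
  | zero =>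
    intro x hx
    have hΓgs := smoothOn_chr hU hg hgu
    have hpdom : ∀ c d, pdM c (om d) x = ∑ k, (pd c (fun y => jac ψ y k d) x • chr g' k (ψ x) +
        jac ψ x k d • ∑ l, jac ψ x l c • pdM l (chr g' k) (ψ x)) := by
      intro c d
      ext i j
      have e1 : pdM c (om d) x i j =
          pd c (fun y => ∑ k, jac ψ y k d * chr g' k (ψ y) i j) x := by
        simp only [pdM, hom, Matrix.of_apply, Matrix.sum_apply, Matrix.smul_apply, smul_eq_mul]
      rw [e1, pd_sum fun k _ => ((hMs.diffAt hU hx) k d).fun_mul (hcompd (hΓd k) x hx i j)]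
      simp only [Matrix.sum_apply, Matrix.add_apply, Matrix.smul_apply, smul_eq_mul]
      refine Finset.sum_congr rfl fun k _ => ?_
      rw [pd_mul ((hMs.diffAt hU hx) k d) (hcompd (hΓd k) x hx i j)]
      congr 2
      have := congrFun (congrFun (hcompm (hΓd k) x hx c) i) j
      rw [Matrix.sum_apply] at this
      exact this
    have hcurv : ∀ c d, jac ψ x * curv g c d x =
        (∑ l, ∑ k, (jac ψ x l c * jac ψ x k d) • curv g' l k (ψ x)) * jac ψ x := by
      intro c d
      rw [curv_of_gauge hU hx hMs (fun c => homd c x hx) (fun c => (hΓgs c).diffAt hU hx)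
        hgauge c d]
      congr 1
      have e2 : ∀ c d, om c x * om d x = ∑ l, ∑ k, (jac ψ x l c * jac ψ x k d) •
          (chr g' l (ψ x) * chr g' k (ψ x)) := by
        intro c d
        simp only [hom, Finset.sum_mul_sum, Matrix.smul_mul, Matrix.mul_smul, smul_smul]
        exact Finset.sum_congr rfl fun _ _ => Finset.sum_congr rfl fun _ _ => by rw [mul_comm]
      have e3 : ∀ k, pd c (fun y => jac ψ y k d) x = pd d (fun y => jac ψ y k c) x := fun k =>
        pd_comm hU (hψ k) hx c d
      rw [hpdom c d, hpdom d c, e2 c d, e2 d c]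
      simp only [curv_eq, Finset.sum_add_distrib, e3, smul_add, smul_sub, Finset.sum_sub_distrib,
        Finset.smul_sum, smul_smul]
      rw [Finset.sum_comm (f := fun l k => (jac ψ x l c * jac ψ x k d) • pdM l (chr g' k) (ψ x)),
        Finset.sum_comm (f := fun l k => (jac ψ x l d * jac ψ x k c) •
          (chr g' l (ψ x) * chr g' k (ψ x)))]
      simp only [mul_comm (jac ψ x _ d)]
      abel
    funext i
    change riem g x (i 0) (i 1) (i 2) (i 3) = _
    rw [riem_of_gauge (h := fun z => g' (ψ z)) (hiso x hx) (hcurv _ _)]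
    change _ = ∑ j : Fin 4 → Fin n, (∏ m : Fin 4, jac ψ x (j m) (i m)) *
      riem g' (ψ x) (j 0) (j 1) (j 2) (j 3)
    rw [sum_fin_four_fun]
    simp only [Fin.prod_univ_four]
    simp only [Matrix.mul_sum, Matrix.sum_mul, Matrix.sum_apply, Matrix.mul_smul, Matrix.smul_mul,
      Matrix.smul_apply, smul_eq_mul]
    have e4 : ∀ l k, ((jac ψ x).transpose * (g' (ψ x) * curv g' l k (ψ x)) * jac ψ x) (i 0) (i 1)
        = ∑ a, ∑ b, jac ψ x a (i 0) * jac ψ x b (i 1) * riem g' (ψ x) a b l k := by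
      intro l k
      simp only [riem_eq_mul, Matrix.mul_apply (M := (jac ψ x).transpose * _),
        Matrix.mul_apply (M := (jac ψ x).transpose), Matrix.transpose_apply, Finset.sum_mul]
      rw [Finset.sum_comm]
      exact Finset.sum_congr rfl fun _ _ => Finset.sum_congr rfl fun _ _ => by ring
    simp only [e4, Finset.mul_sum]
    have e5 : ∀ f : Fin n → Fin n → Fin n → Fin n → ℝ,
        ∑ l, ∑ k, ∑ a, ∑ b, f l k a b = ∑ a, ∑ b, ∑ l, ∑ k, f l k a b := fun f => by
      have e6 : ∀ l, ∑ k, ∑ a, ∑ b, f l k a b = ∑ a, ∑ b, ∑ k, f l k a b := fun l => by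
        rw [Finset.sum_comm]
        exact Finset.sum_congr rfl fun _ _ => Finset.sum_comm
      simp only [e6]
      rw [Finset.sum_comm]
      exact Finset.sum_congr rfl fun _ _ => Finset.sum_comm
    rw [e5]
    refine Finset.sum_congr rfl fun a _ => Finset.sum_congr rfl fun b _ =>
      Finset.sum_congr rfl fun l _ => Finset.sum_congr rfl fun k _ => ?_
    change _ = jac ψ x a (i 0) * jac ψ x b (i 1) * jac ψ x l (i 2) * jac ψ x k (i 3) *
      riem g' (ψ x) a b l k
    ring
  | succ q ih =>
    intro x hx
    have hTd : ∀ j, ∀ y ∈ W, DifferentiableAt ℝ (fun z => nablaR g' q z j) y := fun j y hy =>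
      differentiableAt_of_contDiffOn hW (contDiffOn_nablaR hW hg' hu' q j) hy
    have hTc : ∀ j, DifferentiableAt ℝ (fun y => nablaR g' q (ψ y) j) x := fun j =>
      DifferentiableAt.comp (f := ψ) (g := fun z => nablaR g' q z j) x (hTd j _ (hmaps hx))
        (hψD x hx)
    funext i
    change covD g (nablaR g q) x i = comp (covD g' (nablaR g' q) (ψ x)) (jac ψ x) i
    rw [covD_of_gauge (om := fun c => om c x) (C := fun y => nablaR g' q (ψ y)) hU hx
      (hMs.diffAt hU hx) (hgauge x hx) ih hTc, comp_snoc]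
    have e1 : (fun j => pd (i (Fin.last (4 + q))) (fun y => nablaR g' q (ψ y) j) x -
        act (om (i (Fin.last (4 + q))) x) (nablaR g' q (ψ x)) j) =
        ∑ c, jac ψ x c (i (Fin.last (4 + q))) • fun j : Fin (4 + q) → Fin n =>
          covD g' (nablaR g' q) (ψ x) (Fin.snoc (α := fun _ => Fin n) j c) := by
      funext j
      rw [pd_comp (hTd j _ (hmaps hx)) (hψd x hx)]
      simp only [hom, act_sum, act_smul, Finset.sum_apply, Pi.smul_apply, smul_eq_mul]
      rw [← Finset.sum_sub_distrib]
      refine Finset.sum_congr rfl fun c _ => ?_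
      have e2 : pd (i (Fin.last (4 + q))) (fun y => ψ y c) x =
          jac ψ x c (i (Fin.last (4 + q))) := rfl
      rw [e2, ← mul_sub]
      simp only [covD, Fin.snoc_castSucc, Fin.snoc_last]
      rfl
    rw [e1, comp_sum, Finset.sum_apply]
    exact Finset.sum_congr rfl fun c _ => by rw [comp_smul]; rfl

end Naturality

/-! ### Covariant derivatives in a moving frame -/

section MovingFrame

variable {n k : ℕ} {g : MatField n} {x : Fin n → ℝ} {U : Set (Fin n → ℝ)}

/-- Contracting `covD_of_gauge` with the dual frame leaves frame derivatives of components plus an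
algebraic connection term. For constant components only the latter survives. -/
theorem comp_covD {θ e : MatField n} {om γ : Fin n → Matrix (Fin n) (Fin n) ℝ}
    (hU : IsOpen U) (hx : x ∈ U) (hθ : DiffAt θ x) (hθe : θ x * e x = 1)
    (hc : ∀ c, θ x * chr g c x = pdM c θ x + om c * θ x)
    (hγ : ∀ A, γ A = ∑ c, e x c A • om c)
    {T C : (Fin n → ℝ) → Arr n k} (hT : ∀ y ∈ U, T y = comp (C y) (θ y))
    (hC : ∀ j, DifferentiableAt ℝ (fun y => C y j) x) (i : Fin (k + 1) → Fin n) :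
    comp (covD g T x) (e x) i =
      fderiv ℝ (fun y => C y fun l => i l.castSucc) x (fun c => e x c (i (Fin.last k)))
        + covC γ (C x) i := by
  rw [comp_snoc, fderiv_eq_sum_pd, covC, hγ, act_sum, Finset.sum_apply, ← sub_eq_add_neg,
    ← Finset.sum_sub_distrib]
  refine Finset.sum_congr rfl fun c _ => ?_
  have h1 : (fun j : Fin k → Fin n => covD g T x (Fin.snoc (α := fun _ => Fin n) j c)) =
      comp (fun j => pd c (fun y => C y j) x - act (om c) (C x) j) (θ x) := by
    funext j
    rw [covD_of_gauge hU hx hθ hc hT hC]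
    simp only [Fin.snoc_castSucc, Fin.snoc_last]
  rw [h1, comp_comp, hθe, comp_one, act_smul]
  simp only [Pi.smul_apply, smul_eq_mul]
  ring

end MovingFrame

/-! ### Symmetries of the curvature tensor -/

section Symmetries

variable {n : ℕ} {g : MatField n} {x : Fin n → ℝ} {U : Set (Fin n → ℝ)}

theorem curv_swap (c d : Fin n) : curv g d c x = -curv g c d x := by
  rw [curv_eq, curv_eq]
  abel

theorem riem_swap_right (a b c d : Fin n) : riem g x a b d c = -riem g x a b c d := by
  rw [riem_eq_mul, riem_eq_mul, curv_swap, Matrix.mul_neg, Matrix.neg_apply]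

/-- The second partial derivatives of g commute; rewriting them through metric compatibility of the
connection says exactly that the lowered curvature endomorphism is skew. -/
theorem riem_swap_left (hU : IsOpen U) (hg : SmoothOn g U) (hs : ∀ x ∈ U, (g x).IsSymm)
    (hu : ∀ x ∈ U, IsUnit (g x).det) (hx : x ∈ U) (a b c d : Fin n) :
    riem g x b a c d = -riem g x a b c d := by
  have hΓ := fun c => (smoothOn_chr hU hg hu c).diffAt hU hx
  have hgx := hg.diffAt hU hx
  have h1 : ∀ c d, pdM c (pdM d g) x = ((pdM c (chr g d) x).transpose * g x +
      (chr g d x).transpose * pdM c g x) + (pdM c g x * chr g d x + g x * pdM c (chr g d) x) := by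
    intro c d
    rw [pdM_congr_on hU (fun y hy => pdM_metric hU hs (hu y hy) hy d) hx,
      pdM_add ((hΓ d).transpose.mul hgx) (hgx.mul (hΓ d)), pdM_mul (hΓ d).transpose hgx,
      pdM_mul hgx (hΓ d), pdM_transpose]
  have h2 : pdM c (pdM d g) x = pdM d (pdM c g) x := by
    ext i j
    exact pd_comm hU (hg i j) hx c d
  have h3 : (g x * curv g c d x).transpose = -(g x * curv g c d x) := by
    rw [h1 c d, h1 d c, pdM_metric hU hs (hu x hx) hx c, pdM_metric hU hs (hu x hx) hx d,
      ← sub_eq_zero] at h2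
    rw [eq_neg_iff_add_eq_zero, Matrix.transpose_mul, (hs x hx).eq, curv_eq, ← h2]
    simp only [Matrix.transpose_add, Matrix.transpose_sub, Matrix.transpose_mul]
    noncomm_ring
  rw [riem_eq_mul, riem_eq_mul, ← Matrix.transpose_apply (g x * _), h3, Matrix.neg_apply]

theorem riem_cyclic (hU : IsOpen U) (hs : ∀ x ∈ U, (g x).IsSymm) (hx : x ∈ U)
    (a b c d : Fin n) : riem g x a b c d + riem g x a c d b + riem g x a d b c = 0 := by
  have h1 : ∀ c b d m, pd c (fun y => christoffel g y m d b) x =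
      pd c (fun y => christoffel g y m b d) x := fun c b d m =>
    pd_congr_on hU (fun y hy => chr_symm hU hs hy d b m) hx
  have h2 : ∀ m c b, christoffel g x m c b = christoffel g x m b c := fun m c b =>
    chr_symm hU hs hx c b m
  have h3 : ∀ m, riemUp g x m b c d + riemUp g x m c d b + riemUp g x m d b c = 0 := by
    intro m
    simp only [riemUp, Finset.sum_sub_distrib]
    rw [h1 c b d m, h1 d c b m, h1 b d c m]
    simp only [h2 _ d b, h2 _ c b, h2 _ d c]
    ring
  simp only [riem]
  rw [← Finset.sum_add_distrib, ← Finset.sum_add_distrib]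
  refine Finset.sum_eq_zero fun m _ => ?_
  rw [← mul_add, ← mul_add, h3, mul_zero]

/-- The usual combination of four cyclic identities with the two antisymmetries. -/
theorem riem_pair (hU : IsOpen U) (hg : SmoothOn g U) (hs : ∀ x ∈ U, (g x).IsSymm)
    (hu : ∀ x ∈ U, IsUnit (g x).det) (hx : x ∈ U) (a b c d : Fin n) :
    riem g x c d a b = riem g x a b c d := by
  have l := riem_swap_left hU hg hs hu hx
  have r := riem_swap_right (g := g) (x := x)
  have cy := riem_cyclic (g := g) hU hs hx
  have e1 := cy a b c d
  have e2 := cy b c d a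
  have e3 := cy c d a b
  have e4 := cy d a b c
  linarith [l a b c d, r c d a b, l a b d c, r b a c d, r a b c d, l c d a b, r c d a b, l c d b a,
    r a c b d, l a c b d, l a c d b, r c a b d, r b d a c, l b d a c, l b d c a, r d b a c,
    r a d b c, l a d b c, l a d c b, r d a b c, r b c a d, l b c a d, l b c d a, r c b a d]

end Symmetries

/-! ### Contractions and the Weyl tensor -/

section Weyl

variable {n : ℕ}

theorem comp_perm {k : ℕ} (T : Arr n k) (X : Matrix (Fin n) (Fin n) ℝ) (σ : Equiv.Perm (Fin k)) :
    comp (fun i => T (i ∘ σ)) X = fun i => comp T X (i ∘ σ) := by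
  funext i
  simp only [comp]
  refine Fintype.sum_equiv (Equiv.arrowCongr σ.symm (Equiv.refl _)) _ _ fun j => ?_
  congr 1
  rw [← Equiv.prod_comp σ]
  rfl

/-- The contraction of the first and third slot with `P`. -/
def trace13 (P : Matrix (Fin n) (Fin n) ℝ) (T : Arr n 4) : Matrix (Fin n) (Fin n) ℝ :=
  Matrix.of fun b d => ∑ a, ∑ c, P a c * T ![a, b, c, d]

/-- Contraction is equivariant once the contracting matrix is transformed contravariantly. -/
theorem trace13_comp (P X : Matrix (Fin n) (Fin n) ℝ) (T : Arr n 4) :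
    trace13 P (comp T X) = X.transpose * trace13 (X * P * X.transpose) T * X := by
  ext b d
  have h1 : ∀ a c, comp T X ![a, b, c, d] = ∑ a', ∑ b', ∑ c', ∑ d',
      X a' a * X b' b * X c' c * X d' d * T ![a', b', c', d'] := fun a c => by
    simp only [comp, sum_fin_four_fun, Fin.prod_univ_four]
    rfl
  have h2 : ∀ a' c', (X * P * X.transpose) a' c' = ∑ a, ∑ c, X a' a * P a c * X c' c := by
    intro a' c'
    simp only [Matrix.mul_apply, Matrix.transpose_apply, Finset.sum_mul]
    rw [Finset.sum_comm]
  have h3 : ∀ M : Matrix (Fin n) (Fin n) ℝ, (X.transpose * M * X) b d =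
      ∑ b', ∑ d', X b' b * M b' d' * X d' d := fun M => by
    simp only [Matrix.mul_apply, Matrix.transpose_apply, Finset.sum_mul]
    rw [Finset.sum_comm]
  rw [h3]
  simp only [trace13, Matrix.of_apply, h1, h2, Finset.mul_sum, Finset.sum_mul]
  have e1 : ∀ f : Fin n → Fin n → Fin n → Fin n → Fin n → Fin n → ℝ,
      ∑ a, ∑ c, ∑ a', ∑ b', ∑ c', ∑ d', f a c a' b' c' d' =
      ∑ b', ∑ d', ∑ a', ∑ c', ∑ a, ∑ c, f a c a' b' c' d' := by
    intro f
    calc _ = ∑ p : Fin n × Fin n × Fin n × Fin n × Fin n × Fin n,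
          f p.1 p.2.1 p.2.2.1 p.2.2.2.1 p.2.2.2.2.1 p.2.2.2.2.2 := by
          simp only [Fintype.sum_prod_type]
      _ = ∑ p : Fin n × Fin n × Fin n × Fin n × Fin n × Fin n,
          f p.2.2.2.2.1 p.2.2.2.2.2 p.2.2.1 p.1 p.2.2.2.1 p.2.1 :=
          Fintype.sum_equiv ⟨fun p => (p.2.2.2.1, p.2.2.2.2.2, p.2.2.1, p.2.2.2.2.1, p.1, p.2.1),
            fun p => (p.2.2.2.2.1, p.2.2.2.2.2, p.2.2.1, p.1, p.2.2.2.1, p.2.1),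
            fun _ => rfl, fun _ => rfl⟩ _ _ fun _ => rfl
      _ = _ := by simp only [Fintype.sum_prod_type]
  rw [e1]
  refine Finset.sum_congr rfl fun b' _ => Finset.sum_congr rfl fun d' _ =>
    Finset.sum_congr rfl fun a' _ => Finset.sum_congr rfl fun c' _ =>
    Finset.sum_congr rfl fun a _ => Finset.sum_congr rfl fun c _ => ?_
  ring

theorem ricci_eq_trace13 {g : MatField n} {x : Fin n → ℝ} (hs : (g x).IsSymm)
    (hu : IsUnit (g x).det) :
    Matrix.of (ricci g x) = trace13 (g x)⁻¹ (nablaR g 0 x) := by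
  ext b d
  have h1 : ∀ c, ∑ a, (g x)⁻¹ a c * riem g x a b c d = riemUp g x c b c d := by
    intro c
    have h2 : ∀ a, (g x)⁻¹ a c = (g x)⁻¹ c a := fun a => by
      have : (g x)⁻¹.IsSymm := by rw [Matrix.IsSymm, Matrix.transpose_nonsing_inv, hs.eq]
      exact this.apply _ _
    have h3 := congrFun (congrFun (Matrix.nonsing_inv_mul_cancel_left (g x) (curv g c d x) hu) c) b
    rw [Matrix.mul_apply] at h3
    simp only [h2, riem_eq_mul]
    exact h3
  change ∑ a, riemUp g x a b a d = ∑ a, ∑ c, (g x)⁻¹ a c * riem g x a b c d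
  rw [Finset.sum_comm]
  exact Finset.sum_congr rfl fun c _ => (h1 c).symm

end Weyl

section WeylFour

variable {g : MatField 4} {x : Fin 4 → ℝ} {U : Set (Fin 4 → ℝ)}

/-- The Weyl tensor as an array. -/
def weylArr (g : MatField 4) (x : Fin 4 → ℝ) : Arr 4 4 := fun i =>
  weyl g x (i 0) (i 1) (i 2) (i 3)

/-- If Z preserves g it preserves g⁻¹, so an isotropy of the curvature also fixes its contraction,
the Ricci tensor; the Weyl tensor is assembled from R, g and Ric. -/
theorem comp_weylArr {Z : Matrix (Fin 4) (Fin 4) ℝ} (hs : (g x).IsSymm) (hu : IsUnit (g x).det)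
    (hZ : Z.transpose * g x * Z = g x) (hR : comp (nablaR g 0 x) Z = nablaR g 0 x) :
    comp (weylArr g x) Z = weylArr g x := by
  have hZd : IsUnit Z.det := isUnit_iff_ne_zero.mpr fun h => by
    have := congrArg Matrix.det hZ
    rw [Matrix.det_mul, h, mul_zero] at this
    exact hu.ne_zero this.symm
  have hZi : Z * (g x)⁻¹ * Z.transpose = (g x)⁻¹ := by
    have h1 := congrArg (fun m => m⁻¹) hZ
    simp only [Matrix.mul_inv_rev] at h1
    conv_lhs => rw [← h1]
    simp only [Matrix.mul_assoc]
    rw [Matrix.nonsing_inv_mul _ (by rwa [Matrix.det_transpose]), Matrix.mul_one,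
      Matrix.mul_nonsing_inv_cancel_left _ _ hZd]
  have hric : Z.transpose * Matrix.of (ricci g x) * Z = Matrix.of (ricci g x) := by
    rw [ricci_eq_trace13 hs hu]
    nth_rw 2 [← hR]
    rw [trace13_comp, hZi]
  set ρ : Matrix (Fin 4) (Fin 4) ℝ := Matrix.of (ricci g x)
  have h1 : ∀ (P Q : Matrix (Fin 4) (Fin 4) ℝ) (σ : Equiv.Perm (Fin 4)),
      Z.transpose * P * Z = P → Z.transpose * Q * Z = Q →
      comp (fun i => arr4 P Q (i ∘ σ)) Z = fun i => arr4 P Q (i ∘ σ) := by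
    intro P Q σ hP hQ
    rw [comp_perm, comp_arr4, hP, hQ]
  have hw : weylArr g x = nablaR g 0 x
      + (-(1 / 2) : ℝ) • (fun i : Fin 4 → Fin 4 => arr4 (g x) ρ (i ∘ ![0, 2, 1, 3]))
      + (1 / 2 : ℝ) • (fun i : Fin 4 → Fin 4 => arr4 (g x) ρ (i ∘ ![0, 3, 1, 2]))
      + (1 / 2 : ℝ) • (fun i : Fin 4 → Fin 4 => arr4 (g x) ρ (i ∘ ![1, 2, 0, 3]))
      + (-(1 / 2) : ℝ) • (fun i : Fin 4 → Fin 4 => arr4 (g x) ρ (i ∘ ![1, 3, 0, 2]))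
      + (scal g x / 6) • (fun i : Fin 4 → Fin 4 => arr4 (g x) (g x) (i ∘ ![0, 2, 1, 3]))
      + (-(scal g x / 6)) • (fun i : Fin 4 → Fin 4 => arr4 (g x) (g x) (i ∘ ![0, 3, 1, 2])) := by
    funext i
    change weyl g x (i 0) (i 1) (i 2) (i 3) = riem g x (i 0) (i 1) (i 2) (i 3)
      + -(1 / 2) * (g x (i 0) (i 2) * ricci g x (i 1) (i 3))
      + (1 / 2) * (g x (i 0) (i 3) * ricci g x (i 1) (i 2))
      + (1 / 2) * (g x (i 1) (i 2) * ricci g x (i 0) (i 3))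
      + -(1 / 2) * (g x (i 1) (i 3) * ricci g x (i 0) (i 2))
      + (scal g x / 6) * (g x (i 0) (i 2) * g x (i 1) (i 3))
      + -(scal g x / 6) * (g x (i 0) (i 3) * g x (i 1) (i 2))
    unfold weyl
    ring
  have hp : ∀ f : Fin 4 → Fin 4, Function.Bijective f → ∀ Q, Z.transpose * Q * Z = Q →
      comp (fun i => arr4 (g x) Q (i ∘ f)) Z = fun i => arr4 (g x) Q (i ∘ f) := fun f hf Q hQ =>
    h1 (g x) Q (Equiv.ofBijective f hf) hZ hQ
  rw [hw]
  simp only [comp_add, comp_smul]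
  rw [hp ![0, 2, 1, 3] (by decide) ρ hric, hp ![0, 3, 1, 2] (by decide) ρ hric,
    hp ![1, 2, 0, 3] (by decide) ρ hric, hp ![1, 3, 0, 2] (by decide) ρ hric,
    hp ![0, 2, 1, 3] (by decide) (g x) hZ, hp ![0, 3, 1, 2] (by decide) (g x) hZ]
  congr

theorem ricci_symm (hU : IsOpen U) (hg : SmoothOn g U) (hs : ∀ x ∈ U, (g x).IsSymm)
    (hu : ∀ x ∈ U, IsUnit (g x).det) (hx : x ∈ U) (b d : Fin 4) :
    ricci g x b d = ricci g x d b := by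
  have h := ricci_eq_trace13 (hs x hx) (hu x hx)
  have hi : (g x)⁻¹.IsSymm := by rw [Matrix.IsSymm, Matrix.transpose_nonsing_inv, (hs x hx).eq]
  have h1 : ∀ b d, ricci g x b d = ∑ a, ∑ c, (g x)⁻¹ a c * riem g x a b c d := fun b d =>
    congrFun (congrFun h b) d
  rw [h1, h1, Finset.sum_comm]
  refine Finset.sum_congr rfl fun a _ => Finset.sum_congr rfl fun c _ => ?_
  rw [riem_pair hU hg hs hu hx, hi.apply]

theorem weyl_symmetries (hU : IsOpen U) (hg : SmoothOn g U) (hs : ∀ x ∈ U, (g x).IsSymm)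
    (hu : ∀ x ∈ U, IsUnit (g x).det) (hx : x ∈ U) (a b c d : Fin 4) :
    weyl g x b a c d = -weyl g x a b c d ∧ weyl g x a b d c = -weyl g x a b c d ∧
      weyl g x c d a b = weyl g x a b c d := by
  have r := ricci_symm hU hg hs hu hx
  have s : ∀ a b, g x a b = g x b a := fun a b => (hs x hx).apply _ _
  refine ⟨?_, ?_, ?_⟩
  · unfold weyl
    rw [riem_swap_left hU hg hs hu hx]
    ring
  · unfold weyl
    rw [riem_swap_right]
    ring
  · unfold weyl
    rw [riem_pair hU hg hs hu hx, s c a, s d b, s c b, s d a, r d b, r d a, r c b, r c a]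
    ring

theorem trace13_weylArr (hs : ∀ x ∈ U, (g x).IsSymm)
    (hu : ∀ x ∈ U, IsUnit (g x).det) (hx : x ∈ U) : trace13 (g x)⁻¹ (weylArr g x) = 0 := by
  have h := ricci_eq_trace13 (hs x hx) (hu x hx)
  have h1 : ∀ b d, ricci g x b d = ∑ a, ∑ c, (g x)⁻¹ a c * riem g x a b c d := fun b d =>
    congrFun (congrFun h b) d
  have hsym : ∀ a b, g x a b = g x b a := fun a b => (hs x hx).apply _ _
  have hi : ∀ a b, (g x)⁻¹ a b = (g x)⁻¹ b a := fun a b => by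
    have : (g x)⁻¹.IsSymm := by rw [Matrix.IsSymm, Matrix.transpose_nonsing_inv, (hs x hx).eq]
    exact this.apply _ _
  have k1 : ∀ a d, ∑ c, (g x)⁻¹ a c * g x c d = if a = d then 1 else 0 := fun a d => by
    have := congrFun (congrFun (Matrix.nonsing_inv_mul _ (hu x hx)) a) d
    rwa [Matrix.mul_apply, Matrix.one_apply] at this
  ext b d
  change ∑ a, ∑ c, (g x)⁻¹ a c * weyl g x a b c d = 0
  have e : ∀ a c, (g x)⁻¹ a c * weyl g x a b c d = (g x)⁻¹ a c * riem g x a b c d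
      - (1 / 2) * ((g x)⁻¹ a c * g x c a * ricci g x b d
        - (g x)⁻¹ c a * g x a d * ricci g x b c
        - (g x)⁻¹ a c * g x c b * ricci g x a d + (g x)⁻¹ a c * ricci g x a c * g x b d)
      + (scal g x / 6) * ((g x)⁻¹ a c * g x c a * g x b d
        - (g x)⁻¹ c a * g x a d * g x b c) := by
    intro a c
    rw [hi c a, hsym c a, hsym c b]
    unfold weyl
    ring
  simp only [e, Finset.sum_add_distrib, Finset.sum_sub_distrib, ← Finset.mul_sum, ← h1]
  have f1 : ∀ r : ℝ, ∑ a, ∑ c, (g x)⁻¹ a c * g x c a * r = 4 * r := fun r => by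
    simp only [← Finset.sum_mul, k1]
    simp
  have f2 : ∀ f : Fin 4 → ℝ, ∑ a, ∑ c, (g x)⁻¹ c a * g x a d * f c = f d := fun f => by
    rw [Finset.sum_comm]
    simp only [← Finset.sum_mul, k1]
    simp
  have f3 : ∑ a, ∑ c, (g x)⁻¹ a c * g x c b * ricci g x a d = ricci g x b d := by
    simp only [← Finset.sum_mul, k1]
    simp
  have f4 : ∑ a, ∑ c, (g x)⁻¹ a c * ricci g x a c * g x b d = scal g x * g x b d := by
    simp only [← Finset.sum_mul]
    rfl
  rw [f1, f1, f2, f2, f3, f4]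
  simp
  ring

end WeylFour

/-! ### The isotropy group of a curvature tensor of Petrov type N -/

section EtaNull

theorem etaNull_isSymm : etaNull.IsSymm := by
  ext i j
  fin_cases i <;> fin_cases j <;> simp [etaNull]

theorem etaNull_mul_self : etaNull * etaNull = 1 := by
  ext i j
  fin_cases i <;> fin_cases j <;> simp [etaNull, Matrix.mul_apply, Fin.sum_univ_four]

theorem isUnit_det_etaNull : IsUnit etaNull.det := by
  refine isUnit_iff_ne_zero.mpr fun h => ?_
  have := congrArg Matrix.det etaNull_mul_self
  rw [Matrix.det_mul, h] at this
  simp at this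

theorem etaNull_inv : etaNull⁻¹ = etaNull := Matrix.inv_eq_left_inv etaNull_mul_self

/-- The generators of the null rotations about the fourth frame vector. -/
def nul (x y : ℝ) : Matrix (Fin 4) (Fin 4) ℝ :=
  !![0, 0, x, 0; 0, 0, y, 0; 0, 0, 0, 0; x, y, 0, 0]

/-- The linear map parametrizing the generators of null rotations. -/
def nulL : (Fin 2 → ℝ) →ₗ[ℝ] Matrix (Fin 4) (Fin 4) ℝ where
  toFun v := nul (v 0) (v 1)
  map_add' u v := by
    ext i j
    fin_cases i <;> fin_cases j <;> simp [nul]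
  map_smul' r v := by
    ext i j
    fin_cases i <;> fin_cases j <;> simp [nul]

theorem skew_entries {A : Matrix (Fin 4) (Fin 4) ℝ} (h : A.transpose * etaNull + etaNull * A = 0) :
    A 0 0 = 0 ∧ A 1 1 = 0 ∧ A 1 0 = -A 0 1 ∧ A 3 0 = A 0 2 ∧ A 3 1 = A 1 2 ∧ A 2 0 = A 0 3 ∧
      A 2 1 = A 1 3 ∧ A 3 3 = -A 2 2 ∧ A 2 3 = 0 ∧ A 3 2 = 0 := by
  have e : ∀ i j, (A.transpose * etaNull + etaNull * A) i j = 0 := fun i j => by rw [h]; rfl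
  have e00 := e 0 0
  have e11 := e 1 1
  have e01 := e 0 1
  have e02 := e 0 2
  have e12 := e 1 2
  have e03 := e 0 3
  have e13 := e 1 3
  have e23 := e 2 3
  have e22 := e 2 2
  have e33 := e 3 3
  simp only [Matrix.add_apply, Matrix.mul_apply, Matrix.transpose_apply, Fin.sum_univ_four] at *
  simp [etaNull] at e00 e11 e01 e02 e12 e03 e13 e23 e22 e33
  refine ⟨?_, ?_, ?_, ?_, ?_, ?_, ?_, ?_, ?_, ?_⟩ <;> linarith

theorem nul_skew (x y : ℝ) : (nul x y).transpose * etaNull + etaNull * nul x y = 0 := by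
  ext i j
  fin_cases i <;> fin_cases j <;> simp [nul, etaNull, Matrix.mul_apply, Fin.sum_univ_four]

theorem act_four {n : ℕ} (A : Matrix (Fin n) (Fin n) ℝ) (T : Arr n 4) (a b c d : Fin n) :
    act A T ![a, b, c, d] = ∑ e, (A e a * T ![e, b, c, d] + A e b * T ![a, e, c, d]
      + A e c * T ![a, b, e, d] + A e d * T ![a, b, c, e]) := by
  have h0 : ∀ e, Function.update ![a, b, c, d] 0 e = ![e, b, c, d] := fun e => by
    funext i; fin_cases i <;> rfl
  have h1 : ∀ e, Function.update ![a, b, c, d] 1 e = ![a, e, c, d] := fun e => by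
    funext i; fin_cases i <;> rfl
  have h2 : ∀ e, Function.update ![a, b, c, d] 2 e = ![a, b, e, d] := fun e => by
    funext i; fin_cases i <;> rfl
  have h3 : ∀ e, Function.update ![a, b, c, d] 3 e = ![a, b, c, e] := fun e => by
    funext i; fin_cases i <;> rfl
  simp only [act, Fin.sum_univ_four, h0, h1, h2, h3, Finset.sum_add_distrib]
  rfl

/-- If the last component vanishes, nullity forces `k` onto the third axis and a swap of the two
null vectors suffices; otherwise a null rotation about the third vector carries e₄ to a multiple of
`k`. -/
theorem exists_null_frame {k : Fin 4 → ℝ} (hk : k ≠ 0)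
    (hn : k 0 ^ 2 + k 1 ^ 2 = 2 * k 2 * k 3) :
    ∃ Y : Matrix (Fin 4) (Fin 4) ℝ, Y.transpose * etaNull * Y = etaNull ∧
      ∃ r : ℝ, ∀ i, Y i 3 = r * k i := by
  by_cases h3 : k 3 = 0
  · rw [h3, mul_zero] at hn
    have h0 : k 0 = 0 := by
      have : k 0 ^ 2 = 0 := by linarith [sq_nonneg (k 0), sq_nonneg (k 1)]
      simpa using this
    have h1 : k 1 = 0 := by
      have : k 1 ^ 2 = 0 := by linarith [sq_nonneg (k 0), sq_nonneg (k 1)]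
      simpa using this
    have h2 : k 2 ≠ 0 := fun h2 => hk (by funext i; fin_cases i <;> simp [h0, h1, h2, h3])
    refine ⟨!![1, 0, 0, 0; 0, 1, 0, 0; 0, 0, 0, 1; 0, 0, 1, 0], ?_, (k 2)⁻¹, fun i => ?_⟩
    · ext i j
      fin_cases i <;> fin_cases j <;> simp [etaNull, Matrix.mul_apply, Fin.sum_univ_four]
    · fin_cases i <;> simp [h0, h1, h2, h3]
  · refine ⟨!![1, 0, 0, k 0 / k 3; 0, 1, 0, k 1 / k 3;
      k 0 / k 3, k 1 / k 3, 1, ((k 0 / k 3) ^ 2 + (k 1 / k 3) ^ 2) / 2; 0, 0, 0, 1], ?_,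
      (k 3)⁻¹, fun i => ?_⟩
    · ext i j
      fin_cases i <;> fin_cases j <;>
        (simp [etaNull, Matrix.mul_apply, Fin.sum_univ_four]; try ring)
    · fin_cases i
      · simp; ring
      · simp; ring
      · simp
        field_simp
        linarith
      · simp [h3]

/-- A trace-free tensor with curvature symmetries that is annihilated by e₄ has just two independent
components p, q. A boost scales the pair, a rotation turns it, and null rotations about e₃ create
new components, so all these generators are excluded. -/
theorem skew_of_act_typeN {w : Arr 4 4} (h1 : ∀ a b c d, w ![b, a, c, d] = -w ![a, b, c, d])
    (h2 : ∀ a b c d, w ![a, b, d, c] = -w ![a, b, c, d])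
    (h3 : ∀ a b c d, w ![c, d, a, b] = w ![a, b, c, d])
    (htr : trace13 etaNull w = 0) (hk : ∀ b c d, w ![3, b, c, d] = 0) (hw : w ≠ 0)
    {A : Matrix (Fin 4) (Fin 4) ℝ} (hA : A.transpose * etaNull + etaNull * A = 0)
    (ha : act A w = 0) : A = nul (A 0 2) (A 1 2) := by
  have k1 : ∀ b c d, w ![b, 3, c, d] = 0 := fun b c d => by rw [h1, hk, neg_zero]
  have k2 : ∀ b c d, w ![b, c, 3, d] = 0 := fun b c d => by rw [← h3, hk]
  have k3 : ∀ b c d, w ![b, c, d, 3] = 0 := fun b c d => by rw [h2, k2, neg_zero]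
  have z1 : ∀ a c d, w ![a, a, c, d] = 0 := fun a c d => by linarith [h1 a a c d]
  have z2 : ∀ a c d, w ![c, d, a, a] = 0 := fun a c d => by linarith [h2 c d a a]
  have tr : ∀ b d, w ![0, b, 0, d] + w ![1, b, 1, d] = 0 := fun b d => by
    have := congrFun (congrFun htr b) d
    simp [trace13, etaNull, Fin.sum_univ_four, hk, k2] at this
    linarith
  set p := w ![0, 2, 0, 2] with hp
  set q := w ![0, 2, 1, 2] with hq
  have v1 : w ![1, 2, 1, 2] = -p := by linarith [tr 2 2]
  have v2 : w ![1, 2, 0, 2] = q := h3 _ _ _ _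
  have v3 : w ![0, 1, 0, 1] = 0 := by
    have := tr 1 1
    rw [z1 1 1 1] at this
    linarith
  have v4 : w ![0, 1, 0, 2] = 0 := by
    have := tr 1 2
    rw [z1 1 1 2] at this
    linarith
  have v5 : w ![1, 0, 1, 2] = 0 := by
    have := tr 0 2
    rw [z1 0 0 2] at this
    linarith
  have v6 : w ![0, 1, 1, 2] = 0 := by rw [h1, v5, neg_zero]
  -- All components are 0, ±p or ±q, so p = q = 0 would force `w = 0`. The linear systems solved
  -- below have a multiple of p² + q² as determinant.
  have hpq : p ^ 2 + q ^ 2 ≠ 0 := by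
    intro h0
    have hp0 : p = 0 := by nlinarith
    have hq0 : q = 0 := by nlinarith
    have u : ∀ a b c d, w ![a, b, c, d] = 0 := by
      have s1 : ∀ c d, w ![0, 1, c, d] = 0 := by
        intro c d
        fin_cases c <;> fin_cases d <;>
          simp only [Fin.zero_eta, Fin.mk_one, Fin.reduceFinMk, z2, k2, k3, v3, v4, v6, h2 _ _ 0 1,
            h2 _ _ 0 2, h2 _ _ 1 2, neg_zero]
      have s2 : ∀ c d, w ![0, 2, c, d] = 0 := by
        intro c d
        fin_cases c <;> fin_cases d <;>
          simp only [Fin.zero_eta, Fin.mk_one, Fin.reduceFinMk, z2, k2, k3, h3 0 1 0 2, v4,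
            h2 _ _ 0 1, h2 _ _ 0 2, h2 _ _ 1 2, neg_zero, ← hp, ← hq, hp0, hq0]
      have s3 : ∀ c d, w ![1, 2, c, d] = 0 := by
        intro c d
        fin_cases c <;> fin_cases d <;>
          simp only [Fin.zero_eta, Fin.mk_one, Fin.reduceFinMk, z2, k2, k3, h3 0 1 1 2, v6,
            h2 _ _ 0 1, h2 _ _ 0 2, h2 _ _ 1 2, neg_zero, v1, v2, hp0, hq0]
      intro a b c d
      fin_cases a <;> fin_cases b <;>
        simp only [Fin.zero_eta, Fin.mk_one, Fin.reduceFinMk, hk, k1, z1, s1, s2, s3, h1 0 1,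
          h1 0 2, h1 1 2, neg_zero]
    refine hw (funext fun i => ?_)
    have : i = ![i 0, i 1, i 2, i 3] := by funext m; fin_cases m <;> rfl
    rw [this]
    exact u _ _ _ _
  obtain ⟨a00, a11, a10, a30, a31, a20, a21, a33, a23, a32⟩ := skew_entries hA
  have e1 : act A w ![0, 2, 0, 2] = 0 := by rw [ha]; rfl
  have e2 : act A w ![0, 2, 1, 2] = 0 := by rw [ha]; rfl
  have e3 : act A w ![0, 1, 0, 2] = 0 := by rw [ha]; rfl
  have e4 : act A w ![0, 1, 1, 2] = 0 := by rw [ha]; rfl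
  simp only [act_four, Fin.sum_univ_four, hk, k1, k2, k3, z1, z2, a00, a11, a10, a20, a21, v1, v2,
    v3, v4, v6, ← hp, ← hq, h1 1 2, h2 _ _ 0 1, h3 0 1 0 2] at e1 e2 e3 e4
  have l0 : A 2 2 = 0 := by
    have : A 2 2 * (p ^ 2 + q ^ 2) = 0 := by linear_combination p / 2 * e1 + q / 2 * e2
    exact (mul_eq_zero.mp this).resolve_right hpq
  have r0 : A 0 1 = 0 := by
    have : A 0 1 * (p ^ 2 + q ^ 2) = 0 := by linear_combination -q / 2 * e1 + p / 2 * e2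
    exact (mul_eq_zero.mp this).resolve_right hpq
  have u0 : A 0 3 = 0 := by
    have : A 0 3 * (p ^ 2 + q ^ 2) = 0 := by linear_combination -q * e3 + p * e4
    exact (mul_eq_zero.mp this).resolve_right hpq
  have w0 : A 1 3 = 0 := by
    have : A 1 3 * (p ^ 2 + q ^ 2) = 0 := by linear_combination p * e3 + q * e4
    exact (mul_eq_zero.mp this).resolve_right hpq
  ext i j
  fin_cases i <;> fin_cases j <;> simp [nul, *]

end EtaNull

section TypeN

/-- Pass to a null frame with fourth vector along `k`; conjugation does not change the dimension.
There an isotropy of the curvature fixes the Weyl components, and `skew_of_act_typeN` leaves only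
the two-parameter family of null rotations. -/
theorem groupDim_isotropy_le_two {g : MatField 4} {W : Set (Fin 4 → ℝ)} (hW : IsOpen W)
    (hg : IsMetricOn etaNull g W) {x : Fin 4 → ℝ} (hx : x ∈ W) (hN : IsTypeN g x)
    {e : Matrix (Fin 4) (Fin 4) ℝ} (he : e.transpose * g x * e = etaNull)
    {G : Set (Matrix (Fin 4) (Fin 4) ℝ)} (hG : ∀ X ∈ G, X.transpose * etaNull * X = etaNull ∧
      comp (comp (nablaR g 0 x) e) X = comp (nablaR g 0 x) e) : groupDim G ≤ 2 := by
  have hs : ∀ x ∈ W, (g x).IsSymm := fun x hx => (hg.2 x hx).choose_spec.1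
  have hu : ∀ x ∈ W, IsUnit (g x).det := fun x hx => by
    obtain ⟨e, -, -, h⟩ := hg.2 x hx
    refine isUnit_iff_ne_zero.mpr fun h0 => isUnit_det_etaNull.ne_zero ?_
    rw [← h, Matrix.det_mul, Matrix.det_mul, h0]
    simp
  have hed : IsUnit e.det := by
    refine isUnit_iff_ne_zero.mpr fun h0 => isUnit_det_etaNull.ne_zero ?_
    rw [← he, Matrix.det_mul, h0, mul_zero]
  obtain ⟨k, hk0, hkn, hkw, hw⟩ := hN
  have hgx : g x = e⁻¹.transpose * etaNull * e⁻¹ := by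
    rw [← he]
    simp only [Matrix.mul_assoc]
    rw [Matrix.mul_nonsing_inv _ hed, Matrix.mul_one, ← Matrix.mul_assoc, ← Matrix.transpose_mul,
      Matrix.mul_nonsing_inv _ hed, Matrix.transpose_one, Matrix.one_mul]
  set kf := e⁻¹.mulVec k with hkf
  have hkf' : e.mulVec kf = k := by
    rw [hkf, Matrix.mulVec_mulVec, Matrix.mul_nonsing_inv _ hed, Matrix.one_mulVec]
  have hkf0 : kf ≠ 0 := fun h => hk0 (by rw [← hkf', h, Matrix.mulVec_zero])
  have hkn' : kf 0 ^ 2 + kf 1 ^ 2 = 2 * kf 2 * kf 3 := by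
    have h1 : dotProduct k ((g x).mulVec k) = 0 := by
      rw [← hkn]
      simp only [dotProduct, Matrix.mulVec, Finset.mul_sum]
      exact Finset.sum_congr rfl fun _ _ => Finset.sum_congr rfl fun _ _ => by ring
    have h2 : dotProduct kf (etaNull.mulVec kf) = 0 := by
      rw [← h1, hgx, ← Matrix.mulVec_mulVec, ← Matrix.mulVec_mulVec, ← hkf,
        Matrix.dotProduct_mulVec k, Matrix.vecMul_transpose, ← hkf]
    simp [dotProduct, Matrix.mulVec, etaNull, Fin.sum_univ_four] at h2
    linarith
  obtain ⟨Y, hY, r, hr⟩ := exists_null_frame hkf0 hkn'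
  have hYd : IsUnit Y.det := isUnit_iff_ne_zero.mpr fun h0 => isUnit_det_etaNull.ne_zero (by
    rw [← hY, Matrix.det_mul, h0, mul_zero])
  set e' := e * Y with he'
  have he'd : IsUnit e'.det := by rw [he', Matrix.det_mul]; exact hed.mul hYd
  have he'g : e'.transpose * g x * e' = etaNull := by
    rw [he', Matrix.transpose_mul]
    calc _ = Y.transpose * (e.transpose * g x * e) * Y := by simp only [Matrix.mul_assoc]
      _ = etaNull := by rw [he, hY]
  have hcol : ∀ i, e' i 3 = r * k i := fun i => by
    rw [← hkf', he', Matrix.mul_apply, Matrix.mulVec, dotProduct, Finset.mul_sum]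
    exact Finset.sum_congr rfl fun j _ => by rw [hr]; ring
  set w := comp (weylArr g x) e' with hwdef
  have hsym := weyl_symmetries hW hg.1 hs hu hx
  have hperm : ∀ (σ : Equiv.Perm (Fin 4)) (s : ℝ),
      (fun i : Fin 4 → Fin 4 => weylArr g x (i ∘ σ)) = s • weylArr g x →
      ∀ i : Fin 4 → Fin 4, w (i ∘ σ) = s * w i := by
    intro σ s h i
    have h1 := congrFun (comp_perm (weylArr g x) e' σ) i
    rw [h, comp_smul] at h1
    exact h1.symm
  have h1 : ∀ a b c d, w ![b, a, c, d] = -w ![a, b, c, d] := by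
    intro a b c d
    have := hperm (Equiv.swap 0 1) (-1) (by
      funext i
      change weyl g x (i 1) (i 0) (i 2) (i 3) = -1 * weyl g x (i 0) (i 1) (i 2) (i 3)
      rw [(hsym _ _ _ _).1]; ring) ![a, b, c, d]
    rw [neg_one_mul] at this
    rw [← this]
    congr 1
    funext i; fin_cases i <;> rfl
  have h2 : ∀ a b c d, w ![a, b, d, c] = -w ![a, b, c, d] := by
    intro a b c d
    have := hperm (Equiv.swap 2 3) (-1) (by
      funext i
      change weyl g x (i 0) (i 1) (i 3) (i 2) = -1 * weyl g x (i 0) (i 1) (i 2) (i 3)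
      rw [(hsym _ _ _ _).2.1]; ring) ![a, b, c, d]
    rw [neg_one_mul] at this
    rw [← this]
    congr 1
    funext i; fin_cases i <;> rfl
  have h3 : ∀ a b c d, w ![c, d, a, b] = w ![a, b, c, d] := by
    intro a b c d
    have := hperm (Equiv.swap 0 2 * Equiv.swap 1 3) 1 (by
      funext i
      change weyl g x (i 2) (i 3) (i 0) (i 1) = 1 * weyl g x (i 0) (i 1) (i 2) (i 3)
      rw [(hsym _ _ _ _).2.2]; ring) ![a, b, c, d]
    rw [one_mul] at this
    rw [← this]
    congr 1
    funext i; fin_cases i <;> rfl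
  have htr : trace13 etaNull w = 0 := by
    have hi : e' * etaNull * e'.transpose = (g x)⁻¹ := by
      have h := congrArg (fun m => m⁻¹) he'g
      simp only [Matrix.mul_inv_rev, etaNull_inv] at h
      rw [← h]
      simp only [Matrix.mul_assoc]
      rw [Matrix.nonsing_inv_mul _ (by rwa [Matrix.det_transpose]), Matrix.mul_one,
        Matrix.mul_nonsing_inv_cancel_left _ _ he'd]
    rw [hwdef, trace13_comp, hi, trace13_weylArr hs hu hx]
    simp
  have hk : ∀ b c d, w ![3, b, c, d] = 0 := by
    intro b c d
    rw [hwdef]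
    simp only [comp, sum_fin_four_fun, Fin.prod_univ_four]
    rw [Finset.sum_comm]
    refine Finset.sum_eq_zero fun b' _ => ?_
    rw [Finset.sum_comm]
    refine Finset.sum_eq_zero fun c' _ => ?_
    rw [Finset.sum_comm]
    refine Finset.sum_eq_zero fun d' _ => ?_
    have : ∀ a', e' a' 3 * e' b' b * e' c' c * e' d' d * weyl g x a' b' c' d' =
        r * e' b' b * e' c' c * e' d' d * (k a' * weyl g x a' b' c' d') := fun a' => by
      rw [hcol]; ring
    change ∑ a', e' a' 3 * e' b' b * e' c' c * e' d' d * weyl g x a' b' c' d' = 0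
    simp only [this, ← Finset.mul_sum, hkw, mul_zero]
  have hw0 : w ≠ 0 := by
    intro h
    obtain ⟨a, b, c, d, hne⟩ := hw
    have h4 : weylArr g x = 0 := comp_injective he'd (by
      change comp _ e' = comp _ e'
      rw [comp_zero, ← hwdef, h])
    exact hne (congrFun h4 ![a, b, c, d])
  set H : Set (Matrix (Fin 4) (Fin 4) ℝ) :=
    {X | X.transpose * etaNull * X = etaNull ∧ comp w X = w}
  have hH : groupDim H ≤ 2 := by
    have h5 := groupDim_le (G := H) (LinearMap.range nulL) fun A hA => by
      refine ⟨![A 0 2, A 1 2], ?_⟩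
      exact (skew_of_act_typeN h1 h2 h3 htr hk hw0 (skew_of_exp_smul fun s => (hA s).1)
        (act_eq_zero_of_comp_exp fun s => (hA s).2)).symm
    exact h5.trans ((LinearMap.finrank_range_le nulL).trans (by simp))
  have hYi : IsUnit Y⁻¹.det := by
    rw [Matrix.det_nonsing_inv, Ring.inverse_eq_inv']
    exact isUnit_iff_ne_zero.mpr (inv_ne_zero hYd.ne_zero)
  rw [← groupDim_conj hYi] at hH
  refine (groupDim_mono fun X hX => ?_).trans hH
  obtain ⟨hX1, hX2⟩ := hG X hX
  simp only [Set.mem_ofPred_eq, H, Matrix.nonsing_inv_nonsing_inv _ hYd]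
  refine ⟨?_, ?_⟩
  · have h6 : Y⁻¹.transpose * etaNull * Y⁻¹ = etaNull := by
      nth_rw 1 [← hY]
      simp only [Matrix.mul_assoc]
      rw [Matrix.mul_nonsing_inv _ hYd, Matrix.mul_one, ← Matrix.mul_assoc, ← Matrix.transpose_mul,
        Matrix.mul_nonsing_inv _ hYd, Matrix.transpose_one, Matrix.one_mul]
    rw [Matrix.transpose_mul, Matrix.transpose_mul]
    calc _ = Y.transpose * (X.transpose * (Y⁻¹.transpose * etaNull * Y⁻¹) * X) * Y := by
          simp only [Matrix.mul_assoc]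
      _ = etaNull := by rw [h6, hX1, hY]
  · set Z := e * X * e⁻¹ with hZ
    have hZe : Z * e = e * X := by rw [hZ, Matrix.mul_assoc, Matrix.nonsing_inv_mul _ hed,
      Matrix.mul_one]
    have hZg : Z.transpose * g x * Z = g x := by
      rw [hZ, Matrix.transpose_mul, Matrix.transpose_mul]
      calc _ = e⁻¹.transpose * (X.transpose * (e.transpose * g x * e) * X) * e⁻¹ := by
            simp only [Matrix.mul_assoc]
        _ = g x := by rw [he, hX1, hgx]
    have hZR : comp (nablaR g 0 x) Z = nablaR g 0 x := by
      apply comp_injective hed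
      change comp _ e = comp _ e
      rw [comp_comp, hZe, ← comp_comp, hX2]
    have hZw := comp_weylArr (hs x hx) (hu x hx) hZg hZR
    have h7 : e' * (Y⁻¹ * X * Y) = Z * e' := by
      rw [he', ← Matrix.mul_assoc Z, hZe]
      simp only [Matrix.mul_assoc]
      rw [Matrix.mul_nonsing_inv_cancel_left _ _ hYd]
    rw [hwdef, comp_comp, h7, ← comp_comp, hZw]

end TypeN

/-! ### The bound on the order of the algorithm -/

section Bound

variable {n : ℕ} {o : Bool} {η : Matrix (Fin n) (Fin n) ℝ} {g : MatField n} {W : Set (Fin n → ℝ)}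

theorem permitted_anti (std : (q : ℕ) → Set (Arr n (4 + q))) {p q : ℕ} (h : p ≤ q)
    (x : Fin n → ℝ) : permitted o η g std q x ⊆ permitted o η g std p x := by
  induction h with
  | refl => exact subset_rfl
  | step _ ih => exact fun e he => ih he.1

theorem KarlhedeRun.finrank_le (r : KarlhedeRun o η g W) (hW : W.Nonempty) {q : ℕ}
    (hq : q ≤ r.last) : r.t q ≤ n := by
  obtain ⟨x, hx⟩ := hW
  rw [← r.rank q hq x hx]
  refine (Submodule.finrank_le _).trans ?_
  have h2 : Module.finrank ℝ ((Fin n → ℝ) →L[ℝ] ℝ) = n := by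
    rw [← LinearMap.toContinuousLinearMap.finrank_eq, Module.finrank_linearMap]
    simp
  exact h2.le

/-- The frame of stage q + 1 was already permitted at stage q, and by uniqueness of the standard
forms both frames give the same components up to order q. -/
theorem KarlhedeRun.t_mono (r : KarlhedeRun o η g W) (hWo : IsOpen W) (hW : W.Nonempty) {q : ℕ}
    (hq : q + 1 ≤ r.last) : r.t q ≤ r.t (q + 1) := by
  obtain ⟨x, hx⟩ := hW
  rw [← r.rank q (by omega) x hx, ← r.rank (q + 1) hq x hx]
  refine Submodule.finrank_mono (Submodule.span_mono ?_)
  rintro α ⟨j, hj, i, rfl⟩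
  refine ⟨j, by omega, i, ?_⟩
  apply Filter.EventuallyEq.fderiv_eq
  filter_upwards [hWo.mem_nhds hx] with y hy
  rw [r.std_unique j (by omega) y hy (r.frame q y)
    (permitted_anti _ (by omega) _ (r.frame_mem q (by omega) y hy)) (r.frame (q + 1) y)
    (permitted_anti _ (by omega) _ (r.frame_mem (q + 1) hq y hy))]

theorem KarlhedeRun.isotropy_anti (r : KarlhedeRun o η g W) (hW : W.Nonempty) {q : ℕ}
    (hq : q + 1 ≤ r.last) : r.G (q + 1) ⊆ r.G q := by
  obtain ⟨x, hx⟩ := hW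
  rw [r.isotropy (q + 1) hq x hx _ (r.frame_mem (q + 1) hq x hx)]
  exact fun X hX => hX.1

theorem KarlhedeRun.last_le (r : KarlhedeRun o η g W) (hWo : IsOpen W) (hW : W.Nonempty) {d : ℕ}
    (hd : groupDim (r.G 0) ≤ d) : r.last ≤ d + n + 1 := by
  -- Stage 0 costs nothing, since only dim G₀ ≤ d is used; each later stage that continues either
  -- raises t or lowers the dimension, which keeps this inequality. With t ≤ n it bounds the
  -- continuing stages by d + n, and the terminating stage adds one.
  have h : ∀ q, q < r.last → groupDim (r.G q) ≤ d ∧ q + groupDim (r.G q) ≤ d + r.t q := by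
    intro q
    induction q with
    | zero => exact fun _ => ⟨hd, by omega⟩
    | succ q ih =>
      intro hq
      have h1 := ih (by omega)
      have h2 := r.t_mono hWo hW (q := q) (by omega)
      have h3 := groupDim_mono (r.isotropy_anti hW (q := q) (by omega))
      have h4 := r.continues (q + 1) hq
      simp only [before] at h4
      omega
  by_contra hcon
  have h1 := h (d + n + 1) (by omega)
  have h2 := r.finrank_le hW (q := d + n + 1) (by omega)
  omega

theorem typeNOrders_le (o : Bool) {N : ℕ} (h : N ∈ typeNOrders o) : N ≤ 7 := by
  obtain ⟨W, g, hWo, hW, hg, hN, r, rfl⟩ := h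
  obtain ⟨x, hx⟩ := hW
  have hm := r.frame_mem 0 (Nat.zero_le _) x hx
  refine r.last_le hWo ⟨x, hx⟩ (d := 2) (groupDim_isotropy_le_two hWo hg hx (hN x hx)
    (e := r.frame 0 x) hm.1.1 fun X hX => ?_)
  rw [r.isotropy 0 (Nat.zero_le _) x hx _ hm] at hX
  exact ⟨hX.1.1, hX.2⟩

end Bound

/-! ### Gradients -/

section Gradients

variable {n : ℕ} {f f' : (Fin n → ℝ) → ℝ} {v v' x : Fin n → ℝ}

/-- `f` is differentiable at `x` with partial derivatives `v`. -/
def HasGrad (f : (Fin n → ℝ) → ℝ) (v x : Fin n → ℝ) : Prop :=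
  HasFDerivAt f (∑ k, v k • ContinuousLinearMap.proj (R := ℝ) (φ := fun _ : Fin n => ℝ) k) x

theorem HasGrad.pd (h : HasGrad f v x) (c : Fin n) : pd c f x = v c := by
  simp [Karlhede.pd, HasFDerivAt.fderiv h, Pi.single_apply]

theorem HasGrad.differentiableAt (h : HasGrad f v x) : DifferentiableAt ℝ f x :=
  HasFDerivAt.differentiableAt h

theorem HasGrad.fderiv_apply (h : HasGrad f v x) (w : Fin n → ℝ) :
    fderiv ℝ f x w = ∑ k, w k * v k := by
  rw [fderiv_eq_sum_pd]
  simp only [h.pd]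

theorem HasGrad.const (r : ℝ) : HasGrad (fun _ : Fin n → ℝ => r) 0 x := by
  simpa [HasGrad] using hasFDerivAt_const r x

theorem HasGrad.coord (k : Fin n) : HasGrad (fun y : Fin n → ℝ => y k) (Pi.single k 1) x := by
  have : HasFDerivAt (fun y : Fin n → ℝ => y k)
      (ContinuousLinearMap.proj (R := ℝ) (φ := fun _ : Fin n => ℝ) k) x :=
    (ContinuousLinearMap.proj (R := ℝ) (φ := fun _ : Fin n => ℝ) k).hasFDerivAt
  unfold HasGrad
  convert this
  simp [Pi.single_apply]

theorem HasGrad.add (h : HasGrad f v x) (h' : HasGrad f' v' x) :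
    HasGrad (fun y => f y + f' y) (v + v') x := by
  have := HasFDerivAt.fun_add h h'
  unfold HasGrad
  simpa [add_smul, Finset.sum_add_distrib] using this

theorem HasGrad.mul (h : HasGrad f v x) (h' : HasGrad f' v' x) :
    HasGrad (fun y => f y * f' y) (f x • v' + f' x • v) x := by
  have := HasFDerivAt.fun_mul h h'
  unfold HasGrad
  simpa [add_smul, Finset.sum_add_distrib, Finset.smul_sum, smul_smul] using this

theorem HasGrad.const_mul (r : ℝ) (h : HasGrad f v x) : HasGrad (fun y => r * f y) (r • v) x := by
  have := (HasGrad.const r).mul h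
  simpa using this

theorem HasGrad.sub (h : HasGrad f v x) (h' : HasGrad f' v' x) :
    HasGrad (fun y => f y - f' y) (v - v') x := by
  have := h.add (h'.const_mul (-1))
  simpa [sub_eq_add_neg] using this

theorem HasGrad.real_comp {u : ℝ → ℝ} {u' : ℝ} (h : HasGrad f v x) (hu : HasDerivAt u u' (f x)) :
    HasGrad (fun y => u (f y)) (u' • v) x := by
  have := hu.comp_hasFDerivAt x h
  unfold HasGrad
  simp only [Pi.smul_apply, smul_assoc, ← Finset.smul_sum]
  exact this

theorem HasGrad.congr_grad (h : HasGrad f v x) (hv : v = v') : HasGrad f v' x := hv ▸ h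

end Gradients

/-! ### The orthonormal frame -/

section Frame

/-- The matrix with lowered components `A₁₂ = p`, `A₁₃ = q`, `A₁₄ = u`, `A₂₃ = y`, `A₂₄ = v` and
`A₃₄ = l`. -/
def so (p q u y v l : ℝ) : Matrix (Fin 4) (Fin 4) ℝ :=
  !![0, p, q, u; -p, 0, y, v; u, v, l, 0; q, y, 0, -l]

theorem so_skew (p q u y v l : ℝ) :
    (so p q u y v l).transpose * etaNull + etaNull * so p q u y v l = 0 := by
  ext i j
  fin_cases i <;> fin_cases j <;> simp [so, etaNull, Matrix.mul_apply, Fin.sum_univ_four]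

theorem so_add (p q u y v l p' q' u' y' v' l' : ℝ) : so p q u y v l + so p' q' u' y' v' l' =
    so (p + p') (q + q') (u + u') (y + y') (v + v') (l + l') := by
  ext i j
  fin_cases i <;> fin_cases j <;> simp [so] <;> ring

theorem so_smul (r p q u y v l : ℝ) : r • so p q u y v l =
    so (r * p) (r * q) (r * u) (r * y) (r * v) (r * l) := by
  ext i j
  fin_cases i <;> fin_cases j <;> simp [so]

theorem so_neg (p q u y v l : ℝ) : -so p q u y v l = so (-p) (-q) (-u) (-y) (-v) (-l) := by
  ext i j
  fin_cases i <;> fin_cases j <;> simp [so]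

theorem so_comm (p q u y v l p' q' u' y' v' l' : ℝ) :
    so p q u y v l * so p' q' u' y' v' l' - so p' q' u' y' v' l' * so p q u y v l =
    so (q * v' + u * y' - q' * v - u' * y) (p * y' + q * l' - p' * y - q' * l)
      (p * v' - u * l' - p' * v + u' * l) (-p * q' + y * l' + p' * q - y' * l)
      (-p * u' - v * l' + p' * u + v' * l) (u * q' + v * y' - u' * q - v' * y) := by
  ext i j
  fin_cases i <;> fin_cases j <;> simp [so] <;> ring

/-- The components of the Levi-Civita connection in the frame; `I` is the value of `I₁`. -/
def gam (κ μ I : ℝ) : Fin 4 → Matrix (Fin 4) (Fin 4) ℝ :=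
  ![so 0 0 0 (2 - 2 * μ) 0 (-4 * κ), so (2 * κ) 2 0 0 0 0, so 3 0 (-2 * κ) (6 * κ * I) 0 0,
    so 0 (-2 * κ) 0 0 0 0]

/-- A real coframe for the metric. -/
def cof (κ μ : ℝ) (F : ℝ → ℝ) : MatField 4 := fun x =>
  !![0, 1 / (2 * κ), -(Real.exp (x 1) * x 0) / κ, 0;
    -1 / κ, -x 0 / κ, Real.exp (x 1) * (x 0 ^ 2 + (μ / 2 - 5 / 4)) / κ, 0;
    0, 0, Real.exp (x 1), 0;
    -(μ / (2 * κ ^ 2)), -(μ / (2 * κ ^ 2) * x 0),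
      F (x 2) * Real.exp (-3 * x 1) - 6 * x 0 * Real.exp (-2 * x 1) * x 3
        + μ / (2 * κ ^ 2) * (x 0 ^ 2 + μ / 4 - 5 / 8) * Real.exp (x 1), Real.exp (-3 * x 1)]

/-- The frame dual to `cof`. -/
def frm (κ μ : ℝ) (F : ℝ → ℝ) : MatField 4 := fun x =>
  !![-2 * x 0 * κ, -κ, (μ / 2 - 5 / 4) - x 0 ^ 2, 0;
    2 * κ, 0, 2 * x 0, 0;
    0, 0, Real.exp (-x 1), 0;
    0, -(μ / (2 * κ)) * Real.exp (3 * x 1),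
      μ / (2 * κ ^ 2) * (μ / 4 - 5 / 8) * Real.exp (3 * x 1) - F (x 2) * Real.exp (-x 1)
        + 6 * x 0 * x 3, Real.exp (3 * x 1)]

variable {κ μ : ℝ} {F : ℝ → ℝ}

/-- Every exponential in the coframe is a power of e^b, so identities between its entries become
rational ones. -/
theorem exp_relations (b : ℝ) : Real.exp (-b) = (Real.exp b)⁻¹ ∧
    Real.exp (-2 * b) = (Real.exp b)⁻¹ ^ 2 ∧ Real.exp (-3 * b) = (Real.exp b)⁻¹ ^ 3 ∧
    Real.exp (3 * b) = Real.exp b ^ 3 ∧ Real.exp (-4 * b) = (Real.exp b)⁻¹ ^ 4 := by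
  refine ⟨Real.exp_neg b, ?_, ?_, ?_, ?_⟩
  · rw [← Real.exp_neg, ← Real.exp_nat_mul]; congr 1; push_cast; ring
  · rw [← Real.exp_neg, ← Real.exp_nat_mul]; congr 1; push_cast; ring
  · rw [← Real.exp_nat_mul]; congr 1
  · rw [← Real.exp_neg, ← Real.exp_nat_mul]; congr 1; push_cast; ring

theorem cof_mul_frm (hκ : κ ≠ 0) (x : Fin 4 → ℝ) : cof κ μ F x * frm κ μ F x = 1 := by
  obtain ⟨e1, e2, e3, e4, -⟩ := exp_relations (x 1)
  have hE := Real.exp_ne_zero (x 1)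
  ext i j
  fin_cases i <;> fin_cases j <;>
    simp [cof, frm, Matrix.mul_apply, Fin.sum_univ_four, e1, e2, e3, e4, -neg_mul] <;>
    field_simp <;> ring

theorem frm_mul_cof (hκ : κ ≠ 0) (x : Fin 4 → ℝ) : frm κ μ F x * cof κ μ F x = 1 :=
  mul_eq_one_comm.mp (cof_mul_frm hκ x)

theorem det_cof (x : Fin 4 → ℝ) :
    (cof κ μ F x).det = 1 / (2 * κ ^ 2) * (Real.exp (x 1) * Real.exp (-3 * x 1)) := by
  simp [cof, Matrix.det_succ_row_zero, Fin.sum_univ_succ, Fin.succAbove]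
  ring

theorem det_frm_pos (hκ : κ ≠ 0) (x : Fin 4 → ℝ) : 0 < (frm κ μ F x).det := by
  have h1 : (cof κ μ F x).det * (frm κ μ F x).det = 1 := by
    rw [← Matrix.det_mul, cof_mul_frm hκ, Matrix.det_one]
  have h2 : 0 < (cof κ μ F x).det := by
    rw [det_cof]
    positivity
  by_contra h
  nlinarith

theorem isUnit_det_cof (hκ : κ ≠ 0) (x : Fin 4 → ℝ) : IsUnit (cof κ μ F x).det :=
  Matrix.isUnit_det_of_right_inverse (cof_mul_frm hκ x)

theorem isUnit_det_frm (hκ : κ ≠ 0) (x : Fin 4 → ℝ) : IsUnit (frm κ μ F x).det :=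
  Matrix.isUnit_det_of_left_inverse (cof_mul_frm hκ x)

/-- The complex forms θ¹, θ² are κ/τ times E¹ ∓ iE², where Eᴬ are the rows of `cof`, and (κ/τ)² =
1/2. Thus 2θ¹θ² is the sum of the squares of E¹ and E². -/
theorem metric_eq {τ : ℝ} (hκ : 2 * κ ^ 2 = τ ^ 2) (hτ : τ ≠ 0) (x : Fin 4 → ℝ) :
    metric τ μ F x = (cof κ μ F x).transpose * etaNull * cof κ μ F x := by
  have hκ0 : κ ≠ 0 := by
    rintro rfl
    apply hτ
    simpa using hκ.symm
  have h0 : coframe τ μ F x 0 = fun i => ((κ / τ : ℝ) : ℂ) * (cof κ μ F x 0 i -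
      Complex.I * cof κ μ F x 1 i) := by
    have hκc : (κ : ℂ) ≠ 0 := by exact_mod_cast hκ0
    have hτc : (τ : ℂ) ≠ 0 := by exact_mod_cast hτ
    funext i
    fin_cases i <;> simp [coframe, cof] <;> field_simp <;> ring
  have h1 : coframe τ μ F x 1 = fun i => ((κ / τ : ℝ) : ℂ) * (cof κ μ F x 0 i +
      Complex.I * cof κ μ F x 1 i) := by
    have hκc : (κ : ℂ) ≠ 0 := by exact_mod_cast hκ0
    have hτc : (τ : ℂ) ≠ 0 := by exact_mod_cast hτ
    funext i
    fin_cases i <;> simp [coframe, cof] <;> field_simp <;> ring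
  have h2 : coframe τ μ F x 2 = fun i => (cof κ μ F x 2 i : ℂ) := by
    funext i
    fin_cases i <;> simp [coframe, cof]
  have h3 : coframe τ μ F x 3 = fun i => (cof κ μ F x 3 i : ℂ) := by
    funext i
    fin_cases i <;> simp [coframe, cof, hκ]
  have h4 : (κ / τ) * (κ / τ) * 2 = 1 := by
    field_simp
    linarith
  ext i j
  simp only [metric, Matrix.of_apply, h0, h1, h2, h3]
  have h5 : ((cof κ μ F x).transpose * etaNull * cof κ μ F x) i j =
      cof κ μ F x 0 i * cof κ μ F x 0 j + cof κ μ F x 1 i * cof κ μ F x 1 j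
      - cof κ μ F x 2 i * cof κ μ F x 3 j - cof κ μ F x 3 i * cof κ μ F x 2 j := by
    simp [Matrix.mul_apply, etaNull, Fin.sum_univ_four]
    ring
  rw [h5]
  generalize cof κ μ F x = M
  simp only [Complex.sub_re, Complex.add_re, Complex.mul_re, Complex.mul_im, Complex.ofReal_re,
    Complex.ofReal_im, Complex.I_re, Complex.I_im, Complex.sub_im, Complex.add_im]
  linear_combination (M 0 i * M 0 j + M 1 i * M 1 j) * h4

end Frame

/-! ### The first structure equation -/

section FrameEquations

variable {κ μ : ℝ} {F : ℝ → ℝ}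

/-- The partial derivatives of `cof`. -/
def dcof (κ μ : ℝ) (F : ℝ → ℝ) (x : Fin 4 → ℝ) : Fin 4 → Matrix (Fin 4) (Fin 4) ℝ :=
  ![!![0, 0, -Real.exp (x 1) / κ, 0;
      0, -1 / κ, Real.exp (x 1) * (2 * x 0) / κ, 0;
      0, 0, 0, 0;
      0, -(μ / (2 * κ ^ 2)), -6 * Real.exp (-2 * x 1) * x 3
        + μ / (2 * κ ^ 2) * (2 * x 0) * Real.exp (x 1), 0],
    !![0, 0, -(Real.exp (x 1) * x 0) / κ, 0;
      0, 0, Real.exp (x 1) * (x 0 ^ 2 + (μ / 2 - 5 / 4)) / κ, 0;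
      0, 0, Real.exp (x 1), 0;
      0, 0, -3 * F (x 2) * Real.exp (-3 * x 1) + 12 * x 0 * Real.exp (-2 * x 1) * x 3
        + μ / (2 * κ ^ 2) * (x 0 ^ 2 + μ / 4 - 5 / 8) * Real.exp (x 1), -3 * Real.exp (-3 * x 1)],
    !![0, 0, 0, 0; 0, 0, 0, 0; 0, 0, 0, 0; 0, 0, deriv F (x 2) * Real.exp (-3 * x 1), 0],
    !![0, 0, 0, 0; 0, 0, 0, 0; 0, 0, 0, 0; 0, 0, -6 * x 0 * Real.exp (-2 * x 1), 0]]

theorem hasGrad_exp {n : ℕ} (r : ℝ) (k : Fin n) (x : Fin n → ℝ) :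
    HasGrad (fun y => Real.exp (r * y k)) ((Real.exp (r * x k) * r) • Pi.single k 1) x := by
  have h1 : HasDerivAt (fun z => Real.exp (r * z)) (Real.exp (r * x k) * r) (x k) := by
    have := ((hasDerivAt_id (x k)).const_mul r).exp
    simpa using this
  exact (HasGrad.coord k).real_comp h1

theorem hasGrad_cof {x : Fin 4 → ℝ} (hF : DifferentiableAt ℝ F (x 2)) (i j : Fin 4) :
    HasGrad (fun y => cof κ μ F y i j) (fun c => dcof κ μ F x c i j) x := by
  have ha : HasGrad (fun y : Fin 4 → ℝ => y 0) (Pi.single 0 1) x := HasGrad.coord 0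
  have ht : HasGrad (fun y : Fin 4 → ℝ => y 3) (Pi.single 3 1) x := HasGrad.coord 3
  have hE := hasGrad_exp 1 1 x
  simp only [one_mul] at hE
  have hE2 := hasGrad_exp (-2) 1 x
  have hE3 := hasGrad_exp (-3) 1 x
  have hFs : HasGrad (fun y : Fin 4 → ℝ => F (y 2)) _ x :=
    HasGrad.real_comp (HasGrad.coord 2) hF.hasDerivAt
  have c0 : HasGrad (fun _ : Fin 4 → ℝ => (0 : ℝ)) 0 x := HasGrad.const 0
  have h02 := (hE.mul ha).const_mul (-1 / κ)
  have h11 := ha.const_mul (-1 / κ)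
  have h12 := (hE.mul ((ha.mul ha).add (HasGrad.const (μ / 2 - 5 / 4)))).const_mul (1 / κ)
  have h31 := ha.const_mul (-(μ / (2 * κ ^ 2)))
  have h32 := ((hFs.mul hE3).sub ((((ha.const_mul 6).mul hE2).mul ht))).add
    ((((ha.mul ha).add (HasGrad.const (μ / 4 - 5 / 8))).mul hE).const_mul (μ / (2 * κ ^ 2)))
  have key : ∀ {f f' : (Fin 4 → ℝ) → ℝ} {v w : Fin 4 → ℝ}, HasGrad f v x → (∀ y, f' y = f y) →
      (∀ c, w c = v c) → HasGrad f' w x := fun h h1 h2 => by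
    rw [funext h1, funext h2]; exact h
  fin_cases i <;> fin_cases j
  · exact key c0 (fun _ => rfl) (fun c => by fin_cases c <;> simp [dcof])
  · exact key (HasGrad.const (1 / (2 * κ))) (fun _ => rfl)
      (fun c => by fin_cases c <;> simp [dcof])
  · refine key h02 (fun _ => ?_) (fun c => ?_)
    · simp [cof]; ring
    · fin_cases c <;> simp [dcof] <;> ring
  · exact key c0 (fun _ => rfl) (fun c => by fin_cases c <;> simp [dcof])
  · exact key (HasGrad.const (-1 / κ)) (fun _ => rfl) (fun c => by fin_cases c <;> simp [dcof])
  · refine key h11 (fun _ => ?_) (fun c => ?_)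
    · simp [cof]; ring
    · fin_cases c <;> simp [dcof]
  · refine key h12 (fun _ => ?_) (fun c => ?_)
    · simp [cof]; ring
    · fin_cases c <;> simp [dcof] <;> ring
  · exact key c0 (fun _ => rfl) (fun c => by fin_cases c <;> simp [dcof])
  · exact key c0 (fun _ => rfl) (fun c => by fin_cases c <;> simp [dcof])
  · exact key c0 (fun _ => rfl) (fun c => by fin_cases c <;> simp [dcof])
  · exact key hE (fun _ => rfl) (fun c => by fin_cases c <;> simp [dcof])
  · exact key c0 (fun _ => rfl) (fun c => by fin_cases c <;> simp [dcof])
  · exact key (HasGrad.const (-(μ / (2 * κ ^ 2)))) (fun _ => rfl)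
      (fun c => by fin_cases c <;> simp [dcof])
  · refine key h31 (fun _ => ?_) (fun c => ?_)
    · simp [cof]
    · fin_cases c <;> simp [dcof]
  · refine key h32 (fun _ => ?_) (fun c => ?_)
    · simp [cof]; ring
    · fin_cases c <;> simp [dcof] <;> ring
  · refine key hE3 (fun _ => rfl) (fun c => ?_)
    fin_cases c <;> simp [dcof]; ring

theorem pdM_cof {x : Fin 4 → ℝ} (hF : DifferentiableAt ℝ F (x 2)) (c : Fin 4) :
    pdM c (cof κ μ F) x = dcof κ μ F x c := by
  ext i j
  exact (hasGrad_cof hF i j).pd c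

/-- The connection forms of the frame, with coordinate form index. -/
def omg (κ μ : ℝ) (F : ℝ → ℝ) (c : Fin 4) : MatField 4 := fun x =>
  ∑ A, cof κ μ F x A c • gam κ μ (I₁ x) A

theorem omg_skew (c : Fin 4) (x : Fin 4 → ℝ) :
    (omg κ μ F c x).transpose * etaNull + etaNull * omg κ μ F c x = 0 := by
  simp only [omg, Matrix.transpose_sum, Matrix.transpose_smul, Matrix.sum_mul, Matrix.mul_sum,
    Matrix.smul_mul, Matrix.mul_smul, ← Finset.sum_add_distrib, ← smul_add]
  refine Finset.sum_eq_zero fun A _ => ?_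
  fin_cases A <;> simp [gam, so_skew]

theorem omg_eq (c : Fin 4) (x : Fin 4 → ℝ) : omg κ μ F c x =
    so (2 * κ * cof κ μ F x 1 c + 3 * cof κ μ F x 2 c)
      (2 * cof κ μ F x 1 c - 2 * κ * cof κ μ F x 3 c) (-2 * κ * cof κ μ F x 2 c)
      ((2 - 2 * μ) * cof κ μ F x 0 c + 6 * κ * I₁ x * cof κ μ F x 2 c) 0
      (-4 * κ * cof κ μ F x 0 c) := by
  simp only [omg, Fin.sum_univ_four, gam, Matrix.cons_val, so_smul, so_add]
  congr 1 <;> ring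

theorem so_mul_apply (p q u y v l : ℝ) (M : Matrix (Fin 4) (Fin 4) ℝ) (a : Fin 4) :
    (so p q u y v l * M) 0 a = p * M 1 a + q * M 2 a + u * M 3 a ∧
    (so p q u y v l * M) 1 a = -p * M 0 a + y * M 2 a + v * M 3 a ∧
    (so p q u y v l * M) 2 a = u * M 0 a + v * M 1 a + l * M 2 a ∧
    (so p q u y v l * M) 3 a = q * M 0 a + y * M 1 a - l * M 3 a := by
  refine ⟨?_, ?_, ?_, ?_⟩ <;> (simp [so, Matrix.mul_apply, Fin.sum_univ_four]; try ring)

/-- This is dE + ω ∧ E = 0, the identity that determines the coefficients `gam`. It is antisymmetric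
in `c` and `a`, so it is enough to check ordered pairs. -/
theorem cof_torsion_of_lt (hκ : κ ≠ 0) (x : Fin 4 → ℝ) (c a d : Fin 4) (hca : c < a) :
    (dcof κ μ F x c + omg κ μ F c x * cof κ μ F x) d a =
      (dcof κ μ F x a + omg κ μ F a x * cof κ μ F x) d c := by
  obtain ⟨-, e2, e3, -, -⟩ := exp_relations (x 1)
  have hE := Real.exp_ne_zero (x 1)
  rw [Matrix.add_apply, Matrix.add_apply, omg_eq, omg_eq]
  have h0 := fun p q u y v l (M : Matrix (Fin 4) (Fin 4) ℝ) a => (so_mul_apply p q u y v l M a).1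
  have h1 := fun p q u y v l (M : Matrix (Fin 4) (Fin 4) ℝ) a => (so_mul_apply p q u y v l M a).2.1
  have h2 := fun p q u y v l (M : Matrix (Fin 4) (Fin 4) ℝ) a =>
    (so_mul_apply p q u y v l M a).2.2.1
  have h3 := fun p q u y v l (M : Matrix (Fin 4) (Fin 4) ℝ) a =>
    (so_mul_apply p q u y v l M a).2.2.2
  fin_cases d
  · change dcof κ μ F x c 0 a + _ = dcof κ μ F x a 0 c + _
    simp only [Fin.zero_eta, h0]
    fin_cases c <;> fin_cases a <;> first | exact absurd hca (by decide) | skip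
    all_goals
      simp only [dcof, cof, Fin.zero_eta, Fin.mk_one, Fin.reduceFinMk, Matrix.of_apply,
        Matrix.cons_val, e3]
      field_simp
      ring
  · change dcof κ μ F x c 1 a + _ = dcof κ μ F x a 1 c + _
    simp only [Fin.mk_one, h1]
    fin_cases c <;> fin_cases a <;> first | exact absurd hca (by decide) | skip
    all_goals
      simp only [dcof, cof, Fin.zero_eta, Fin.mk_one, Fin.reduceFinMk, Matrix.of_apply,
        Matrix.cons_val]
      field_simp
      ring
  · change dcof κ μ F x c 2 a + _ = dcof κ μ F x a 2 c + _
    simp only [Fin.reduceFinMk, h2]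
    fin_cases c <;> fin_cases a <;> first | exact absurd hca (by decide) | skip
    all_goals
      simp only [dcof, cof, Fin.zero_eta, Fin.mk_one, Fin.reduceFinMk, Matrix.of_apply,
        Matrix.cons_val]
      field_simp
      ring
  · change dcof κ μ F x c 3 a + _ = dcof κ μ F x a 3 c + _
    simp only [Fin.reduceFinMk, h3]
    fin_cases c <;> fin_cases a <;> first | exact absurd hca (by decide) | skip
    all_goals
      simp only [dcof, cof, I₁, Fin.zero_eta, Fin.mk_one, Fin.reduceFinMk, Matrix.of_apply,
        Matrix.cons_val, e2, e3]
      field_simp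
      ring

theorem cof_torsion (hκ : κ ≠ 0) (x : Fin 4 → ℝ) (c a d : Fin 4) :
    (dcof κ μ F x c + omg κ μ F c x * cof κ μ F x) d a =
      (dcof κ μ F x a + omg κ μ F a x * cof κ μ F x) d c := by
  rcases lt_trichotomy c a with h | h | h
  · exact cof_torsion_of_lt hκ x c a d h
  · rw [h]
  · exact (cof_torsion_of_lt hκ x a c d h).symm

end FrameEquations

/-! ### The second structure equation in a frame -/

section FrameCurvature

/-- The curvature in terms of the connection coefficients `γ` and their frame derivatives `Δ`. -/
theorem frame_curvature {n : ℕ} {θ : Matrix (Fin n) (Fin n) ℝ}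
    {dθ γ om : Fin n → Matrix (Fin n) (Fin n) ℝ} {Δ dom : Fin n → Fin n → Matrix (Fin n) (Fin n) ℝ}
    (hom : ∀ c, om c = ∑ A, θ A c • γ A)
    (ht : ∀ c a d, (dθ c + om c * θ) d a = (dθ a + om a * θ) d c)
    (hd : ∀ c d, dom c d = ∑ A, (dθ c A d • γ A + θ A d • ∑ B, θ B c • Δ B A)) (c d : Fin n) :
    dom c d - dom d c + (om c * om d - om d * om c) = ∑ B, ∑ C, (θ B c * θ C d) •
      (Δ B C - Δ C B + (γ B * γ C - γ C * γ B) - ∑ A, (γ B A C - γ C A B) • γ A) := by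
  have e1 : ∀ c d, om c * om d = ∑ B, ∑ C, (θ B c * θ C d) • (γ B * γ C) := by
    intro c d
    rw [hom c, hom d, Finset.sum_mul_sum]
    refine Finset.sum_congr rfl fun _ _ => Finset.sum_congr rfl fun _ _ => ?_
    rw [Matrix.smul_mul, Matrix.mul_smul, smul_smul]
  have e2 : ∀ c d A, (om c * θ) A d = ∑ B, ∑ C, θ B c * θ C d * γ B A C := by
    intro c d A
    rw [hom c, Matrix.sum_mul, Matrix.sum_apply]
    refine Finset.sum_congr rfl fun B _ => ?_
    rw [Matrix.smul_mul, Matrix.smul_apply, Matrix.mul_apply, smul_eq_mul, Finset.mul_sum]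
    exact Finset.sum_congr rfl fun C _ => by ring
  have e3 : ∀ A, dθ c A d - dθ d A c =
      ∑ B, ∑ C, θ B c * θ C d * (γ C A B - γ B A C) := by
    intro A
    have h1 := ht c d A
    rw [Matrix.add_apply, Matrix.add_apply, e2 c d A, e2 d c A] at h1
    have h2 : ∑ B, ∑ C, θ B d * θ C c * γ B A C = ∑ B, ∑ C, θ B c * θ C d * γ C A B := by
      rw [Finset.sum_comm]
      exact Finset.sum_congr rfl fun _ _ => Finset.sum_congr rfl fun _ _ => by ring
    rw [h2] at h1
    simp only [mul_sub, Finset.sum_sub_distrib]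
    linarith
  have e4 : ∑ A, dθ c A d • γ A - ∑ A, dθ d A c • γ A = ∑ B, ∑ C, (θ B c * θ C d) •
      -∑ A, (γ B A C - γ C A B) • γ A := by
    rw [← Finset.sum_sub_distrib]
    simp only [← sub_smul, e3, ← Finset.sum_neg_distrib, Finset.sum_smul, Finset.smul_sum]
    rw [Finset.sum_comm]
    refine Finset.sum_congr rfl fun B _ => ?_
    rw [Finset.sum_comm]
    refine Finset.sum_congr rfl fun C _ => Finset.sum_congr rfl fun A _ => ?_
    rw [← neg_smul, smul_smul]
    congr 1
    ring
  have e5 : ∀ c d, ∑ A, θ A d • ∑ B, θ B c • Δ B A = ∑ B, ∑ C, (θ B c * θ C d) • Δ B C := by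
    intro c d
    simp only [Finset.smul_sum, smul_smul]
    rw [Finset.sum_comm]
    exact Finset.sum_congr rfl fun _ _ => Finset.sum_congr rfl fun _ _ => by rw [mul_comm]
  have e6 : ∀ f : Fin n → Fin n → Matrix (Fin n) (Fin n) ℝ,
      ∑ B, ∑ C, (θ B d * θ C c) • f B C = ∑ B, ∑ C, (θ B c * θ C d) • f C B := by
    intro f
    rw [Finset.sum_comm]
    exact Finset.sum_congr rfl fun _ _ => Finset.sum_congr rfl fun _ _ => by rw [mul_comm]
  rw [hd c d, hd d c, Finset.sum_add_distrib, Finset.sum_add_distrib, e5, e5, e1, e1,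
    e6 (fun B C => Δ B C), e6 (fun B C => γ B * γ C)]
  have e7 : ∀ a b a' b' r : Matrix (Fin n) (Fin n) ℝ,
      a + b - (a' + b') + r = (b - b' + r) + (a - a') := fun _ _ _ _ _ => by abel
  rw [e7, e4]
  simp only [← Finset.sum_sub_distrib, ← Finset.sum_add_distrib, ← smul_sub, ← smul_add,
    ← sub_eq_add_neg]

end FrameCurvature

/-! ### The curvature components are constant -/

section Curvature

variable {κ μ : ℝ} {F : ℝ → ℝ}

/-- The components of `θ¹ ∧ θ³`. -/
def wedge1 : Matrix (Fin 4) (Fin 4) ℝ := !![0, 0, 1, 0; 0, 0, 0, 0; -1, 0, 0, 0; 0, 0, 0, 0]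

/-- The components of `θ² ∧ θ³`. -/
def wedge2 : Matrix (Fin 4) (Fin 4) ℝ := !![0, 0, 0, 0; 0, 0, 1, 0; 0, -1, 0, 0; 0, 0, 0, 0]

/-- The frame components of the curvature tensor. -/
def curvC (κ μ : ℝ) (a b c d : Fin 4) : ℝ :=
  -4 * κ ^ 2 * (etaNull a c * etaNull b d - etaNull a d * etaNull b c)
    + (8 - 5 * μ) * (-2 * (wedge1 a b * wedge1 c d) + wedge2 a b * wedge2 c d)

/-- The frame components of the curvature tensor, as an array. -/
def C₀ (κ μ : ℝ) : Arr 4 4 := fun i => curvC κ μ (i 0) (i 1) (i 2) (i 3)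

/-- The derivative of the connection components with respect to `I₁`. -/
def dgam (κ : ℝ) : Fin 4 → Matrix (Fin 4) (Fin 4) ℝ :=
  ![0, 0, (6 * κ) • so 0 0 0 1 0 0, 0]

theorem gam_eq (κ μ I : ℝ) (A : Fin 4) : gam κ μ I A = gam κ μ 0 A + I • dgam κ A := by
  fin_cases A
  · simp [gam, dgam]
  · simp [gam, dgam]
  · simp only [gam, dgam, so_smul, Fin.reduceFinMk, Matrix.cons_val, so_add]
    congr 1 <;> ring
  · simp [gam, dgam]

/-- `J = F e^{-4b}`, the exponential of `I₂`. -/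
def Jf (F : ℝ → ℝ) (x : Fin 4 → ℝ) : ℝ := F (x 2) * Real.exp (-4 * x 1)

/-- The frame derivatives of `I₁`. -/
def dI₁ (κ μ : ℝ) (F : ℝ → ℝ) (x : Fin 4 → ℝ) : Fin 4 → ℝ :=
  ![-6 * κ * I₁ x, -(μ / (2 * κ)), μ / (2 * κ ^ 2) * (μ / 4 - 5 / 8) - Jf F x, 1]

theorem hasGrad_I₁ (hκ : κ ≠ 0) (x : Fin 4 → ℝ) :
    HasGrad I₁ (fun c => ∑ B, cof κ μ F x B c * dI₁ κ μ F x B) x := by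
  obtain ⟨-, e2, e3, -, e4⟩ := exp_relations (x 1)
  have hE := Real.exp_ne_zero (x 1)
  refine ((hasGrad_exp (-3) 1 x).mul (HasGrad.coord 3)).congr_grad ?_
  funext c
  rw [Fin.sum_univ_four]
  fin_cases c <;>
    simp only [cof, dI₁, Jf, I₁, Fin.zero_eta, Fin.mk_one, Fin.reduceFinMk, Matrix.of_apply,
      Matrix.cons_val, e2, e3, e4, Pi.add_apply, Pi.smul_apply, smul_eq_mul] <;>
    simp <;> field_simp <;> ring

/-- The curvature endomorphisms in the frame. -/
def Om (κ μ : ℝ) (F : ℝ → ℝ) (x : Fin 4 → ℝ) (B C : Fin 4) : Matrix (Fin 4) (Fin 4) ℝ :=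
  dI₁ κ μ F x B • dgam κ C - dI₁ κ μ F x C • dgam κ B
    + (gam κ μ (I₁ x) B * gam κ μ (I₁ x) C - gam κ μ (I₁ x) C * gam κ μ (I₁ x) B)
    - ∑ A, (gam κ μ (I₁ x) B A C - gam κ μ (I₁ x) C A B) • gam κ μ (I₁ x) A

theorem Om_swap (x : Fin 4 → ℝ) (B C : Fin 4) : Om κ μ F x C B = -Om κ μ F x B C := by
  have : ∑ A, (gam κ μ (I₁ x) C A B - gam κ μ (I₁ x) B A C) • gam κ μ (I₁ x) A =
      -∑ A, (gam κ μ (I₁ x) B A C - gam κ μ (I₁ x) C A B) • gam κ μ (I₁ x) A := by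
    rw [← Finset.sum_neg_distrib]
    exact Finset.sum_congr rfl fun A _ => by rw [← neg_smul, neg_sub]
  rw [Om, this, Om]
  abel

theorem so_sub (p q u y v l p' q' u' y' v' l' : ℝ) : so p q u y v l - so p' q' u' y' v' l' =
    so (p - p') (q - q') (u - u') (y - y') (v - v') (l - l') := by
  ext i j
  fin_cases i <;> fin_cases j <;> simp [so] <;> ring

theorem so_congr {p q u y v l p' q' u' y' v' l' : ℝ} (h1 : p = p') (h2 : q = q') (h3 : u = u')
    (h4 : y = y') (h5 : v = v') (h6 : l = l') : so p q u y v l = so p' q' u' y' v' l' := by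
  rw [h1, h2, h3, h4, h5, h6]

/-- The terms with I₁ cancel. The derivative of I₁ along e₃, the only one that contains F, never
contributes: it would have to multiply the I₁-part of the connection in another direction, and that
part is zero. -/
theorem Om_eq_of_lt (hκ : κ ≠ 0) (x : Fin 4 → ℝ) (B C : Fin 4) (h : B < C) : Om κ μ F x B C =
    so (curvC κ μ 0 1 B C) (curvC κ μ 0 2 B C) (curvC κ μ 0 3 B C) (curvC κ μ 1 2 B C)
      (curvC κ μ 1 3 B C) (curvC κ μ 2 3 B C) := by
  have z : (0 : Matrix (Fin 4) (Fin 4) ℝ) = so 0 0 0 0 0 0 := by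
    ext i j
    fin_cases i <;> fin_cases j <;> simp [so]
  unfold Om
  rw [Fin.sum_univ_four]
  fin_cases B <;> fin_cases C <;> first | exact absurd h (by decide) | skip
  all_goals
    simp only [gam, dgam, dI₁, Fin.zero_eta, Fin.mk_one, Fin.reduceFinMk, Matrix.cons_val, so_comm,
      z, so_smul, so_sub, so_add]
    refine so_congr ?_ ?_ ?_ ?_ ?_ ?_
  all_goals
    simp [so, curvC, etaNull, wedge1, wedge2]
  all_goals
    field_simp
  all_goals
    ring

theorem curvC_swap_right (a b c d : Fin 4) : curvC κ μ a b d c = -curvC κ μ a b c d := by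
  have h1 : ∀ c d, wedge1 d c = -wedge1 c d := fun c d => by
    fin_cases c <;> fin_cases d <;> simp [wedge1]
  have h2 : ∀ c d, wedge2 d c = -wedge2 c d := fun c d => by
    fin_cases c <;> fin_cases d <;> simp [wedge2]
  unfold curvC
  rw [h1 c d, h2 c d]
  ring

theorem curvC_swap_left (a b c d : Fin 4) : curvC κ μ b a c d = -curvC κ μ a b c d := by
  have h1 : ∀ c d, wedge1 d c = -wedge1 c d := fun c d => by
    fin_cases c <;> fin_cases d <;> simp [wedge1]
  have h2 : ∀ c d, wedge2 d c = -wedge2 c d := fun c d => by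
    fin_cases c <;> fin_cases d <;> simp [wedge2]
  unfold curvC
  rw [h1 a b, h2 a b]
  ring

theorem Om_eq (hκ : κ ≠ 0) (x : Fin 4 → ℝ) (B C : Fin 4) : Om κ μ F x B C =
    so (curvC κ μ 0 1 B C) (curvC κ μ 0 2 B C) (curvC κ μ 0 3 B C) (curvC κ μ 1 2 B C)
      (curvC κ μ 1 3 B C) (curvC κ μ 2 3 B C) := by
  rcases lt_trichotomy B C with h | h | h
  · exact Om_eq_of_lt hκ x B C h
  · subst h
    have h1 : Om κ μ F x B B = 0 := by
      have := Om_swap (κ := κ) (μ := μ) (F := F) x B B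
      rw [eq_neg_iff_add_eq_zero, ← two_smul ℝ] at this
      exact (smul_eq_zero.mp this).resolve_left two_ne_zero
    have h2 : ∀ a b, curvC κ μ a b B B = 0 := fun a b => by
      linarith [curvC_swap_right (κ := κ) (μ := μ) a b B B]
    simp only [h1, h2]
    ext i j
    fin_cases i <;> fin_cases j <;> simp [so]
  · rw [Om_swap, Om_eq_of_lt hκ x C B h, so_neg]
    simp only [curvC_swap_right (κ := κ) (μ := μ) _ _ C B]

theorem etaNull_mul_Om (hκ : κ ≠ 0) (x : Fin 4 → ℝ) (a b c d : Fin 4) :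
    (etaNull * Om κ μ F x c d) a b = curvC κ μ a b c d := by
  have h : ∀ f : Fin 4 → Fin 4 → ℝ, (∀ a b, f b a = -f a b) →
      (etaNull * so (f 0 1) (f 0 2) (f 0 3) (f 1 2) (f 1 3) (f 2 3)) a b = f a b := by
    intro f hf
    have h0 : ∀ a, f a a = 0 := fun a => by linarith [hf a a]
    fin_cases a <;> fin_cases b <;>
      simp [etaNull, so, Matrix.mul_apply, Fin.sum_univ_four, h0, hf 0 1, hf 0 2, hf 0 3,
        hf 1 2, hf 1 3, hf 2 3]
  rw [Om_eq hκ]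
  exact h (fun a b => curvC κ μ a b c d) fun a b => curvC_swap_left a b c d

end Curvature

/-! ### The metrics of the family and their curvature tensor -/

section Family

variable {τ κ μ : ℝ} {J : Set ℝ} {F : ℝ → ℝ} {x : Fin 4 → ℝ}

theorem Admissible.isOpen_domain (hA : Admissible τ μ J F) : IsOpen (domain J) :=
  hA.isOpen.preimage (continuous_apply 2)

theorem kappa_ne (hA : Admissible τ μ J F) (hκ : 2 * κ ^ 2 = τ ^ 2) : κ ≠ 0 := by
  rintro rfl
  apply hA.tau_ne
  simpa using hκ.symm

theorem Admissible.contDiffOn_comp (_ : Admissible τ μ J F) {f : ℝ → ℝ}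
    (hf : ContDiffOn ℝ ∞ f J) : ContDiffOn ℝ ∞ (fun x : Fin 4 → ℝ => f (x 2)) (domain J) :=
  hf.comp (contDiff_apply ℝ ℝ (2 : Fin 4)).contDiffOn fun _ hx => hx

theorem smoothOn_cof (hA : Admissible τ μ J F) : SmoothOn (cof κ μ F) (domain J) := by
  obtain ⟨G, hG⟩ : ∃ G : (Fin 4 → ℝ) → ℝ, ∀ x, F (x 2) = G x := ⟨_, fun _ => rfl⟩
  have hF := hA.contDiffOn_comp hA.smooth
  simp only [hG] at hF
  intro i j
  fin_cases i <;> fin_cases j <;>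
    simp only [cof, hG, Fin.zero_eta, Fin.mk_one, Fin.reduceFinMk, Matrix.of_apply, Matrix.cons_val] <;>
    fun_prop

theorem smoothOn_frm (hA : Admissible τ μ J F) : SmoothOn (frm κ μ F) (domain J) := by
  obtain ⟨G, hG⟩ : ∃ G : (Fin 4 → ℝ) → ℝ, ∀ x, F (x 2) = G x := ⟨_, fun _ => rfl⟩
  have hF := hA.contDiffOn_comp hA.smooth
  simp only [hG] at hF
  intro i j
  fin_cases i <;> fin_cases j <;>
    simp only [frm, hG, Fin.zero_eta, Fin.mk_one, Fin.reduceFinMk, Matrix.of_apply, Matrix.cons_val] <;>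
    fun_prop

theorem frm_metric (hA : Admissible τ μ J F) (hκ : 2 * κ ^ 2 = τ ^ 2) (x : Fin 4 → ℝ) :
    (frm κ μ F x).transpose * metric τ μ F x * frm κ μ F x = etaNull := by
  have h := cof_mul_frm (μ := μ) (F := F) (kappa_ne hA hκ) x
  rw [metric_eq hκ hA.tau_ne]
  calc _ = (cof κ μ F x * frm κ μ F x).transpose * etaNull * (cof κ μ F x * frm κ μ F x) := by
        rw [Matrix.transpose_mul]; noncomm_ring
    _ = etaNull := by rw [h]; simp

theorem metric_isSymm (hA : Admissible τ μ J F) (x : Fin 4 → ℝ) : (metric τ μ F x).IsSymm := by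
  have hκ : 2 * (τ / √2) ^ 2 = τ ^ 2 := by
    rw [div_pow, Real.sq_sqrt zero_le_two]; ring
  rw [metric_eq hκ hA.tau_ne, Matrix.IsSymm, Matrix.transpose_mul, Matrix.transpose_mul,
    Matrix.transpose_transpose, etaNull_isSymm.eq, Matrix.mul_assoc]

theorem isUnit_det_metric (hA : Admissible τ μ J F) (x : Fin 4 → ℝ) :
    IsUnit (metric τ μ F x).det := by
  have hκ : 2 * (τ / √2) ^ 2 = τ ^ 2 := by
    rw [div_pow, Real.sq_sqrt zero_le_two]; ring
  have h := isUnit_det_cof (μ := μ) (F := F) (kappa_ne hA hκ) x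
  rw [metric_eq hκ hA.tau_ne, Matrix.det_mul, Matrix.det_mul, Matrix.det_transpose]
  exact (h.mul isUnit_det_etaNull).mul h

theorem smoothOn_metric (hA : Admissible τ μ J F) : SmoothOn (metric τ μ F) (domain J) := by
  have hκ : 2 * (τ / √2) ^ 2 = τ ^ 2 := by
    rw [div_pow, Real.sq_sqrt zero_le_two]; ring
  have h := smoothOn_cof (κ := τ / √2) hA
  exact ((h.transpose.mul (SmoothOn.const etaNull)).mul h).congr fun x _ =>
    metric_eq hκ hA.tau_ne x

theorem isMetricOn_metric (hA : Admissible τ μ J F) :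
    IsMetricOn etaNull (metric τ μ F) (domain J) := by
  have hκ : 2 * (τ / √2) ^ 2 = τ ^ 2 := by
    rw [div_pow, Real.sq_sqrt zero_le_two]; ring
  exact ⟨smoothOn_metric hA, fun x _ => ⟨frm (τ / √2) μ F x, metric_isSymm hA x,
    isUnit_det_frm (kappa_ne hA hκ) x, frm_metric hA hκ x⟩⟩

theorem Admissible.differentiableAt (hA : Admissible τ μ J F) (hx : x ∈ domain J) :
    DifferentiableAt ℝ F (x 2) :=
  (hA.smooth.differentiableOn (by simp)).differentiableAt (hA.isOpen.mem_nhds hx)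

theorem cof_mul_chr (hA : Admissible τ μ J F) (hκ : 2 * κ ^ 2 = τ ^ 2) (hx : x ∈ domain J)
    (c : Fin 4) : cof κ μ F x * chr (metric τ μ F) c x =
      pdM c (cof κ μ F) x + omg κ μ F c x * cof κ μ F x := by
  have hκ0 := kappa_ne hA hκ
  refine mul_chr_of_structure (h := fun _ => etaNull) (om := fun c => omg κ μ F c x)
    hA.isOpen_domain hx (fun y _ => metric_eq hκ hA.tau_ne y) etaNull_isSymm
    (isUnit_det_metric hA x) (isUnit_det_cof hκ0 x) ((smoothOn_cof hA).diffAt hA.isOpen_domain hx)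
    ((SmoothOn.const etaNull).diffAt hA.isOpen_domain hx) (fun c => ?_) (fun c a d => ?_) c
  · rw [pdM_const, omg_skew]
  · rw [pdM_cof (hA.differentiableAt hx), pdM_cof (hA.differentiableAt hx)]
    exact cof_torsion hκ0 x c a d

theorem hasGrad_omg (hκ : κ ≠ 0) (hF : DifferentiableAt ℝ F (x 2)) (d i j : Fin 4) :
    HasGrad (fun y => omg κ μ F d y i j) (fun c => (∑ A, (dcof κ μ F x c A d • gam κ μ (I₁ x) A +
      cof κ μ F x A d • ∑ B, cof κ μ F x B c • dI₁ κ μ F x B • dgam κ A)) i j) x := by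
  have h : ∀ A, HasGrad (fun y => cof κ μ F y A d * (gam κ μ 0 A i j + I₁ y * dgam κ A i j))
      (fun c => (dcof κ μ F x c A d • gam κ μ (I₁ x) A +
        cof κ μ F x A d • ∑ B, cof κ μ F x B c • dI₁ κ μ F x B • dgam κ A) i j) x := fun A => by
    refine ((hasGrad_cof hF A d).mul ((HasGrad.const (gam κ μ 0 A i j)).add
      ((hasGrad_I₁ (κ := κ) (μ := μ) (F := F) hκ x).mul
        (HasGrad.const (dgam κ A i j))))).congr_grad ?_
    funext c
    simp only [gam_eq κ μ (I₁ x) A, Pi.add_apply, Pi.smul_apply, Matrix.add_apply,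
      Matrix.smul_apply, Matrix.sum_apply, smul_eq_mul, Pi.zero_apply]
    simp only [← mul_assoc, ← Finset.sum_mul]
    ring
  have h2 := (((h 0).add (h 1)).add (h 2)).add (h 3)
  have e : (fun y => omg κ μ F d y i j) = fun y =>
      cof κ μ F y 0 d * (gam κ μ 0 0 i j + I₁ y * dgam κ 0 i j) +
      cof κ μ F y 1 d * (gam κ μ 0 1 i j + I₁ y * dgam κ 1 i j) +
      cof κ μ F y 2 d * (gam κ μ 0 2 i j + I₁ y * dgam κ 2 i j) +
      cof κ μ F y 3 d * (gam κ μ 0 3 i j + I₁ y * dgam κ 3 i j) := by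
    funext y
    simp only [omg, gam_eq κ μ (I₁ y), Fin.sum_univ_four, Matrix.add_apply, Matrix.smul_apply,
      smul_eq_mul]
  rw [e]
  refine h2.congr_grad ?_
  funext c
  rw [Fin.sum_univ_four]
  rfl

theorem cof_mul_curv (hA : Admissible τ μ J F) (hκ : 2 * κ ^ 2 = τ ^ 2) (hx : x ∈ domain J)
    (c d : Fin 4) : cof κ μ F x * curv (metric τ μ F) c d x =
      (∑ B, ∑ C, (cof κ μ F x B c * cof κ μ F x C d) • Om κ μ F x B C) * cof κ μ F x := by
  have hκ0 := kappa_ne hA hκ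
  have hF := hA.differentiableAt hx
  rw [curv_of_gauge hA.isOpen_domain hx (smoothOn_cof hA) (om := omg κ μ F)
    (fun c i j => (hasGrad_omg hκ0 hF c i j).differentiableAt)
    (fun c => (smoothOn_chr hA.isOpen_domain (smoothOn_metric hA)
      (fun y _ => isUnit_det_metric hA y) c).diffAt hA.isOpen_domain hx)
    (fun y hy c => cof_mul_chr hA hκ hy c)]
  congr 1
  have hp : ∀ c d, pdM c (omg κ μ F d) x = ∑ A, (dcof κ μ F x c A d • gam κ μ (I₁ x) A +
      cof κ μ F x A d • ∑ B, cof κ μ F x B c • dI₁ κ μ F x B • dgam κ A) := fun c d => by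
    ext i j
    exact (hasGrad_omg hκ0 hF d i j).pd c
  rw [hp c d, hp d c]
  exact frame_curvature (Δ := fun B A => dI₁ κ μ F x B • dgam κ A)
    (dom := fun c d => ∑ A, (dcof κ μ F x c A d • gam κ μ (I₁ x) A +
      cof κ μ F x A d • ∑ B, cof κ μ F x B c • dI₁ κ μ F x B • dgam κ A))
    (om := fun c => omg κ μ F c x) (fun c => rfl) (cof_torsion hκ0 x) (fun c d => rfl) c d

theorem comp_four {n : ℕ} (T : Arr n 4) (P : Matrix (Fin n) (Fin n) ℝ) (a b c d : Fin n) :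
    comp T P ![a, b, c, d] = ∑ e, ∑ f, ∑ g, ∑ h, P e a * P f b * P g c * P h d * T ![e, f, g, h] := by
  rw [comp, sum_fin_four_fun]
  simp only [Fin.prod_univ_four, Matrix.cons_val]

theorem comp_four_of_endo {n : ℕ} (P η : Matrix (Fin n) (Fin n) ℝ)
    (O : Fin n → Fin n → Matrix (Fin n) (Fin n) ℝ) (T : Arr n 4)
    (hT : ∀ a b c d, T ![a, b, c, d] = (η * O c d) a b) (a b c d : Fin n) :
    (P.transpose * (η * ∑ B, ∑ C, (P B c * P C d) • O B C) * P) a b =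
      comp T P ![a, b, c, d] := by
  have h : ∀ M : Matrix (Fin n) (Fin n) ℝ, (P.transpose * M * P) a b =
      ∑ e, ∑ f, P e a * P f b * M e f := fun M => by
    rw [Matrix.mul_apply, Finset.sum_comm]
    refine Finset.sum_congr rfl fun f _ => ?_
    rw [Matrix.mul_apply, Finset.sum_mul]
    refine Finset.sum_congr rfl fun e _ => ?_
    rw [Matrix.transpose_apply]
    ring
  rw [comp_four, h]
  refine Finset.sum_congr rfl fun e _ => Finset.sum_congr rfl fun f _ => ?_
  simp only [Matrix.mul_smul, Matrix.sum_apply, Matrix.smul_apply, smul_eq_mul,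
    Finset.mul_sum, hT]
  exact Finset.sum_congr rfl fun _ _ => Finset.sum_congr rfl fun _ _ => by ring

theorem riem_metric (hA : Admissible τ μ J F) (hκ : 2 * κ ^ 2 = τ ^ 2) (hx : x ∈ domain J)
    (a b c d : Fin 4) : riem (metric τ μ F) x a b c d =
      comp (C₀ κ μ) (cof κ μ F x) ![a, b, c, d] := by
  rw [riem_of_gauge (h := fun _ => etaNull) (metric_eq hκ hA.tau_ne x)
    (cof_mul_curv hA hκ hx c d)]
  exact comp_four_of_endo _ _ _ _
    (fun a b c d => (etaNull_mul_Om (kappa_ne hA hκ) x a b c d).symm) a b c d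

theorem nablaR_zero_eq (hA : Admissible τ μ J F) (hκ : 2 * κ ^ 2 = τ ^ 2) (hx : x ∈ domain J) :
    nablaR (metric τ μ F) 0 x = comp (C₀ κ μ) (cof κ μ F x) := by
  funext i
  refine (riem_metric hA hκ hx (i 0) (i 1) (i 2) (i 3)).trans (congrArg _ ?_)
  funext j
  fin_cases j <;> rfl

end Family

/-! ### Ricci tensor, Weyl tensor and Petrov type -/

section TypeN

variable {τ κ μ : ℝ} {J : Set ℝ} {F : ℝ → ℝ} {x : Fin 4 → ℝ}

/-- The array is a combination of outer products of η and of two 2-forms, so a change of frame acts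
by congruence on these three matrices. -/
theorem comp_C₀ (κ μ : ℝ) (X : Matrix (Fin 4) (Fin 4) ℝ) (i : Fin 4 → Fin 4) :
    comp (C₀ κ μ) X i = -4 * κ ^ 2 *
      ((X.transpose * etaNull * X) (i 0) (i 2) * (X.transpose * etaNull * X) (i 1) (i 3)
        - (X.transpose * etaNull * X) (i 0) (i 3) * (X.transpose * etaNull * X) (i 1) (i 2))
      + (8 - 5 * μ) *
        (-2 * ((X.transpose * wedge1 * X) (i 0) (i 1) * (X.transpose * wedge1 * X) (i 2) (i 3))
          + (X.transpose * wedge2 * X) (i 0) (i 1) * (X.transpose * wedge2 * X) (i 2) (i 3)) := by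
  have h1 : ∀ f : Fin 4 → Fin 4, Function.Bijective f → ∀ P Q : Matrix (Fin 4) (Fin 4) ℝ,
      comp (fun i => arr4 P Q (i ∘ f)) X =
        fun i => arr4 (X.transpose * P * X) (X.transpose * Q * X) (i ∘ f) := fun f hf P Q => by
    rw [← comp_arr4]
    exact comp_perm (arr4 P Q) X (Equiv.ofBijective f hf)
  have h : C₀ κ μ =
      (-4 * κ ^ 2) • (fun i : Fin 4 → Fin 4 => arr4 etaNull etaNull (i ∘ ![0, 2, 1, 3]))
      + (4 * κ ^ 2) • (fun i : Fin 4 → Fin 4 => arr4 etaNull etaNull (i ∘ ![0, 3, 1, 2]))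
      + (-2 * (8 - 5 * μ)) • arr4 wedge1 wedge1 + (8 - 5 * μ) • arr4 wedge2 wedge2 := by
    funext i
    change curvC κ μ (i 0) (i 1) (i 2) (i 3) =
      (-4 * κ ^ 2) * (etaNull (i 0) (i 2) * etaNull (i 1) (i 3))
      + (4 * κ ^ 2) * (etaNull (i 0) (i 3) * etaNull (i 1) (i 2))
      + (-2 * (8 - 5 * μ)) * (wedge1 (i 0) (i 1) * wedge1 (i 2) (i 3))
      + (8 - 5 * μ) * (wedge2 (i 0) (i 1) * wedge2 (i 2) (i 3))
    unfold curvC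
    ring
  rw [h]
  simp only [comp_add, comp_smul]
  rw [h1 ![0, 2, 1, 3] (by decide), h1 ![0, 3, 1, 2] (by decide), comp_arr4, comp_arr4]
  change (-4 * κ ^ 2) * ((X.transpose * etaNull * X) (i 0) (i 2) *
        (X.transpose * etaNull * X) (i 1) (i 3))
      + (4 * κ ^ 2) * ((X.transpose * etaNull * X) (i 0) (i 3) *
        (X.transpose * etaNull * X) (i 1) (i 2))
      + (-2 * (8 - 5 * μ)) *
        ((X.transpose * wedge1 * X) (i 0) (i 1) * (X.transpose * wedge1 * X) (i 2) (i 3))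
      + (8 - 5 * μ) *
        ((X.transpose * wedge2 * X) (i 0) (i 1) * (X.transpose * wedge2 * X) (i 2) (i 3)) = _
  ring

theorem trace13_C₀ : trace13 etaNull (C₀ κ μ) =
    (-12 * κ ^ 2) • etaNull - (8 - 5 * μ) • !![0, 0, 0, 0; 0, 0, 0, 0; 0, 0, 1, 0; 0, 0, 0, 0] := by
  ext b d
  simp only [trace13, Matrix.of_apply, C₀, Matrix.cons_val]
  fin_cases b <;> fin_cases d <;>
    simp [Fin.sum_univ_four, curvC, etaNull, wedge1, wedge2] <;> ring

theorem wedge1_conj (P : Matrix (Fin 4) (Fin 4) ℝ) (a b : Fin 4) :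
    (P.transpose * wedge1 * P) a b = P 0 a * P 2 b - P 2 a * P 0 b := by
  simp [Matrix.mul_apply, wedge1, Fin.sum_univ_four]
  ring

theorem wedge2_conj (P : Matrix (Fin 4) (Fin 4) ℝ) (a b : Fin 4) :
    (P.transpose * wedge2 * P) a b = P 1 a * P 2 b - P 2 a * P 1 b := by
  simp [Matrix.mul_apply, wedge2, Fin.sum_univ_four]
  ring

theorem etaNull_conj (P : Matrix (Fin 4) (Fin 4) ℝ) (a b : Fin 4) :
    (P.transpose * etaNull * P) a b =
      P 0 a * P 0 b + P 1 a * P 1 b - P 2 a * P 3 b - P 3 a * P 2 b := by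
  simp [Matrix.mul_apply, etaNull, Fin.sum_univ_four]
  ring

theorem ricci_metric (hA : Admissible τ μ J F) (hκ : 2 * κ ^ 2 = τ ^ 2) (hx : x ∈ domain J)
    (i j : Fin 4) : ricci (metric τ μ F) x i j = -6 * τ ^ 2 * metric τ μ F x i j
      + (5 * μ - 8) * cof κ μ F x 2 i * cof κ μ F x 2 j := by
  have h := ricci_eq_trace13 (metric_isSymm hA x) (isUnit_det_metric hA x)
  have hκ0 := kappa_ne hA hκ
  have hP : cof κ μ F x * (metric τ μ F x)⁻¹ * (cof κ μ F x).transpose = etaNull := by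
    have hu := isUnit_det_cof (μ := μ) (F := F) hκ0 x
    rw [metric_eq hκ hA.tau_ne, Matrix.mul_inv_rev, Matrix.mul_inv_rev, etaNull_inv,
      Matrix.mul_nonsing_inv_cancel_left _ _ hu, Matrix.mul_assoc,
      Matrix.nonsing_inv_mul _ (by rwa [Matrix.det_transpose]), Matrix.mul_one]
  rw [nablaR_zero_eq hA hκ hx] at h
  have h2 := trace13_comp (metric τ μ F x)⁻¹ (cof κ μ F x) (C₀ κ μ)
  rw [hP, trace13_C₀] at h2
  have h3 := congrFun (congrFun (h.trans h2) i) j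
  rw [Matrix.of_apply] at h3
  rw [h3, metric_eq hκ hA.tau_ne, Matrix.mul_sub, Matrix.sub_mul, Matrix.mul_smul, Matrix.smul_mul,
    Matrix.sub_apply, Matrix.smul_apply, smul_eq_mul, Matrix.mul_smul, Matrix.smul_mul,
    Matrix.smul_apply]
  have h4 : ∀ P : Matrix (Fin 4) (Fin 4) ℝ,
      (P.transpose * (!![0, 0, 0, 0; 0, 0, 0, 0; 0, 0, 1, 0; 0, 0, 0, 0] :
        Matrix (Fin 4) (Fin 4) ℝ) * P) i j = P 2 i * P 2 j := fun P => by
    simp [Matrix.mul_apply, Fin.sum_univ_four]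
  rw [h4, smul_eq_mul, ← hκ]
  ring

theorem exists_typeN_vector (hA : Admissible τ μ J F) (hx : x ∈ domain J) :
    ∃ k : Fin 4 → ℝ, IsTypeNAlong (metric τ μ F) x k ∧
      (∀ i, ((∑ j, metric τ μ F x i j * k j : ℝ) : ℂ) = coframe τ μ F x 2 i) ∧
      ∀ i j, ricci (metric τ μ F) x i j = -6 * τ ^ 2 * metric τ μ F x i j +
        (5 * μ - 8) * (∑ l, metric τ μ F x i l * k l) * (∑ l, metric τ μ F x j l * k l) := by
  obtain ⟨κ, hκ⟩ : ∃ κ, 2 * κ ^ 2 = τ ^ 2 := ⟨τ / √2, by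
    rw [div_pow, Real.sq_sqrt zero_le_two]; ring⟩
  have hκ0 := kappa_ne hA hκ
  have hric := ricci_metric hA hκ hx
  set P := cof κ μ F x with hP
  set E := frm κ μ F x with hE
  have hPE : P * E = 1 := cof_mul_frm hκ0 x
  have hPk : ∀ A, ∑ j, P A j * -E j 3 = if A = 3 then -1 else 0 := fun A => by
    have := congrFun (congrFun hPE A) 3
    rw [Matrix.mul_apply, Matrix.one_apply] at this
    simp only [mul_neg, Finset.sum_neg_distrib, this]
    split_ifs <;> simp
  have hg : ∀ i j, metric τ μ F x i j =
      P 0 i * P 0 j + P 1 i * P 1 j - P 2 i * P 3 j - P 3 i * P 2 j := fun i j => by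
    rw [metric_eq hκ hA.tau_ne, etaNull_conj]
  have hgk : ∀ i, ∑ j, metric τ μ F x i j * -E j 3 = P 2 i := fun i => by
    have : ∀ j, metric τ μ F x i j * -E j 3 = P 0 i * (P 0 j * -E j 3) + P 1 i * (P 1 j * -E j 3)
        - P 2 i * (P 3 j * -E j 3) - P 3 i * (P 2 j * -E j 3) := fun j => by rw [hg]; ring
    simp only [this, Finset.sum_add_distrib, Finset.sum_sub_distrib, ← Finset.mul_sum, hPk]
    simp
  -- The one-form E³ is null, so the second term of the Ricci tensor is trace-free.
  have hsc : scal (metric τ μ F) x = -24 * τ ^ 2 := by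
    have h1 : ∀ b, ∑ d, (metric τ μ F x)⁻¹ b d * P 2 d = -E b 3 := fun b => by
      have := congrFun (Matrix.mulVec_mulVec (fun j => -E j 3) (metric τ μ F x)⁻¹
        (metric τ μ F x)) b
      rw [Matrix.nonsing_inv_mul _ (isUnit_det_metric hA x), Matrix.one_mulVec] at this
      rw [← this]
      simp only [Matrix.mulVec, dotProduct, hgk]
    have h2 : ∑ b, ∑ d, (metric τ μ F x)⁻¹ b d * metric τ μ F x b d = 4 := by
      have h3 : ∀ b, ∑ d, (metric τ μ F x)⁻¹ b d * metric τ μ F x b d = 1 := fun b => by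
        have := congrFun (congrFun (Matrix.nonsing_inv_mul _ (isUnit_det_metric hA x)) b) b
        rw [Matrix.mul_apply, Matrix.one_apply_eq] at this
        rw [← this]
        exact Finset.sum_congr rfl fun d _ => by rw [(metric_isSymm hA x).apply b d]
      simp [h3]
    have h4 : ∀ b d, (metric τ μ F x)⁻¹ b d * ricci (metric τ μ F) x b d =
        -6 * τ ^ 2 * ((metric τ μ F x)⁻¹ b d * metric τ μ F x b d) +
        (5 * μ - 8) * P 2 b * ((metric τ μ F x)⁻¹ b d * P 2 d) := fun b d => by
      rw [hric]; ring
    simp only [scal, h4, Finset.sum_add_distrib, ← Finset.mul_sum, h2, h1, mul_assoc, hPk 2]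
    simp
    ring
  -- The part of constant curvature drops out, and what remains is proportional to 8 - 5μ.
  have hW : ∀ a b c d, weyl (metric τ μ F) x a b c d = (8 - 5 * μ) * (
      -2 * ((P 0 a * P 2 b - P 2 a * P 0 b) * (P 0 c * P 2 d - P 2 c * P 0 d))
      + (P 1 a * P 2 b - P 2 a * P 1 b) * (P 1 c * P 2 d - P 2 c * P 1 d)
      + 1 / 2 * (metric τ μ F x a c * P 2 b * P 2 d - metric τ μ F x a d * P 2 b * P 2 c
        - metric τ μ F x b c * P 2 a * P 2 d + metric τ μ F x b d * P 2 a * P 2 c)) := by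
    intro a b c d
    rw [weyl, hsc, hric, hric, hric, hric, riem_metric hA hκ hx, comp_C₀,
      ← metric_eq hκ hA.tau_ne x]
    simp only [wedge1_conj, wedge2_conj, Matrix.cons_val, ← hP]
    rw [← hκ]
    ring
  -- The vector is -e₄; the sign is due to η₃₄ = -1, so that lowering its index gives E³. The
  -- component exhibited as nonzero is the one along `da`, `ds`, `da`, `ds`.
  refine ⟨fun i => -E i 3, ⟨fun h => ?_, ?_, fun b c d => ?_, 0, 2, 0, 2, ?_⟩, fun i => ?_,
    fun i j => ?_⟩
  · have := hPk 3
    have h' : ∀ i, -E i 3 = 0 := fun i => congrFun h i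
    simp [h'] at this
  · have : ∀ i, ∑ j, metric τ μ F x i j * -E i 3 * -E j 3 = P 2 i * -E i 3 := fun i => by
      rw [← hgk i, Finset.sum_mul]
      exact Finset.sum_congr rfl fun j _ => by ring
    simp only [this, hPk]
    simp
  · have hgk' : ∀ i, ∑ j, metric τ μ F x j i * -E j 3 = P 2 i := fun i => by
      rw [← hgk i]
      exact Finset.sum_congr rfl fun j _ => by rw [(metric_isSymm hA x).apply]
    have : ∀ a, -E a 3 * weyl (metric τ μ F) x a b c d = (8 - 5 * μ) * (
        -2 * ((P 0 a * -E a 3) * (P 2 b * (P 0 c * P 2 d - P 2 c * P 0 d)))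
        + 2 * ((P 2 a * -E a 3) * (P 0 b * (P 0 c * P 2 d - P 2 c * P 0 d)))
        + (P 1 a * -E a 3) * (P 2 b * (P 1 c * P 2 d - P 2 c * P 1 d))
        - (P 2 a * -E a 3) * (P 1 b * (P 1 c * P 2 d - P 2 c * P 1 d))
        + 1 / 2 * ((metric τ μ F x a c * -E a 3) * (P 2 b * P 2 d)
          - (metric τ μ F x a d * -E a 3) * (P 2 b * P 2 c)
          - (P 2 a * -E a 3) * (metric τ μ F x b c * P 2 d)
          + (P 2 a * -E a 3) * (metric τ μ F x b d * P 2 c))) := fun a => by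
      rw [hW]; ring
    simp only [this, ← Finset.mul_sum, Finset.sum_add_distrib, Finset.sum_sub_distrib,
      ← Finset.sum_mul, hPk, hgk']
    simp
    right
    ring
  -- The value of this component is (8 - 5μ)·(3/2)·(e^b/κ)².
  · rw [hW, hg, hg, hg, hg]
    have h0 : P 0 0 = 0 := rfl
    have h1 : P 1 0 = -1 / κ := rfl
    have h2 : P 2 0 = 0 := rfl
    have h3 : P 2 2 = Real.exp (x 1) := rfl
    rw [h0, h1, h2, h3]
    have hν : 8 - 5 * μ ≠ 0 := fun h => hA.mu_ne (by linarith)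
    have hE := Real.exp_ne_zero (x 1)
    refine mul_ne_zero hν ?_
    have : (Real.exp (x 1) / κ) ^ 2 ≠ 0 := pow_ne_zero _ (div_ne_zero hE hκ0)
    intro h
    apply this
    have e : (Real.exp (x 1) / κ) ^ 2 = 2 / 3 * (-2 * ((0 * Real.exp (x 1) - 0 * P 0 2) *
      (0 * Real.exp (x 1) - 0 * P 0 2)) + (-1 / κ * Real.exp (x 1) - 0 * P 1 2) *
      (-1 / κ * Real.exp (x 1) - 0 * P 1 2) + 1 / 2 * ((0 * 0 + -1 / κ * (-1 / κ) - 0 * P 3 0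
      - P 3 0 * 0) * Real.exp (x 1) * Real.exp (x 1))) := by
      field_simp
      ring
    rw [e]
    refine Eq.trans ?_ (congrArg (fun r => 2 / 3 * r) h) |>.trans (mul_zero _)
    ring
  · rw [hgk]
    have : coframe τ μ F x 2 = fun i => (cof κ μ F x 2 i : ℂ) := by
      funext i
      fin_cases i <;> simp [coframe, cof]
    rw [this]
  · rw [hgk, hgk, hric]

end TypeN

/-! ### Changes of frame and null rotations -/

section Conjugation

variable {κ μ κ' μ' : ℝ} {X : Matrix (Fin 4) (Fin 4) ℝ}

theorem inv_of_preserves (hX : X.transpose * etaNull * X = etaNull) :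
    X⁻¹ = etaNull * X.transpose * etaNull := by
  refine Matrix.inv_eq_left_inv ?_
  rw [Matrix.mul_assoc, Matrix.mul_assoc, ← Matrix.mul_assoc X.transpose, hX, etaNull_mul_self]

theorem isUnit_det_of_preserves (hX : X.transpose * etaNull * X = etaNull) : IsUnit X.det :=
  isUnit_iff_ne_zero.mpr fun h => by
    have := det_sq_of_preserves isUnit_det_etaNull hX
    simp [h] at this

theorem preserves_transpose (hX : X.transpose * etaNull * X = etaNull) :
    X * etaNull * X.transpose = etaNull := by
  have h1 : X * (etaNull * X.transpose * etaNull) = 1 := by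
    rw [← inv_of_preserves hX]
    exact Matrix.mul_nonsing_inv _ (isUnit_det_of_preserves hX)
  calc X * etaNull * X.transpose =
      X * (etaNull * X.transpose * etaNull) * etaNull := by
        simp only [Matrix.mul_assoc, etaNull_mul_self, Matrix.mul_one]
    _ = etaNull := by rw [h1, Matrix.one_mul]

/-- The bilinear form `η(·, so p q u y v l ·)` on the columns of `X`. -/
def low (p q u y v l : ℝ) (X : Matrix (Fin 4) (Fin 4) ℝ) (a b : Fin 4) : ℝ :=
  p * (X 0 a * X 1 b - X 1 a * X 0 b) + q * (X 0 a * X 2 b - X 2 a * X 0 b)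
    + u * (X 0 a * X 3 b - X 3 a * X 0 b) + y * (X 1 a * X 2 b - X 2 a * X 1 b)
    + v * (X 1 a * X 3 b - X 3 a * X 1 b) + l * (X 2 a * X 3 b - X 3 a * X 2 b)

/-- For η-orthogonal X, conjugation of an endomorphism is the pull-back of the bilinear form
obtained by lowering an index; hence no inverse appears in the result. -/
theorem conj_so (hX : X.transpose * etaNull * X = etaNull) (p q u y v l : ℝ) :
    X⁻¹ * so p q u y v l * X = so (low p q u y v l X 0 1) (low p q u y v l X 0 2)
      (low p q u y v l X 0 3) (low p q u y v l X 1 2) (low p q u y v l X 1 3)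
      (low p q u y v l X 2 3) := by
  have h1 : ∀ a b, (X.transpose * (etaNull * so p q u y v l) * X) a b = low p q u y v l X a b := by
    intro a b
    simp only [Matrix.mul_apply, Matrix.transpose_apply, Fin.sum_univ_four]
    simp [etaNull, so, low]
    ring
  have h2 : X⁻¹ * so p q u y v l * X =
      etaNull * (X.transpose * (etaNull * so p q u y v l) * X) := by
    rw [inv_of_preserves hX]
    simp only [Matrix.mul_assoc]
  rw [h2]
  ext i j
  rw [Matrix.mul_apply, Fin.sum_univ_four]
  simp only [h1]
  fin_cases i <;> fin_cases j <;> (simp [etaNull, so, low]; try ring)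

theorem conjC_gam (I : ℝ) (c : Fin 4) :
    conjC X (gam κ μ I) c = X 0 c • (X⁻¹ * so 0 0 0 (2 - 2 * μ) 0 (-4 * κ) * X)
      + X 1 c • (X⁻¹ * so (2 * κ) 2 0 0 0 0 * X)
      + X 2 c • (X⁻¹ * so 3 0 (-2 * κ) (6 * κ * I) 0 0 * X)
      + X 3 c • (X⁻¹ * so 0 (-2 * κ) 0 0 0 0 * X) := by
  rw [conjC, Fin.sum_univ_four]
  rfl

/-- The matrix of a null rotation. -/
def nrot (x y : ℝ) : Matrix (Fin 4) (Fin 4) ℝ :=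
  !![1, 0, x, 0; 0, 1, y, 0; 0, 0, 1, 0; x, y, (x ^ 2 + y ^ 2) / 2, 1]

theorem nrot_preserves (x y : ℝ) : (nrot x y).transpose * etaNull * nrot x y = etaNull := by
  ext i j
  rw [etaNull_conj]
  fin_cases i <;> fin_cases j <;> simp [nrot, etaNull] <;> ring

theorem hasDerivAt_nrot (x y : ℝ) (a b : Fin 4) :
    HasDerivAt (fun s : ℝ => nrot (s * x) (s * y) a b) (nul x y a b) 0 := by
  have h1 : ∀ r : ℝ, HasDerivAt (fun s : ℝ => s * r) r 0 := fun r => by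
    simpa using (hasDerivAt_id (0 : ℝ)).mul_const r
  have h2 : HasDerivAt (fun s : ℝ => ((s * x) ^ 2 + (s * y) ^ 2) / 2) 0 0 := by
    have := (((h1 x).pow 2).add ((h1 y).pow 2)).div_const 2
    simpa using this
  fin_cases a <;> fin_cases b <;> first
    | exact hasDerivAt_const _ _
    | exact h1 x
    | exact h1 y
    | exact h2

/-- The explicit curve of null rotations passes through the identity with velocity `nul x y`;
differentiate the invariance at s = 0. -/
theorem act_nul_eq_zero {k : ℕ} {T : Arr 4 k} {x y : ℝ}
    (h : ∀ s : ℝ, comp T (nrot (s * x) (s * y)) = T) : act (nul x y) T = 0 := by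
  funext i
  have h1 := hasDerivAt_comp_const T (M := fun s => nrot (s * x) (s * y)) (M' := nul x y) (t := 0)
    (hasDerivAt_nrot x y) i
  have h2 : nrot (0 * x) (0 * y) = 1 := by
    ext i j
    fin_cases i <;> fin_cases j <;> simp [nrot]
  rw [h2, dcomp_one] at h1
  simp only [h] at h1
  exact h1.unique (hasDerivAt_const _ _)

/-- A null rotation about e₄ fixes E³ and changes E¹, E² by multiples of E³, so the 2-forms E¹∧E³
and E²∧E³ are unchanged. -/
theorem comp_C₀_nrot (x y : ℝ) : comp (C₀ κ μ) (nrot x y) = C₀ κ μ := by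
  have h1 : (nrot x y).transpose * wedge1 * nrot x y = wedge1 := by
    ext i j
    rw [wedge1_conj]
    fin_cases i <;> fin_cases j <;> simp [nrot, wedge1]
  have h2 : (nrot x y).transpose * wedge2 * nrot x y = wedge2 := by
    ext i j
    rw [wedge2_conj]
    fin_cases i <;> fin_cases j <;> simp [nrot, wedge2]
  funext i
  rw [comp_C₀, h1, h2, nrot_preserves]
  rfl

theorem act_nul_C₀ (x y : ℝ) : act (nul x y) (C₀ κ μ) = 0 :=
  act_nul_eq_zero fun _ => comp_C₀_nrot _ _

/-- Four components of the action isolate the rotation, the boost and the two null rotations about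
e₃, each multiplied by 8 - 5μ ≠ 0. -/
theorem eq_nul_of_act_C₀ (hμ : μ ≠ 8 / 5) {A : Matrix (Fin 4) (Fin 4) ℝ}
    (hA : A.transpose * etaNull + etaNull * A = 0) (h : act A (C₀ κ μ) = 0) :
    A 0 1 = 0 ∧ A 0 3 = 0 ∧ A 1 3 = 0 ∧ A 2 2 = 0 := by
  obtain ⟨h00, h11, h10, h30, h31, h20, h21, h33, h23, h32⟩ := skew_entries hA
  have hν : 8 - 5 * μ ≠ 0 := fun h => hμ (by linarith)
  have e : ∀ a b c d, act A (C₀ κ μ) ![a, b, c, d] = 0 := fun a b c d => by rw [h]; rfl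
  simp only [act_four, C₀, Matrix.cons_val] at e
  have e1 := e 0 2 0 2
  have e2 := e 0 2 1 2
  have e3 := e 0 1 0 2
  have e4 := e 0 1 1 2
  simp [Fin.sum_univ_four, curvC, etaNull, wedge1, wedge2, h00, h11, h10, h20, h21] at e1 e2 e3 e4
  rw [h31] at e3
  rw [h30] at e4
  rw [h32] at e1
  refine ⟨?_, ?_, ?_, ?_⟩ <;> refine (mul_eq_zero.mp ?_).resolve_left hν
  · linear_combination -(1 / 3) * e2
  · linear_combination -e4
  · linear_combination -(1 / 2) * e3
  · linear_combination -(1 / 4) * e1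

end Conjugation

/-! ### Stabilizers of the components of R, ∇R and ∇²R -/

section Stabilizers

variable {κ μ κ' μ' : ℝ} {X : Matrix (Fin 4) (Fin 4) ℝ}

/-- The components of `∇R` in the frame. -/
def C₁ (κ μ : ℝ) : Arr 4 (4 + 1) := covC (gam κ μ 0) (C₀ κ μ)

/-- The components of `∇²R` in the frame. -/
def C₂ (κ μ : ℝ) : Arr 4 (4 + 2) := covC (gam κ μ 0) (C₁ κ μ)

/-- The components of `∇³R` in the frame; `I` is the value of `I₁`. -/
def C₃ (κ μ I : ℝ) : Arr 4 (4 + 3) := covC (gam κ μ I) (C₂ κ μ)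

/-- The lowered connection components after the change of frame `X`. -/
def cg (κ μ I : ℝ) (X : Matrix (Fin 4) (Fin 4) ℝ) (c a b : Fin 4) : ℝ :=
  X 0 c * low 0 0 0 (2 - 2 * μ) 0 (-4 * κ) X a b + X 1 c * low (2 * κ) 2 0 0 0 0 X a b
    + X 2 c * low 3 0 (-2 * κ) (6 * κ * I) 0 0 X a b + X 3 c * low 0 (-2 * κ) 0 0 0 0 X a b

theorem conjC_gam_eq_so (hX : X.transpose * etaNull * X = etaNull) (I : ℝ) (c : Fin 4) :
    conjC X (gam κ μ I) c = so (cg κ μ I X c 0 1) (cg κ μ I X c 0 2) (cg κ μ I X c 0 3)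
      (cg κ μ I X c 1 2) (cg κ μ I X c 1 3) (cg κ μ I X c 2 3) := by
  rw [conjC_gam]
  simp only [conj_so hX, so_smul, so_add]
  rfl

theorem gam_skew (I : ℝ) (c : Fin 4) :
    (gam κ μ I c).transpose * etaNull + etaNull * gam κ μ I c = 0 := by
  fin_cases c <;> simp [gam, so_skew]

theorem conjC_sub_gam_skew (hX : X.transpose * etaNull * X = etaNull) (I I' : ℝ) (c : Fin 4) :
    ((conjC X (gam κ μ I) - gam κ' μ' I') c).transpose * etaNull +
      etaNull * (conjC X (gam κ μ I) - gam κ' μ' I') c = 0 := by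
  rw [Pi.sub_apply, Matrix.transpose_sub, Matrix.sub_mul, Matrix.mul_sub, sub_add_sub_comm,
    gam_skew, conjC_gam_eq_so hX, so_skew, sub_zero]

/-- The Ricci trace separates η from E³⊗E³, which gives κ² and forces X to rescale E³; orthogonality
then fixes the shape up to a rotation in the first two directions. Two parameter sets are allowed so
that the result serves for isotropy and for isometries alike. -/
theorem stabilizer_C₀ (hμ : μ ≠ 8 / 5) (hμ' : μ' ≠ 8 / 5)
    (hX : X.transpose * etaNull * X = etaNull) (h0 : comp (C₀ κ μ) X = C₀ κ' μ') :
    κ ^ 2 = κ' ^ 2 ∧ ∃ e f a b s : ℝ, e ^ 2 = 1 ∧ f ^ 2 = 1 ∧ s ≠ 0 ∧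
      (8 - 5 * μ) * s ^ 2 = 8 - 5 * μ' ∧
      X = !![e, 0, a, 0; 0, f, b, 0; 0, 0, s, 0;
        e * a / s, f * b / s, (a ^ 2 + b ^ 2) / (2 * s), 1 / s] := by
  have hν : 8 - 5 * μ ≠ 0 := fun h => hμ (by linarith)
  have hν' : 8 - 5 * μ' ≠ 0 := fun h => hμ' (by linarith)
  have t := trace13_comp etaNull X (C₀ κ μ)
  rw [h0, preserves_transpose hX, trace13_C₀, trace13_C₀] at t
  have t1 : ∀ i j, -12 * κ' ^ 2 * etaNull i j -
      (8 - 5 * μ') * (!![0, 0, 0, 0; 0, 0, 0, 0; 0, 0, 1, 0; 0, 0, 0, 0] :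
        Matrix (Fin 4) (Fin 4) ℝ) i j =
      -12 * κ ^ 2 * etaNull i j - (8 - 5 * μ) * (X 2 i * X 2 j) := fun i j => by
    have := congrFun (congrFun t i) j
    rw [Matrix.mul_sub, Matrix.sub_mul, Matrix.mul_smul, Matrix.smul_mul, hX, Matrix.mul_smul,
      Matrix.smul_mul] at this
    simp only [Matrix.sub_apply, Matrix.smul_apply, smul_eq_mul] at this
    rw [this]
    congr 2
    simp [Matrix.mul_apply, Fin.sum_univ_four]
  have t33 := t1 3 3
  have t23 := t1 2 3
  have t00 := t1 0 0
  have t11 := t1 1 1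
  have t22 := t1 2 2
  simp [etaNull] at t33 t23 t00 t11 t22
  have x23 : X 2 3 = 0 := t33.resolve_left hν
  rw [x23] at t23
  have hκ : κ ^ 2 = κ' ^ 2 := by linarith
  have x20 : X 2 0 = 0 := by
    rw [hκ] at t00
    refine mul_self_eq_zero.mp ((mul_eq_zero.mp ?_).resolve_left hν)
    linarith
  have x21 : X 2 1 = 0 := by
    rw [hκ] at t11
    refine mul_self_eq_zero.mp ((mul_eq_zero.mp ?_).resolve_left hν)
    linarith
  have hs : (8 - 5 * μ) * X 2 2 ^ 2 = 8 - 5 * μ' := by linarith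
  have s0 : X 2 2 ≠ 0 := fun h => hν' (by rw [← hs, h]; ring)
  have r : ∀ i j, X i 0 * X j 0 + X i 1 * X j 1 - X i 2 * X j 3 - X i 3 * X j 2 =
      etaNull i j := fun i j => by
    have := congrFun (congrFun (preserves_transpose hX) i) j
    rw [← this]
    simp [Matrix.mul_apply, etaNull, Fin.sum_univ_four]
    ring
  have c : ∀ i j, X 0 i * X 0 j + X 1 i * X 1 j - X 2 i * X 3 j - X 3 i * X 2 j =
      etaNull i j := fun i j => by rw [← etaNull_conj, hX]
  have r02 := r 0 2
  have r12 := r 1 2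
  have r32 := r 3 2
  have c00 := c 0 0
  have c01 := c 0 1
  have c11 := c 1 1
  have c02 := c 0 2
  have c12 := c 1 2
  have c22 := c 2 2
  simp [etaNull, x20, x21, x23] at r02 r12 r32 c00 c01 c11 c02 c12 c22
  have x03 : X 0 3 = 0 := r02.resolve_right s0
  have x13 : X 1 3 = 0 := r12.resolve_right s0
  have d : ∀ i j k l, C₀ κ' μ' ![i, j, k, l] = _ := fun i j k l => by
    rw [← h0, comp_C₀, hX]
  simp only [C₀, Matrix.cons_val, curvC, ← hκ, add_right_inj, wedge1_conj, wedge2_conj] at d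
  have d1 := d 0 2 0 2
  simp [wedge1, wedge2, x20] at d1
  have d2 : (8 - 5 * μ') * (-2 * X 0 0 ^ 2 + X 1 0 ^ 2 + 2) = 0 := by
    rw [← hs] at d1 ⊢
    linarith
  have d3 := (mul_eq_zero.mp d2).resolve_left hν'
  -- The weights -2 and 1 of the two 2-forms are different, which together with x₀₀² + x₁₀² = 1
  -- rules out a rotation.
  have x10 : X 1 0 = 0 := by
    have : X 1 0 ^ 2 = 0 := by linear_combination (1 / 3) * d3 + (2 / 3) * c00
    exact pow_eq_zero_iff two_ne_zero |>.mp this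
  have x00 : X 0 0 ^ 2 = 1 := by rw [x10] at c00; linear_combination c00
  have x00' : X 0 0 ≠ 0 := fun h => by rw [h] at x00; norm_num at x00
  have x01 : X 0 1 = 0 := by
    rw [x10] at c01
    simpa [x00'] using c01
  have x11 : X 1 1 ^ 2 = 1 := by rw [x01] at c11; linear_combination c11
  refine ⟨hκ, X 0 0, X 1 1, X 0 2, X 1 2, X 2 2, x00, x11, s0, hs, ?_⟩
  rw [x10] at c02
  rw [x01] at c12
  have e30 : X 3 0 = X 0 0 * X 0 2 / X 2 2 := by
    field_simp
    linarith
  have e31 : X 3 1 = X 1 1 * X 1 2 / X 2 2 := by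
    field_simp
    linarith
  have e32 : X 3 2 = (X 0 2 ^ 2 + X 1 2 ^ 2) / (2 * X 2 2) := by
    field_simp
    linarith
  have e33 : X 3 3 = 1 / X 2 2 := by
    field_simp
    linarith
  ext i j
  fin_cases i <;> fin_cases j <;> simp [x20, x21, x23, x03, x13, x10, x01, e30, e31, e32, e33]

/-- By `comp_covC_eq_iff` the transformed and the given connection differ by generators that
annihilate the curvature, and by `eq_nul_of_act_C₀` their rotation and boost parts vanish. This is
what forces μ = μ'. -/
theorem stabilizer_C₁ (hκ : 0 < κ) (hκ' : 0 < κ') (hμ : μ ≠ 8 / 5) (hμ' : μ' ≠ 8 / 5)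
    (hX : X.transpose * etaNull * X = etaNull) (h0 : comp (C₀ κ μ) X = C₀ κ' μ')
    (h1 : comp (C₁ κ μ) X = C₁ κ' μ') :
    κ = κ' ∧ μ = μ' ∧ ∃ f b : ℝ, f ^ 2 = 1 ∧
      X = !![1, 0, 0, 0; 0, f, b, 0; 0, 0, f, 0; 0, b, f * b ^ 2 / 2, f] := by
  obtain ⟨hk, e, f, a, b, s, he, hf, hs, hν, hXe⟩ := stabilizer_C₀ hμ hμ' hX h0
  have hkk : κ = κ' := by nlinarith
  subst hkk
  have h2 := (comp_covC_eq_iff (isUnit_det_of_preserves hX) h0).mp h1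
  have h3 := fun c => eq_nul_of_act_C₀ hμ' (conjC_sub_gam_skew hX _ _ c) (h2 c)
  simp only [Pi.sub_apply, Matrix.sub_apply, conjC_gam_eq_so hX] at h3
  -- The boost part along e₁ gives e = 1, the boost part along e₃ gives a = 0, and the rotation part
  -- along e₃ gives s f = 1.
  have k0 := (h3 0).2.2.2
  have k1 := (h3 2).2.2.2
  have k2 := (h3 2).1
  simp [so, cg, low, gam, hXe, hs] at k0 k1 k2
  have he1 : e = 1 := by
    have : κ * (1 - e) = 0 := by linarith
    have := (mul_eq_zero.mp this).resolve_left hκ.ne'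
    linarith
  subst he1
  have ha : a = 0 := by
    have : κ * a = 0 := by
      field_simp at k1
      linarith
    exact (mul_eq_zero.mp this).resolve_left hκ.ne'
  subst ha
  have hsf : s * f = 1 := by
    field_simp at k2
    linarith
  have hsf' : s = f := by linear_combination f * hsf - s * hf
  subst hsf'
  refine ⟨rfl, by rw [hf] at hν; linarith, s, b, hf, ?_⟩
  have e1 : s⁻¹ = s := inv_eq_of_mul_eq_one_left hsf
  rw [hXe]
  ext i j
  fin_cases i <;> fin_cases j <;> simp [e1, hs]
  field_simp
  rw [hf]
  ring

/-- The whole one-parameter group of A lies in the stabilizer described by `stabilizer_C₁`, where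
this entry is zero. -/
theorem act_C₁_apply_eq_zero (hκ : 0 < κ) (hμ : μ ≠ 8 / 5) {A : Matrix (Fin 4) (Fin 4) ℝ}
    (hA : A.transpose * etaNull + etaNull * A = 0) (h0 : act A (C₀ κ μ) = 0)
    (h1 : act A (C₁ κ μ) = 0) : A 0 2 = 0 := by
  refine deriv_entry_of_exp (r := 0) fun s => ?_
  obtain ⟨-, -, f, b, -, h⟩ := stabilizer_C₁ hκ hκ hμ hμ (exp_smul_preserves hA s)
    (comp_exp_smul h0 s) (comp_exp_smul h1 s)
  rw [h]
  simp

/-- The previous argument one order higher: the difference of the connections must now annihilate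
`C₀` and `C₁`, which also excludes the first null rotation. -/
theorem stabilizer_C₂ (hκ : 0 < κ) (hμ : μ ≠ 8 / 5)
    (hX : X.transpose * etaNull * X = etaNull) (h0 : comp (C₀ κ μ) X = C₀ κ μ)
    (h1 : comp (C₁ κ μ) X = C₁ κ μ) (h2 : comp (C₂ κ μ) X = C₂ κ μ) :
    ∃ f : ℝ, (f = 1 ∨ f = -1) ∧ X = Matrix.diagonal ![1, f, f, f] := by
  obtain ⟨-, -, f, b, hf, hXe⟩ := stabilizer_C₁ hκ hκ hμ hμ hX h0 h1
  have h3 := (comp_covC_eq_iff (isUnit_det_of_preserves hX) h0).mp h1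
  have h4 := (comp_covC_eq_iff (isUnit_det_of_preserves hX) h1).mp h2
  have h5 := fun c => act_C₁_apply_eq_zero hκ hμ (conjC_sub_gam_skew hX _ _ c) (h3 c) (h4 c)
  simp only [Pi.sub_apply, Matrix.sub_apply, conjC_gam_eq_so hX] at h5
  -- The terms quadratic in b cancel; up to a nonzero factor, f b is left.
  have k := h5 2
  simp [so, cg, low, gam, hXe] at k
  have hf1 : f = 1 ∨ f = -1 := mul_self_eq_one_iff.mp (by rw [← sq, hf])
  have hb : b = 0 := by
    rcases hf1 with rfl | rfl <;> linarith
  refine ⟨f, hf1, ?_⟩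
  rw [hXe, hb]
  ext i j
  fin_cases i <;> fin_cases j <;> simp

theorem diagonal_preserves {f : ℝ} (hf : f = 1 ∨ f = -1) :
    (Matrix.diagonal ![1, f, f, f]).transpose * etaNull * Matrix.diagonal ![1, f, f, f] =
      etaNull := by
  ext i j
  rw [etaNull_conj]
  rcases hf with rfl | rfl <;> fin_cases i <;> fin_cases j <;> simp [etaNull, Matrix.diagonal]

/-- The reflection of e₂, e₃, e₄ acts on the connection only by the sign of I₁. Hence it is
invisible in `C₀`, `C₁`, `C₂` and changes `C₃` by reversing its argument. -/
theorem conjC_gam_diagonal {f : ℝ} (hf : f = 1 ∨ f = -1) (I : ℝ) :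
    conjC (Matrix.diagonal ![1, f, f, f]) (gam κ μ I) = gam κ μ (f * I) := by
  funext c
  rw [conjC_gam_eq_so (diagonal_preserves hf)]
  rcases hf with rfl | rfl <;> fin_cases c <;>
    simp [cg, low, gam, Matrix.diagonal]

theorem comp_covC_of_conjC {k : ℕ} (hX : IsUnit X.det) {Γ Γ' : Fin 4 → Matrix (Fin 4) (Fin 4) ℝ}
    {T T' : Arr 4 k} (hT : comp T X = T') (hΓ : conjC X Γ = Γ') :
    comp (covC Γ T) X = covC Γ' T' := by
  rw [comp_covC hX, hT, hΓ]

theorem comp_diagonal {f : ℝ} (hf : f = 1 ∨ f = -1) :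
    comp (C₀ κ μ) (Matrix.diagonal ![1, f, f, f]) = C₀ κ μ ∧
      comp (C₁ κ μ) (Matrix.diagonal ![1, f, f, f]) = C₁ κ μ ∧
      comp (C₂ κ μ) (Matrix.diagonal ![1, f, f, f]) = C₂ κ μ ∧
      ∀ I, comp (C₃ κ μ I) (Matrix.diagonal ![1, f, f, f]) = C₃ κ μ (f * I) := by
  have hu := isUnit_det_of_preserves (diagonal_preserves hf)
  have hc : conjC (Matrix.diagonal ![1, f, f, f]) (gam κ μ 0) = gam κ μ 0 := by
    rw [conjC_gam_diagonal hf, mul_zero]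
  have h0 : comp (C₀ κ μ) (Matrix.diagonal ![1, f, f, f]) = C₀ κ μ := by
    funext i
    rw [comp_C₀, diagonal_preserves hf]
    simp only [wedge1_conj, wedge2_conj]
    change _ = curvC κ μ (i 0) (i 1) (i 2) (i 3)
    unfold curvC
    congr 2
    generalize i 0 = a
    generalize i 1 = b
    generalize i 2 = c
    generalize i 3 = d
    have hff : f * f = 1 := by rcases hf with rfl | rfl <;> norm_num
    have w1 : ∀ a b, Matrix.diagonal ![1, f, f, f] 0 a * Matrix.diagonal ![1, f, f, f] 2 b -
        Matrix.diagonal ![1, f, f, f] 2 a * Matrix.diagonal ![1, f, f, f] 0 b =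
        f * wedge1 a b := fun a b => by
      fin_cases a <;> fin_cases b <;> simp [wedge1, Matrix.diagonal]
    have w2 : ∀ a b, Matrix.diagonal ![1, f, f, f] 1 a * Matrix.diagonal ![1, f, f, f] 2 b -
        Matrix.diagonal ![1, f, f, f] 2 a * Matrix.diagonal ![1, f, f, f] 1 b =
        wedge2 a b := fun a b => by
      fin_cases a <;> fin_cases b <;> simp [wedge2, Matrix.diagonal, hff]
    rw [w1, w1, w2, w2]
    linear_combination (-2 * (wedge1 a b * wedge1 c d)) * hff
  have h1 : comp (C₁ κ μ) (Matrix.diagonal ![1, f, f, f]) = C₁ κ μ := comp_covC_of_conjC hu h0 hc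
  have h2 : comp (C₂ κ μ) (Matrix.diagonal ![1, f, f, f]) = C₂ κ μ := comp_covC_of_conjC hu h1 hc
  exact ⟨h0, h1, h2, fun I => comp_covC_of_conjC hu h2 (conjC_gam_diagonal hf I)⟩

theorem eq_nul_of_skew {A : Matrix (Fin 4) (Fin 4) ℝ}
    (hA : A.transpose * etaNull + etaNull * A = 0) (h1 : A 0 1 = 0) (h2 : A 0 3 = 0)
    (h3 : A 1 3 = 0) (h4 : A 2 2 = 0) : A = nul (A 0 2) (A 1 2) := by
  obtain ⟨h00, h11, h10, h30, h31, h20, h21, h33, h23, h32⟩ := skew_entries hA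
  ext i j
  fin_cases i <;> fin_cases j <;>
    simp [nul, h1, h2, h3, h4, h00, h11, h10, h30, h31, h20, h21, h33, h23, h32]

/-- This null rotation changes the connection only by generators of null rotations about e₄, and
those annihilate `C₀`. -/
theorem comp_C₁_nrot (y : ℝ) : comp (C₁ κ μ) (nrot 0 y) = C₁ κ μ := by
  have hX := nrot_preserves 0 y
  refine (comp_covC_eq_iff (isUnit_det_of_preserves hX) (comp_C₀_nrot 0 y)).mpr fun c => ?_
  have e : (conjC (nrot 0 y) (gam κ μ 0) - gam κ μ 0) c = _ :=
    congrArg (· - gam κ μ 0 c) (conjC_gam_eq_so hX 0 c)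
  rw [eq_nul_of_skew (conjC_sub_gam_skew hX 0 0 c), act_nul_C₀]
  all_goals
    rw [e]
    fin_cases c <;> simp [so, cg, low, gam, nrot] <;> ring

theorem act_nul_C₁ (y : ℝ) : act (nul 0 y) (C₁ κ μ) = 0 :=
  act_nul_eq_zero fun s => by
    rw [mul_zero]
    exact comp_C₁_nrot _

/-- Otherwise its one-parameter group would stabilize `C₀`, `C₁`, `C₂`, contradicting the
discreteness in `stabilizer_C₂`. This makes I₁ appear in ∇³R. -/
theorem act_nul_C₂ (hκ : 0 < κ) (hμ : μ ≠ 8 / 5) : act (nul 0 1) (C₂ κ μ) ≠ 0 := by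
  intro h
  have : nul 0 1 1 2 = 0 := by
    refine deriv_entry_of_exp (r := 0) fun s => ?_
    obtain ⟨f, -, h⟩ := stabilizer_C₂ hκ hμ (exp_smul_preserves (nul_skew 0 1) s)
      (comp_exp_smul (act_nul_C₀ 0 1) s) (comp_exp_smul (act_nul_C₁ 1) s) (comp_exp_smul h s)
    rw [h]
    simp [Matrix.diagonal]
  simp [nul] at this

end Stabilizers

/-! ### Frame components of the covariant derivatives up to order three -/

section FrameComponents

variable {τ κ μ : ℝ} {J : Set ℝ} {F : ℝ → ℝ} {x : Fin 4 → ℝ}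

/-- The components of `∇^(q) R` in the frame. -/
def frameC (τ κ μ : ℝ) (F : ℝ → ℝ) (q : ℕ) (x : Fin 4 → ℝ) : Arr 4 (4 + q) :=
  comp (nablaR (metric τ μ F) q x) (frm κ μ F x)

theorem nablaR_eq_comp_frameC (hA : Admissible τ μ J F) (hκ : 2 * κ ^ 2 = τ ^ 2) (q : ℕ)
    (x : Fin 4 → ℝ) :
    nablaR (metric τ μ F) q x = comp (frameC τ κ μ F q x) (cof κ μ F x) := by
  rw [frameC, comp_comp, frm_mul_cof (kappa_ne hA hκ), comp_one]

theorem contDiffOn_comp_apply {k : ℕ} {T : (Fin 4 → ℝ) → Arr 4 k} {m : MatField 4}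
    {U : Set (Fin 4 → ℝ)} (hT : ∀ i, ContDiffOn ℝ ∞ (fun y => T y i) U) (hm : SmoothOn m U)
    (i : Fin k → Fin 4) : ContDiffOn ℝ ∞ (fun y => comp (T y) (m y) i) U := by
  unfold comp
  refine ContDiffOn.sum fun j _ => ContDiffOn.mul ?_ (hT j)
  exact contDiffOn_prod fun l _ => hm _ _

theorem contDiffOn_frameC (hA : Admissible τ μ J F) (q : ℕ) (i : Fin (4 + q) → Fin 4) :
    ContDiffOn ℝ ∞ (fun y => frameC τ κ μ F q y i) (domain J) :=
  contDiffOn_comp_apply (contDiffOn_nablaR hA.isOpen_domain (smoothOn_metric hA)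
    (fun y _ => isUnit_det_metric hA y) q) (smoothOn_frm hA) i

theorem sum_frm_mul_cof (hκ : κ ≠ 0) (x : Fin 4 → ℝ) (A B : Fin 4) :
    ∑ c, frm κ μ F x c A * cof κ μ F x B c = if B = A then 1 else 0 := by
  have := congrFun (congrFun (cof_mul_frm (μ := μ) (F := F) hκ x) B) A
  rw [Matrix.mul_apply, Matrix.one_apply] at this
  rw [← this]
  exact Finset.sum_congr rfl fun _ _ => mul_comm _ _

theorem gam_eq_sum_omg (hκ : κ ≠ 0) (x : Fin 4 → ℝ) (A : Fin 4) :
    gam κ μ (I₁ x) A = ∑ c, frm κ μ F x c A • omg κ μ F c x := by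
  simp only [omg, Finset.smul_sum, smul_smul]
  rw [Finset.sum_comm]
  simp only [← Finset.sum_smul, sum_frm_mul_cof hκ]
  simp

theorem frameC_succ (hA : Admissible τ μ J F) (hκ : 2 * κ ^ 2 = τ ^ 2) (hx : x ∈ domain J) (q : ℕ)
    (i : Fin (4 + q + 1) → Fin 4) : frameC τ κ μ F (q + 1) x i =
      fderiv ℝ (fun y => frameC τ κ μ F q y fun l => i l.castSucc) x
        (fun c => frm κ μ F x c (i (Fin.last _)))
      + covC (gam κ μ (I₁ x)) (frameC τ κ μ F q x) i :=
  comp_covD hA.isOpen_domain hx ((smoothOn_cof hA).diffAt hA.isOpen_domain hx)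
    (cof_mul_frm (kappa_ne hA hκ) x) (fun c => cof_mul_chr hA hκ hx c)
    (fun A => gam_eq_sum_omg (kappa_ne hA hκ) x A)
    (fun y _ => nablaR_eq_comp_frameC hA hκ q y)
    (fun j => differentiableAt_of_contDiffOn hA.isOpen_domain (contDiffOn_frameC hA q j) hx) i

theorem frameC_succ_of_const (hA : Admissible τ μ J F) (hκ : 2 * κ ^ 2 = τ ^ 2)
    (hx : x ∈ domain J) {q : ℕ} {C : Arr 4 (4 + q)}
    (h : ∀ y ∈ domain J, frameC τ κ μ F q y = C) :
    frameC τ κ μ F (q + 1) x = covC (gam κ μ (I₁ x)) C := by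
  funext i
  rw [frameC_succ hA hκ hx, h x hx]
  have : (fun y => frameC τ κ μ F q y fun l => i l.castSucc) =ᶠ[𝓝 x]
      fun _ => C fun l => i l.castSucc := by
    filter_upwards [hA.isOpen_domain.mem_nhds hx] with y hy
    rw [h y hy]
  rw [this.fderiv_eq]
  simp

theorem covC_add_smul {n k : ℕ} (Γ Δ : Fin n → Matrix (Fin n) (Fin n) ℝ) (I : ℝ) (T : Arr n k) :
    covC (fun c => Γ c + I • Δ c) T = covC Γ T + I • covC Δ T := by
  funext i
  change -act (Γ _ + I • Δ _) T _ = -act (Γ _) T _ + I * -act (Δ _) T _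
  rw [act_add, act_smul]
  simp only [Pi.add_apply, Pi.smul_apply, smul_eq_mul]
  ring

theorem covC_gam {k : ℕ} (I : ℝ) (T : Arr 4 k) :
    covC (gam κ μ I) T = covC (gam κ μ 0) T + I • covC (dgam κ) T := by
  rw [← covC_add_smul]
  congr 1
  funext c
  exact gam_eq κ μ I c

/-- The position-dependent part of the connection is a single null rotation, so it disappears from
the covariant derivative of every constant array invariant under that rotation. -/
theorem dgam_eq (c : Fin 4) : dgam κ c = (if c = 2 then 6 * κ else 0) • nul 0 1 := by
  fin_cases c
  · simp [dgam]
  · simp [dgam]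
  · ext i j
    fin_cases i <;> fin_cases j <;> simp [dgam, so, nul]
  · simp [dgam]

theorem covC_dgam_eq_zero {k : ℕ} {T : Arr 4 k} (h : act (nul 0 1) T = 0) :
    covC (dgam κ) T = 0 := by
  rw [covC_eq_zero_iff]
  intro c
  rw [dgam_eq, act_smul, h, smul_zero]

theorem covC_gam_of_act {k : ℕ} {T : Arr 4 k} (h : act (nul 0 1) T = 0) (I : ℝ) :
    covC (gam κ μ I) T = covC (gam κ μ 0) T := by
  rw [covC_gam, covC_dgam_eq_zero h, smul_zero, add_zero]

theorem frameC_zero (hA : Admissible τ μ J F) (hκ : 2 * κ ^ 2 = τ ^ 2) (hx : x ∈ domain J) :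
    frameC τ κ μ F 0 x = C₀ κ μ := by
  rw [frameC, nablaR_zero_eq hA hκ hx]
  exact (comp_comp _ _ _).trans (by rw [cof_mul_frm (kappa_ne hA hκ), comp_one])

theorem frameC_one (hA : Admissible τ μ J F) (hκ : 2 * κ ^ 2 = τ ^ 2) (hx : x ∈ domain J) :
    frameC τ κ μ F 1 x = C₁ κ μ := by
  rw [frameC_succ_of_const hA hκ hx fun y hy => frameC_zero hA hκ hy]
  exact covC_gam_of_act (act_nul_C₀ 0 1) _

theorem frameC_two (hA : Admissible τ μ J F) (hκ : 2 * κ ^ 2 = τ ^ 2) (hx : x ∈ domain J) :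
    frameC τ κ μ F 2 x = C₂ κ μ := by
  rw [frameC_succ_of_const hA hκ hx fun y hy => frameC_one hA hκ hy]
  exact covC_gam_of_act (act_nul_C₁ 1) _

theorem frameC_three (hA : Admissible τ μ J F) (hκ : 2 * κ ^ 2 = τ ^ 2) (hx : x ∈ domain J) :
    frameC τ κ μ F 3 x = C₃ κ μ (I₁ x) :=
  frameC_succ_of_const hA hκ hx fun _ hy => frameC_two hA hκ hy

theorem C₃_eq (I : ℝ) : C₃ κ μ I = C₃ κ μ 0 + I • covC (dgam κ) (C₂ κ μ) := covC_gam I _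

theorem covC_dgam_C₂ (hκ : 0 < κ) (hμ : μ ≠ 8 / 5) :
    ∃ i, covC (dgam κ) (C₂ κ μ) i ≠ 0 := by
  by_contra! h
  have h1 := (covC_eq_zero_iff _ _).mp (funext h : covC (dgam κ) (C₂ κ μ) = 0) 2
  rw [dgam_eq, if_pos rfl, act_smul] at h1
  exact act_nul_C₂ hκ hμ ((smul_eq_zero.mp h1).resolve_left (by positivity))

/-- The array is affine in its argument with nonzero slope, by `act_nul_C₂`; hence I₁ can be read
off from ∇³R. -/
theorem C₃_injective (hκ : 0 < κ) (hμ : μ ≠ 8 / 5) : Function.Injective (C₃ κ μ) := by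
  intro I I' h
  obtain ⟨i, hi⟩ := covC_dgam_C₂ (μ := μ) hκ hμ
  have h1 := congrFun h i
  rw [C₃_eq I, C₃_eq I'] at h1
  simpa [hi] using h1

end FrameComponents

/-! ### The basic invariants and their frame derivatives -/

section Invariants

variable {τ κ μ : ℝ} {J : Set ℝ} {F : ℝ → ℝ} {x : Fin 4 → ℝ}

theorem Admissible.contDiffOn_F₁ (hA : Admissible τ μ J F) : ContDiffOn ℝ ∞ (F₁ F) J :=
  ((hA.smooth.deriv_of_isOpen hA.isOpen (by simp)).div hA.smooth fun s hs => (hA.pos s hs).ne')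

theorem Admissible.contDiffOn_F₂ (hA : Admissible τ μ J F) : ContDiffOn ℝ ∞ (F₂ F) J :=
  ((hA.contDiffOn_F₁.deriv_of_isOpen hA.isOpen (by simp)).sub
    ((hA.contDiffOn_F₁.pow 2).div_const 8)).div
    (hA.smooth.sqrt fun s hs => (hA.pos s hs).ne') fun s hs => (Real.sqrt_pos.mpr (hA.pos s hs)).ne'

theorem Admissible.hasDerivAt (hA : Admissible τ μ J F) {f : ℝ → ℝ} (hf : ContDiffOn ℝ ∞ f J)
    {s : ℝ} (hs : s ∈ J) : HasDerivAt f (deriv f s) s :=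
  ((hf.differentiableOn (by simp)).differentiableAt (hA.isOpen.mem_nhds hs)).hasDerivAt

/-- The frame derivatives of `J`. -/
def dJf (κ : ℝ) (F : ℝ → ℝ) (x : Fin 4 → ℝ) : Fin 4 → ℝ :=
  ![-8 * κ * Jf F x, 0, Jf F x * I₃ F x, 0]

/-- The frame derivatives of `I₃`. -/
def dI₃ (κ μ : ℝ) (F : ℝ → ℝ) (x : Fin 4 → ℝ) : Fin 4 → ℝ :=
  ![-2 * κ * I₃ F x, 8 * κ, I₄ F x * √(Jf F x) + I₃ F x ^ 2 / 8 - 8 * (μ / 2 - 5 / 4), 0]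

/-- The frame derivatives of `I₄`. -/
def dI₄ (F : ℝ → ℝ) (x : Fin 4 → ℝ) : Fin 4 → ℝ :=
  ![0, 0, deriv (F₂ F) (x 2) * Real.exp (-x 1), 0]

/-- `f` has the frame derivatives `d` at `x`. -/
def HasFrameDeriv (κ μ : ℝ) (F : ℝ → ℝ) (f : (Fin 4 → ℝ) → ℝ) (d x : Fin 4 → ℝ) : Prop :=
  HasGrad f (fun c => ∑ B, cof κ μ F x B c * d B) x

theorem HasFrameDeriv.fderiv_apply (hκ : κ ≠ 0) {f : (Fin 4 → ℝ) → ℝ} {d : Fin 4 → ℝ}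
    (h : HasFrameDeriv κ μ F f d x) (A : Fin 4) :
    fderiv ℝ f x (fun c => frm κ μ F x c A) = d A := by
  rw [HasGrad.fderiv_apply h]
  simp only [Finset.mul_sum, ← mul_assoc]
  rw [Finset.sum_comm]
  simp only [← Finset.sum_mul, sum_frm_mul_cof hκ]
  simp

theorem hasFrameDeriv_Jf (hA : Admissible τ μ J F) (hκ : κ ≠ 0) (hx : x ∈ domain J) :
    HasFrameDeriv κ μ F (Jf F) (dJf κ F x) x := by
  have hF : HasGrad (fun y : Fin 4 → ℝ => F (y 2)) _ x :=
    HasGrad.real_comp (HasGrad.coord 2) (hA.hasDerivAt hA.smooth hx)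
  refine (hF.mul (hasGrad_exp (-4) 1 x)).congr_grad ?_
  obtain ⟨e1, -, -, -, -⟩ := exp_relations (x 1)
  have hE := Real.exp_ne_zero (x 1)
  have hp := (hA.pos _ hx).ne'
  funext c
  rw [Fin.sum_univ_four]
  fin_cases c <;>
    simp only [cof, dJf, Jf, I₃, F₁, Fin.zero_eta, Fin.mk_one, Fin.reduceFinMk, Matrix.of_apply,
      Matrix.cons_val, e1, Pi.add_apply, Pi.smul_apply, smul_eq_mul] <;>
    simp
  · field_simp; ring
  · field_simp; ring

/-- Along e₃, completing the square in I₃ leaves (F₁' - F₁²/8)e^{-2b}, which is F₂ times √J; this is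
the origin of F₂. -/
theorem hasFrameDeriv_I₃ (hA : Admissible τ μ J F) (hκ : κ ≠ 0) (hx : x ∈ domain J) :
    HasFrameDeriv κ μ F (I₃ F) (dI₃ κ μ F x) x := by
  have hF : HasGrad (fun y : Fin 4 → ℝ => F₁ F (y 2)) _ x :=
    HasGrad.real_comp (HasGrad.coord 2) (hA.hasDerivAt hA.contDiffOn_F₁ hx)
  have hE1 := hasGrad_exp (-1) 1 x
  simp only [neg_one_mul] at hE1
  refine ((hE1.mul hF).sub ((HasGrad.coord 0).const_mul 8)).congr_grad ?_
  obtain ⟨e1, -, -, -, e4⟩ := exp_relations (x 1)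
  have hE := Real.exp_ne_zero (x 1)
  have hp := hA.pos _ hx
  have hs := (Real.sqrt_pos.mpr hp).ne'
  have hJ : √(Jf F x) = √(F (x 2)) * (Real.exp (x 1))⁻¹ ^ 2 := by
    rw [Jf, Real.sqrt_mul hp.le, e4]
    congr 1
    rw [show (Real.exp (x 1))⁻¹ ^ 4 = ((Real.exp (x 1))⁻¹ ^ 2) ^ 2 by ring]
    exact Real.sqrt_sq (by positivity)
  have hF2 : F₂ F (x 2) * √(F (x 2)) = deriv (F₁ F) (x 2) - F₁ F (x 2) ^ 2 / 8 := by
    rw [F₂, div_mul_cancel₀ _ hs]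
  have hF3 : I₄ F x * √(Jf F x) =
      (deriv (F₁ F) (x 2) - F₁ F (x 2) ^ 2 / 8) * (Real.exp (x 1))⁻¹ ^ 2 := by
    rw [hJ, I₄, ← hF2]
    ring
  funext c
  rw [Fin.sum_univ_four]
  fin_cases c <;>
    simp only [cof, dI₃, hF3, I₃, Fin.zero_eta, Fin.mk_one, Fin.reduceFinMk, Matrix.of_apply,
      Matrix.cons_val, e1, Pi.add_apply, Pi.smul_apply, smul_eq_mul, Pi.sub_apply] <;>
    simp <;> field_simp <;> ring

theorem hasFrameDeriv_I₄ (hA : Admissible τ μ J F) (hx : x ∈ domain J) :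
    HasFrameDeriv κ μ F (I₄ F) (dI₄ F x) x := by
  have hF : HasGrad (fun y : Fin 4 → ℝ => F₂ F (y 2)) _ x :=
    HasGrad.real_comp (HasGrad.coord 2) (hA.hasDerivAt hA.contDiffOn_F₂ hx)
  refine HasGrad.congr_grad hF ?_
  obtain ⟨e1, -, -, -, -⟩ := exp_relations (x 1)
  have hE := Real.exp_ne_zero (x 1)
  funext c
  rw [Fin.sum_univ_four]
  fin_cases c <;> simp [cof, dI₄, e1]
  field_simp

theorem Jf_pos (hA : Admissible τ μ J F) (hx : x ∈ domain J) : 0 < Jf F x :=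
  mul_pos (hA.pos _ hx) (Real.exp_pos _)

/-- The basic invariants; the second is the exponential of `I₂`. -/
def inv (F : ℝ → ℝ) : Fin 4 → (Fin 4 → ℝ) → ℝ := ![I₁, Jf F, I₃ F, I₄ F]

/-- The frame derivatives of the basic invariants. -/
def dinv (κ μ : ℝ) (F : ℝ → ℝ) (x : Fin 4 → ℝ) : Fin 4 → Fin 4 → ℝ :=
  ![dI₁ κ μ F x, dJf κ F x, dI₃ κ μ F x, dI₄ F x]

theorem hasFrameDeriv_inv (hA : Admissible τ μ J F) (hκ : κ ≠ 0) (hx : x ∈ domain J) (k : Fin 4) :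
    HasFrameDeriv κ μ F (inv F k) (dinv κ μ F x k) x := by
  fin_cases k
  · exact hasGrad_I₁ hκ x
  · exact hasFrameDeriv_Jf hA hκ hx
  · exact hasFrameDeriv_I₃ hA hκ hx
  · exact hasFrameDeriv_I₄ hA hx

/-- The matrix of frame derivatives is triangular up to order: e₄ sees only I₁, then e₂ isolates I₃,
e₁ isolates J, and e₃ isolates I₄, with F₂' ≠ 0. -/
theorem linearIndependent_fderiv_inv (hA : Admissible τ μ J F) (hκ : 2 * κ ^ 2 = τ ^ 2)
    (hx : x ∈ domain J) : LinearIndependent ℝ fun k => fderiv ℝ (inv F k) x := by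
  have hκ0 := kappa_ne hA hκ
  rw [Fintype.linearIndependent_iff]
  intro c hc
  have h : ∀ A, ∑ k, c k * dinv κ μ F x k A = 0 := fun A => by
    have := congrArg (fun l : (Fin 4 → ℝ) →L[ℝ] ℝ => l (fun d => frm κ μ F x d A)) hc
    simp only [sum_apply, smul_apply, smul_eq_mul,
      (hasFrameDeriv_inv hA hκ0 hx _).fderiv_apply hκ0] at this
    simpa using this
  simp only [Fin.sum_univ_four] at h
  have h0 := h 0
  have h1 := h 1
  have h2 := h 2
  have h3 := h 3
  simp [dinv, dI₁, dJf, dI₃, dI₄] at h0 h1 h2 h3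
  have hJ := (Jf_pos hA hx).ne'
  rw [h3] at h0 h1 h2
  have c2 : c 2 = 0 := by simpa [hκ0] using h1
  rw [c2] at h0 h2
  have c1 : c 1 = 0 := by simpa [hκ0, hJ] using h0
  rw [c1] at h2
  have c3 : c 3 = 0 := by simpa [hA.deriv_ne _ hx, Real.exp_ne_zero] using h2
  intro k
  fin_cases k
  exacts [h3, c1, c2, c3]

end Invariants

/-! ### Polynomials in the basic invariants -/

section Polynomials

variable {τ κ μ : ℝ} {J : Set ℝ} {F : ℝ → ℝ} {x : Fin 4 → ℝ} {U : Set (Fin 4 → ℝ)} {m : ℕ}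
  {f f' : (Fin 4 → ℝ) → ℝ} {d d' : Fin 4 → ℝ}

theorem HasFrameDeriv.congr_deriv (h : HasFrameDeriv κ μ F f d x) (hd : ∀ A, d A = d' A) :
    HasFrameDeriv κ μ F f d' x := funext hd ▸ h

theorem HasFrameDeriv.congr_on (h : HasFrameDeriv κ μ F f d x) (hU : IsOpen U) (hx : x ∈ U)
    (hf : Set.EqOn f' f U) : HasFrameDeriv κ μ F f' d x :=
  HasFDerivAt.congr_of_eventuallyEq h (hf.eventuallyEq_of_mem (hU.mem_nhds hx))

theorem HasFrameDeriv.const (r : ℝ) : HasFrameDeriv κ μ F (fun _ => r) (fun _ => 0) x :=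
  (HasGrad.const r).congr_grad (by funext c; simp)

theorem HasFrameDeriv.add (h : HasFrameDeriv κ μ F f d x) (h' : HasFrameDeriv κ μ F f' d' x) :
    HasFrameDeriv κ μ F (fun y => f y + f' y) (fun A => d A + d' A) x :=
  (HasGrad.add h h').congr_grad (by funext c; simp [mul_add, Finset.sum_add_distrib])

theorem HasFrameDeriv.mul (h : HasFrameDeriv κ μ F f d x) (h' : HasFrameDeriv κ μ F f' d' x) :
    HasFrameDeriv κ μ F (fun y => f y * f' y) (fun A => f x * d' A + f' x * d A) x := by
  refine (HasGrad.mul h h').congr_grad ?_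
  funext c
  simp only [Pi.add_apply, Pi.smul_apply, smul_eq_mul, Finset.mul_sum, ← Finset.sum_add_distrib]
  exact Finset.sum_congr rfl fun _ _ => by ring

theorem HasFrameDeriv.const_mul (h : HasFrameDeriv κ μ F f d x) (r : ℝ) :
    HasFrameDeriv κ μ F (fun y => r * f y) (fun A => r * d A) x :=
  ((HasFrameDeriv.const r).mul h).congr_deriv fun A => by simp

/-- On `U` the function `f` is a polynomial in the first `m` basic invariants. -/
def Pol (F : ℝ → ℝ) (U : Set (Fin 4 → ℝ)) (m : ℕ) (f : (Fin 4 → ℝ) → ℝ) : Prop :=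
  ∃ h ∈ Algebra.adjoin ℝ (inv F '' {k | (k : ℕ) < m}), Set.EqOn f h U

theorem Pol.const (r : ℝ) : Pol F U m fun _ => r :=
  ⟨algebraMap ℝ _ r, Subalgebra.algebraMap_mem _ _, fun _ _ => rfl⟩

theorem Pol.inv {k : Fin 4} (hk : (k : ℕ) < m) : Pol F U m (inv F k) :=
  ⟨_, Algebra.subset_adjoin ⟨k, hk, rfl⟩, fun _ _ => rfl⟩

theorem Pol.add (h : Pol F U m f) (h' : Pol F U m f') : Pol F U m fun y => f y + f' y := by
  obtain ⟨g, hg, e⟩ := h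
  obtain ⟨g', hg', e'⟩ := h'
  exact ⟨g + g', add_mem hg hg', fun y hy => congrArg₂ (· + ·) (e hy) (e' hy)⟩

theorem Pol.mul (h : Pol F U m f) (h' : Pol F U m f') : Pol F U m fun y => f y * f' y := by
  obtain ⟨g, hg, e⟩ := h
  obtain ⟨g', hg', e'⟩ := h'
  exact ⟨g * g', mul_mem hg hg', fun y hy => congrArg₂ (· * ·) (e hy) (e' hy)⟩

theorem Pol.neg (h : Pol F U m f) : Pol F U m fun y => -f y := by
  have := (Pol.const (-1)).mul h
  simpa using this

theorem Pol.sub (h : Pol F U m f) (h' : Pol F U m f') : Pol F U m fun y => f y - f' y := by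
  simpa only [sub_eq_add_neg] using h.add h'.neg

theorem Pol.sum {ι : Type*} (s : Finset ι) {f : ι → (Fin 4 → ℝ) → ℝ} (h : ∀ a ∈ s, Pol F U m (f a)) :
    Pol F U m fun y => ∑ a ∈ s, f a y := by
  classical
  induction s using Finset.induction_on with
  | empty => simpa using Pol.const 0
  | insert a s ha ih =>
    simp only [Finset.sum_insert ha]
    exact (h a (Finset.mem_insert_self a s)).add (ih fun b hb => h b (Finset.mem_insert_of_mem hb))

theorem Pol.congr (h : Pol F U m f) (hf : Set.EqOn f' f U) : Pol F U m f' := by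
  obtain ⟨g, hg, e⟩ := h
  exact ⟨g, hg, hf.trans e⟩

theorem Pol.mono {m' : ℕ} (h : Pol F U m f) (hm : m ≤ m') : Pol F U m' f := by
  obtain ⟨g, hg, e⟩ := h
  exact ⟨g, Algebra.adjoin_mono (Set.image_mono fun k hk => lt_of_lt_of_le hk hm) hg, e⟩

/-- The derivatives of I₁ involve I₁ and J, those of J involve J and I₃. The restriction on `k` is
essential: the derivative of I₃ contains √J, which is not polynomial. -/
theorem pol_dinv {k : Fin 4} (hk : (k : ℕ) < 2) (A : Fin 4) :
    Pol F U (k + 2) fun x => dinv κ μ F x k A := by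
  have hI : 0 < (k : ℕ) + 2 → Pol F U (k + 2) I₁ := fun h => Pol.inv (k := 0) h
  have hJ : 1 < (k : ℕ) + 2 → Pol F U (k + 2) (Jf F) := fun h => Pol.inv (k := 1) h
  have h3 : 2 < (k : ℕ) + 2 → Pol F U (k + 2) (I₃ F) := fun h => Pol.inv (k := 2) h
  fin_cases k
  · fin_cases A
    · exact (Pol.const (-6 * κ)).mul (hI (by norm_num))
    · exact Pol.const _
    · exact (Pol.const _).sub (hJ (by norm_num))
    · exact Pol.const _
  · fin_cases A
    · exact (Pol.const (-8 * κ)).mul (hJ (by norm_num))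
    · exact Pol.const _
    · exact (hJ (by norm_num)).mul (h3 (by norm_num))
    · exact Pol.const _
  · norm_num at hk
  · norm_num at hk

theorem Pol.exists_frameDeriv (hA : Admissible τ μ J F) (hκ : κ ≠ 0) (hm : m ≤ 2)
    (h : Pol F (domain J) m f) : ∃ d : Fin 4 → (Fin 4 → ℝ) → ℝ,
      (∀ A, Pol F (domain J) (m + 1) (d A)) ∧
      ∀ x ∈ domain J, HasFrameDeriv κ μ F f (fun A => d A x) x := by
  obtain ⟨g, hg, e⟩ := h
  suffices h : ∃ d : Fin 4 → (Fin 4 → ℝ) → ℝ, (∀ A, Pol F (domain J) (m + 1) (d A)) ∧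
      ∀ x ∈ domain J, HasFrameDeriv κ μ F g (fun A => d A x) x by
    obtain ⟨d, h1, h2⟩ := h
    exact ⟨d, h1, fun x hx => (h2 x hx).congr_on hA.isOpen_domain hx e⟩
  clear e
  induction hg using Algebra.adjoin_induction with
  | mem g hg =>
    obtain ⟨k, hk, rfl⟩ := hg
    exact ⟨fun A x => dinv κ μ F x k A,
      fun A => (pol_dinv (lt_of_lt_of_le hk hm) A).mono (by have : (k : ℕ) < m := hk; omega),
      fun x hx => hasFrameDeriv_inv hA hκ hx k⟩
  | algebraMap r => exact ⟨fun _ _ => 0, fun _ => Pol.const 0, fun x _ => HasFrameDeriv.const r⟩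
  | add g g' hg hg' ih ih' =>
    obtain ⟨d, h1, h2⟩ := ih
    obtain ⟨d', h1', h2'⟩ := ih'
    exact ⟨fun A y => d A y + d' A y, fun A => (h1 A).add (h1' A),
      fun x hx => (h2 x hx).add (h2' x hx)⟩
  | mul g g' hg hg' ih ih' =>
    obtain ⟨d, h1, h2⟩ := ih
    obtain ⟨d', h1', h2'⟩ := ih'
    have p : Pol F (domain J) (m + 1) g := Pol.mono ⟨g, hg, fun _ _ => rfl⟩ (Nat.le_succ m)
    have p' : Pol F (domain J) (m + 1) g' := Pol.mono ⟨g', hg', fun _ _ => rfl⟩ (Nat.le_succ m)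
    exact ⟨fun A y => g y * d' A y + g' y * d A y, fun A => (p.mul (h1' A)).add (p'.mul (h1 A)),
      fun x hx => (h2 x hx).mul (h2' x hx)⟩

/-- The span of the differentials of the first `m` basic invariants. -/
def dspan (F : ℝ → ℝ) (m : ℕ) (x : Fin 4 → ℝ) : Submodule ℝ ((Fin 4 → ℝ) →L[ℝ] ℝ) :=
  Submodule.span ℝ ((fun k => fderiv ℝ (inv F k) x) '' {k | (k : ℕ) < m})

theorem dspan_mono {m' : ℕ} (h : m ≤ m') (x : Fin 4 → ℝ) : dspan F m x ≤ dspan F m' x :=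
  Submodule.span_mono (Set.image_mono fun _ hk => lt_of_lt_of_le hk h)

/-- Sum and product rule; it turns algebraic dependence on few invariants into an upper bound for
the rank. -/
theorem Pol.fderiv_mem (hA : Admissible τ μ J F) (h : Pol F (domain J) m f) (hx : x ∈ domain J) :
    DifferentiableAt ℝ f x ∧ fderiv ℝ f x ∈ dspan F m x := by
  obtain ⟨κ, hκ⟩ : ∃ κ, 2 * κ ^ 2 = τ ^ 2 := ⟨τ / √2, by
    rw [div_pow, Real.sq_sqrt zero_le_two]; ring⟩
  obtain ⟨g, hg, e⟩ := h
  have e' := e.eventuallyEq_of_mem (hA.isOpen_domain.mem_nhds hx)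
  rw [e'.fderiv_eq, e'.differentiableAt_iff]
  clear e e'
  induction hg using Algebra.adjoin_induction with
  | mem g hg =>
    obtain ⟨k, hk, rfl⟩ := hg
    exact ⟨HasGrad.differentiableAt (hasFrameDeriv_inv hA (kappa_ne hA hκ) hx k),
      Submodule.subset_span ⟨k, hk, rfl⟩⟩
  | algebraMap r =>
    have : (algebraMap ℝ ((Fin 4 → ℝ) → ℝ)) r = fun _ => r := rfl
    rw [this]
    exact ⟨differentiableAt_const r, by simp⟩
  | add g g' hg hg' ih ih' =>
    exact ⟨ih.1.add ih'.1, by rw [fderiv_add ih.1 ih'.1]; exact add_mem ih.2 ih'.2⟩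
  | mul g g' hg hg' ih ih' =>
    refine ⟨ih.1.mul ih'.1, ?_⟩
    rw [fderiv_mul ih.1 ih'.1]
    exact add_mem (Submodule.smul_mem _ _ ih'.2) (Submodule.smul_mem _ _ ih.2)

theorem pol_covC {k : ℕ} {T : (Fin 4 → ℝ) → Arr 4 k} (h : ∀ i, Pol F U (m + 1) fun y => T y i)
    (i : Fin (k + 1) → Fin 4) : Pol F U (m + 1) fun y => covC (gam κ μ (I₁ y)) (T y) i := by
  unfold covC act
  refine Pol.neg (Pol.sum _ fun l _ => Pol.sum _ fun e _ => Pol.mul ?_ (h _))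
  have : ∀ y, gam κ μ (I₁ y) (i (Fin.last k)) e (i l.castSucc) =
      gam κ μ 0 (i (Fin.last k)) e (i l.castSucc) +
        I₁ y * dgam κ (i (Fin.last k)) e (i l.castSucc) := fun y => by
    rw [gam_eq κ μ (I₁ y)]
    rfl
  simp only [this]
  exact (Pol.const _).add ((Pol.inv (k := 0) (Nat.succ_pos m)).mul (Pol.const _))

end Polynomials

/-! ### The number of independent invariants at each order -/

section Ranks

variable {τ κ μ : ℝ} {J : Set ℝ} {F : ℝ → ℝ} {x : Fin 4 → ℝ} {m q : ℕ}

/-- One differentiation replaces the leading function by its frame derivative. The derivative of the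
polynomial remainder and the connection terms, which are I₁ and constants times components of the
previous order, involve at most one more invariant. -/
theorem frameC_snoc (hA : Admissible τ μ J F) (hκ : 2 * κ ^ 2 = τ ^ 2) (hm : m ≤ 2)
    (hq : ∀ i, Pol F (domain J) (m + 1) fun y => frameC τ κ μ F q y i)
    {i : Fin (4 + q) → Fin 4} {f p : (Fin 4 → ℝ) → ℝ} {d : (Fin 4 → ℝ) → Fin 4 → ℝ}
    (hf : ∀ x ∈ domain J, HasFrameDeriv κ μ F f (d x) x) (hp : Pol F (domain J) m p)
    (h : Set.EqOn (fun y => frameC τ κ μ F q y i) (fun y => f y + p y) (domain J)) (A : Fin 4) :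
    ∃ p', Pol F (domain J) (m + 1) p' ∧
      Set.EqOn (fun y => frameC τ κ μ F (q + 1) y (Fin.snoc (α := fun _ => Fin 4) i A))
        (fun y => d y A + p' y) (domain J) := by
  have hκ0 := kappa_ne hA hκ
  obtain ⟨d', h1, h2⟩ := hp.exists_frameDeriv hA hκ0 hm
  refine ⟨_, (h1 A).add (pol_covC (κ := κ) (μ := μ) hq (Fin.snoc (α := fun _ => Fin 4) i A)),
    fun x hx => ?_⟩
  beta_reduce
  rw [frameC_succ hA hκ hx]
  have e : (Fin.snoc (α := fun _ => Fin 4) i A : Fin (4 + q + 1) → Fin 4) (Fin.last (4 + q)) = A :=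
    Fin.snoc_last (α := fun _ => Fin 4) A i
  simp only [Fin.snoc_castSucc, e]
  rw [(((hf x hx).add (h2 x hx)).congr_on hA.isOpen_domain hx h).fderiv_apply hκ0, add_assoc]

theorem pol_frameC_succ (hA : Admissible τ μ J F) (hκ : 2 * κ ^ 2 = τ ^ 2) (hm : m + 1 ≤ 2)
    (hq : ∀ i, Pol F (domain J) (m + 1) fun y => frameC τ κ μ F q y i)
    (i : Fin (4 + q + 1) → Fin 4) :
    Pol F (domain J) (m + 2) fun y => frameC τ κ μ F (q + 1) y i := by
  obtain ⟨p, h1, h2⟩ := frameC_snoc hA hκ hm (fun i => (hq i).mono (Nat.le_succ _))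
    (i := fun l => i l.castSucc) (fun x _ => HasFrameDeriv.const 0) (hq _)
    (fun y _ => (zero_add _).symm) (i (Fin.last _))
  refine h1.congr fun y hy => ?_
  have e : Fin.snoc (α := fun _ => Fin 4) (fun l => i l.castSucc) (i (Fin.last _)) = i :=
    Fin.snoc_init_self i
  have h3 := h2 hy
  beta_reduce at h3
  rw [e, zero_add] at h3
  exact h3

theorem pol_frameC (hA : Admissible τ μ J F) (hκ : 2 * κ ^ 2 = τ ^ 2) (hm : m ≤ 2)
    (i : Fin (4 + (m + 3)) → Fin 4) :
    Pol F (domain J) (m + 1) fun y => frameC τ κ μ F (m + 3) y i := by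
  induction m with
  | zero =>
    refine Pol.congr (f := fun y => C₃ κ μ 0 i + I₁ y * covC (dgam κ) (C₂ κ μ) i)
      ((Pol.const _).add ((Pol.inv (k := 0) Nat.one_pos).mul (Pol.const _))) fun y hy => ?_
    beta_reduce
    rw [frameC_three hA hκ hy, C₃_eq]
    rfl
  | succ m ih => exact pol_frameC_succ hA hκ hm (fun i => ih (by omega) i) i

/-- Start from a component of ∇³R with nonzero slope in I₁ and differentiate repeatedly along e₃:
the leading term runs through I₁, -J, -J·I₃, -J√J·I₄ up to the factor `r`, and the remainder
involves only earlier invariants. -/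
theorem exists_leading (hA : Admissible τ μ J F) (hκ : 2 * κ ^ 2 = τ ^ 2) (hκ0 : 0 < κ) :
    ∃ r : ℝ, r ≠ 0 ∧
      (∃ i, ∃ p, Pol F (domain J) 0 p ∧
        ∀ y ∈ domain J, frameC τ κ μ F 3 y i = r * I₁ y + p y) ∧
      (∃ i, ∃ p, Pol F (domain J) 1 p ∧
        ∀ y ∈ domain J, frameC τ κ μ F 4 y i = -r * Jf F y + p y) ∧
      (∃ i, ∃ p, Pol F (domain J) 2 p ∧
        ∀ y ∈ domain J, frameC τ κ μ F 5 y i = -r * (Jf F y * I₃ F y) + p y) ∧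
      (∃ i, ∃ p, Pol F (domain J) 3 p ∧
        ∀ y ∈ domain J, frameC τ κ μ F 6 y i = -r * (Jf F y * √(Jf F y) * I₄ F y) + p y) := by
  obtain ⟨i, hi⟩ := covC_dgam_C₂ (μ := μ) hκ0 hA.mu_ne
  set r := covC (dgam κ) (C₂ κ μ) i
  have hk := kappa_ne hA hκ
  have l3 : ∀ y ∈ domain J, frameC τ κ μ F 3 y i = r * I₁ y + C₃ κ μ 0 i := fun y hy => by
    rw [frameC_three hA hκ hy, C₃_eq, add_comm, mul_comm]
    rfl
  obtain ⟨p4, h4, l4⟩ := frameC_snoc hA hκ (m := 0) (q := 3) (by omega)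
    (fun i => pol_frameC hA hκ (m := 0) (by omega) i)
    (fun x _ => HasFrameDeriv.const_mul (hasGrad_I₁ (μ := μ) (F := F) hk x) r)
    (Pol.const (C₃ κ μ 0 i)) l3 2
  have l4' : ∀ y ∈ domain J, frameC τ κ μ F 4 y (Fin.snoc (α := fun _ => Fin 4) i 2) =
      -r * Jf F y + (r * (μ / (2 * κ ^ 2) * (μ / 4 - 5 / 8)) + p4 y) := fun y hy => by
    refine (l4 hy).trans ?_
    simp only [dI₁, Matrix.cons_val]
    ring
  have h4' : Pol F (domain J) 1 fun y => r * (μ / (2 * κ ^ 2) * (μ / 4 - 5 / 8)) + p4 y :=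
    (Pol.const _).add h4
  obtain ⟨p5, h5, l5⟩ := frameC_snoc hA hκ (m := 1) (q := 4) (by omega)
    (fun i => pol_frameC hA hκ (m := 1) (by omega) i)
    (fun x hx => HasFrameDeriv.const_mul (hasFrameDeriv_Jf hA hk hx) (-r)) h4' l4' 2
  have l5' : ∀ y ∈ domain J, frameC τ κ μ F 5 y (Fin.snoc (α := fun _ => Fin 4)
      (Fin.snoc (α := fun _ => Fin 4) i 2) 2) = -r * (Jf F y * I₃ F y) + p5 y := fun y hy => by
    refine (l5 hy).trans ?_
    simp only [dJf, Matrix.cons_val]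
  obtain ⟨p6, h6, l6⟩ := frameC_snoc hA hκ (m := 2) (q := 5) (by omega)
    (fun i => pol_frameC hA hκ (m := 2) (by omega) i)
    (fun x hx => HasFrameDeriv.const_mul
      ((hasFrameDeriv_Jf hA hk hx).mul (hasFrameDeriv_I₃ hA hk hx)) (-r)) h5 l5' 2
  refine ⟨r, hi, ⟨i, _, Pol.const (C₃ κ μ 0 i), l3⟩, ⟨_, _, h4', l4'⟩, ⟨_, _, h5, l5'⟩,
    ⟨_, fun y => -r * (Jf F y * (I₃ F y * I₃ F y * (1 / 8) - 8 * (μ / 2 - 5 / 4))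
      + I₃ F y * (Jf F y * I₃ F y)) + p6 y, ?_, fun y hy => (l6 hy).trans ?_⟩⟩
  · have hJ : Pol F (domain J) 3 (Jf F) := Pol.inv (k := 1) (by norm_num)
    have h3 : Pol F (domain J) 3 (I₃ F) := Pol.inv (k := 2) (by norm_num)
    exact ((Pol.const _).mul ((hJ.mul (((h3.mul h3).mul (Pol.const _)).sub (Pol.const _))).add
      (h3.mul (hJ.mul h3)))).add h6
  · simp only [dJf, dI₃, Matrix.cons_val]
    ring

/-- The span of the differentials of the frame components of `R, …, ∇^(q) R`. -/
def cspan (τ κ μ : ℝ) (F : ℝ → ℝ) (q : ℕ) (x : Fin 4 → ℝ) :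
    Submodule ℝ ((Fin 4 → ℝ) →L[ℝ] ℝ) :=
  Submodule.span ℝ {α | ∃ j ≤ q, ∃ i : Fin (4 + j) → Fin 4,
    α = fderiv ℝ (fun y => frameC τ κ μ F j y i) x}

theorem cspan_mono {q' : ℕ} (h : q ≤ q') (x : Fin 4 → ℝ) :
    cspan τ κ μ F q x ≤ cspan τ κ μ F q' x :=
  Submodule.span_mono fun _ ⟨j, hj, i, hi⟩ => ⟨j, hj.trans h, i, hi⟩

theorem dspan_four (hA : Admissible τ μ J F) (hx : x ∈ domain J) (hm : 4 ≤ m) :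
    dspan F m x = ⊤ := by
  obtain ⟨κ, hκ⟩ : ∃ κ, 2 * κ ^ 2 = τ ^ 2 := ⟨τ / √2, by
    rw [div_pow, Real.sq_sqrt zero_le_two]; ring⟩
  have h := (linearIndependent_fderiv_inv hA hκ hx).span_eq_top_of_card_eq_finrank' (by
    rw [LinearEquiv.finrank_eq (LinearMap.toContinuousLinearMap (𝕜 := ℝ) (E := Fin 4 → ℝ)
      (F' := ℝ)).symm, Module.finrank_linearMap]
    simp)
  rw [← h, dspan]
  congr 1
  ext α
  constructor
  · rintro ⟨k, -, rfl⟩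
    exact ⟨k, rfl⟩
  · rintro ⟨k, rfl⟩
    exact ⟨k, by have := k.2; change (k : ℕ) < m; omega, rfl⟩

/-- Orders 0 to 2 are constant, whence the truncated q - 2; orders 3 to 5 are polynomial in the
first invariants; from order 6 on all four differentials are allowed and they span everything. -/
theorem cspan_le_dspan (hA : Admissible τ μ J F) (hκ : 2 * κ ^ 2 = τ ^ 2) (hx : x ∈ domain J)
    (q : ℕ) : cspan τ κ μ F q x ≤ dspan F (q - 2) x := by
  refine Submodule.span_le.mpr ?_
  rintro _ ⟨j, hj, i, rfl⟩
  refine dspan_mono (show j - 2 ≤ q - 2 by omega) x ?_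
  have hc : ∀ C : Arr 4 (4 + j), (∀ y ∈ domain J, frameC τ κ μ F j y = C) →
      fderiv ℝ (fun y => frameC τ κ μ F j y i) x ∈ dspan F (j - 2) x := fun C h => by
    have : (fun y => frameC τ κ μ F j y i) =ᶠ[𝓝 x] fun _ => C i := by
      filter_upwards [hA.isOpen_domain.mem_nhds hx] with y hy
      rw [h y hy]
    rw [this.fderiv_eq]
    simp
  rcases lt_or_ge j 3 with h | h
  · interval_cases j
    · exact hc _ fun y hy => frameC_zero hA hκ hy
    · exact hc _ fun y hy => frameC_one hA hκ hy
    · exact hc _ fun y hy => frameC_two hA hκ hy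
  · obtain ⟨m, rfl⟩ := Nat.exists_eq_add_of_le' h
    rcases le_or_gt m 2 with h2 | h2
    · exact ((pol_frameC hA hκ h2 i).fderiv_mem hA hx).2
    · rw [dspan_four hA hx (by omega)]
      trivial

/-- Triangular elimination with `exists_leading`: the remainder at each order has its differential
in the span already reached, so the differential of the leading term lies in the new span. -/
theorem dspan_le_cspan (hA : Admissible τ μ J F) (hκ : 2 * κ ^ 2 = τ ^ 2) (hκ0 : 0 < κ)
    (hx : x ∈ domain J) (hm : m ≤ 4) : dspan F m x ≤ cspan τ κ μ F (m + 2) x := by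
  obtain ⟨r, hr, ⟨i3, p3, h3, l3⟩, ⟨i4, p4, h4, l4⟩, ⟨i5, p5, h5, l5⟩, ⟨i6, p6, h6, l6⟩⟩ :=
    exists_leading hA hκ hκ0
  have hk := kappa_ne hA hκ
  have hd : ∀ k, DifferentiableAt ℝ (inv F k) x := fun k =>
    HasGrad.differentiableAt (hasFrameDeriv_inv hA hk hx k)
  have hJ := Jf_pos hA hx
  have step : ∀ {m q : ℕ} {i : Fin (4 + q) → Fin 4} {f p : (Fin 4 → ℝ) → ℝ} {r : ℝ}, r ≠ 0 →
      Pol F (domain J) m p → DifferentiableAt ℝ f x → dspan F m x ≤ cspan τ κ μ F q x →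
      (∀ y ∈ domain J, frameC τ κ μ F q y i = r * f y + p y) →
      fderiv ℝ f x ∈ cspan τ κ μ F q x := by
    intro m q i f p r hr hp hf hle h
    obtain ⟨hpd, hps⟩ := hp.fderiv_mem hA hx
    have e : (fun y => frameC τ κ μ F q y i) =ᶠ[𝓝 x] fun y => r * f y + p y := by
      filter_upwards [hA.isOpen_domain.mem_nhds hx] with y hy
      rw [h y hy]
    have e2 : fderiv ℝ (fun y => frameC τ κ μ F q y i) x = r • fderiv ℝ f x + fderiv ℝ p x := by
      rw [e.fderiv_eq, fderiv_fun_add (hf.const_mul r) hpd, fderiv_const_mul hf]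
    have e3 : fderiv ℝ f x = r⁻¹ • (fderiv ℝ (fun y => frameC τ κ μ F q y i) x
        - fderiv ℝ p x) := by
      rw [e2, add_sub_cancel_right, smul_smul, inv_mul_cancel₀ hr, one_smul]
    rw [e3]
    exact Submodule.smul_mem _ _ (sub_mem (Submodule.subset_span ⟨q, le_rfl, i, rfl⟩) (hle hps))
  have key : ∀ m : ℕ, ∀ k : Fin 4, (k : ℕ) = m → dspan F m x ≤ cspan τ κ μ F (m + 2) x →
      fderiv ℝ (inv F k) x ∈ cspan τ κ μ F (m + 3) x → dspan F (m + 1) x ≤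
        cspan τ κ μ F (m + 3) x := by
    intro m k hk hle hmem
    refine Submodule.span_le.mpr ?_
    rintro _ ⟨l, hl, rfl⟩
    rcases (Nat.lt_succ_iff_lt_or_eq.mp hl) with h | h
    · exact cspan_mono (Nat.le_succ _) x (hle (Submodule.subset_span ⟨l, h, rfl⟩))
    · have : l = k := Fin.ext (h.trans hk.symm)
      rw [this]
      exact hmem
  have s0 : dspan F 0 x ≤ cspan τ κ μ F 2 x := by simp [dspan]
  have m1 : fderiv ℝ (inv F 0) x ∈ cspan τ κ μ F 3 x :=
    step hr h3 (hd 0) (s0.trans (cspan_mono (by omega) x)) l3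
  have s1 := key 0 0 rfl s0 m1
  have m2 : fderiv ℝ (inv F 1) x ∈ cspan τ κ μ F 4 x :=
    step (neg_ne_zero.mpr hr) h4 (hd 1) (s1.trans (cspan_mono (by omega) x)) l4
  have s2 := key 1 1 rfl s1 m2
  -- The leading term is the product J·I₃; the part I₃ dJ is already in the span and J > 0 can be
  -- divided out. The last invariant is treated in the same way with J√J in place of J.
  have m3' := step (neg_ne_zero.mpr hr) h5 ((hd 1).fun_mul (hd 2))
    (s2.trans (cspan_mono (by omega) x)) l5
  rw [fderiv_fun_mul (hd 1) (hd 2)] at m3'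
  have m3 : fderiv ℝ (inv F 2) x ∈ cspan τ κ μ F 5 x := by
    have h1 := sub_mem m3' (Submodule.smul_mem _ (inv F 2 x)
      (cspan_mono (show 4 ≤ 5 by omega) x m2))
    rw [add_sub_cancel_right] at h1
    exact (Submodule.smul_mem_iff _ hJ.ne').mp h1
  have s3 := key 2 2 rfl s2 m3
  have hsq : HasFDerivAt (fun y => Jf F y * √(Jf F y)) _ x :=
    (hd 1).hasFDerivAt.mul ((hd 1).hasFDerivAt.sqrt hJ.ne')
  have m4' := step (neg_ne_zero.mpr hr) h6 (hsq.differentiableAt.fun_mul (hd 3))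
    (s3.trans (cspan_mono (by omega) x)) l6
  rw [fderiv_fun_mul hsq.differentiableAt (hd 3), hsq.fderiv] at m4'
  have m2' : fderiv ℝ (inv F 1) x ∈ cspan τ κ μ F 6 x := cspan_mono (by omega) x m2
  have m4 : fderiv ℝ (inv F 3) x ∈ cspan τ κ μ F 6 x := by
    have h1 := sub_mem m4' (Submodule.smul_mem _ (inv F 3 x) (add_mem
      (Submodule.smul_mem _ (Jf F x) (Submodule.smul_mem _ (1 / (2 * √(Jf F x))) m2'))
      (Submodule.smul_mem _ (√(Jf F x)) m2')))
    erw [add_sub_cancel_right] at h1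
    exact (Submodule.smul_mem_iff _ (mul_pos hJ (Real.sqrt_pos.mpr hJ)).ne').mp h1
  have s4 := key 3 3 rfl s3 m4
  interval_cases m
  exacts [s0, s1, s2, s3, s4]

theorem finrank_dspan (hA : Admissible τ μ J F) (hx : x ∈ domain J) (hm : m ≤ 4) :
    Module.finrank ℝ (dspan F m x) = m := by
  obtain ⟨κ, hκ⟩ : ∃ κ, 2 * κ ^ 2 = τ ^ 2 := ⟨τ / √2, by
    rw [div_pow, Real.sq_sqrt zero_le_two]; ring⟩
  have h := (linearIndependent_fderiv_inv hA hκ hx).comp _ (Fin.castLE_injective hm)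
  have e : dspan F m x = Submodule.span ℝ
      (Set.range ((fun k => fderiv ℝ (inv F k) x) ∘ Fin.castLE hm)) := by
    rw [dspan, Set.range_comp]
    congr 2
    ext k
    constructor
    · intro hk
      exact ⟨⟨k, hk⟩, rfl⟩
    · rintro ⟨l, rfl⟩
      exact l.2
  rw [e, finrank_span_eq_card h, Fintype.card_fin]

theorem finrank_cspan (hA : Admissible τ μ J F) (hκ : 2 * κ ^ 2 = τ ^ 2) (hκ0 : 0 < κ)
    (hx : x ∈ domain J) (q : ℕ) :
    Module.finrank ℝ (cspan τ κ μ F q x) = min (q - 2) 4 := by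
  have h1 : dspan F (min (q - 2) 4) x ≤ cspan τ κ μ F q x := by
    rcases le_or_gt 2 q with h | h
    · exact (dspan_le_cspan hA hκ hκ0 hx (min_le_right _ _)).trans (cspan_mono (by omega) x)
    · have : min (q - 2) 4 = 0 := by omega
      rw [this]
      simp [dspan]
  have h2 : cspan τ κ μ F q x ≤ dspan F (min (q - 2) 4) x := by
    rcases le_or_gt (q - 2) 4 with h | h
    · rw [min_eq_left h]
      exact cspan_le_dspan hA hκ hx q
    · rw [min_eq_right h.le, dspan_four hA hx le_rfl]
      exact le_top
  rw [le_antisymm h2 h1, finrank_dspan hA hx (min_le_right _ _)]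

end Ranks

/-! ### Dimensions of the isotropy groups -/

section IsotropyDimensions

variable {κ μ : ℝ} {o : Bool}

/-- Three independent generators are enough: only a strict drop at stage 0 is needed, so that no run
stops there. -/
theorem two_lt_groupDim_orthGroup (o : Bool) : 2 < groupDim (orthGroup o etaNull) := by
  let L : (Fin 3 → ℝ) →ₗ[ℝ] Matrix (Fin 4) (Fin 4) ℝ :=
    { toFun := fun v => so (v 0) (v 1) (v 2) 0 0 0
      map_add' := fun u v => by simp [so_add]
      map_smul' := fun r v => by simp [so_smul] }
  have hL : Function.Injective L := by
    intro u v h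
    have e : ∀ i j, so (u 0) (u 1) (u 2) 0 0 0 i j = so (v 0) (v 1) (v 2) 0 0 0 i j :=
      fun i j => congrFun (congrFun h i) j
    have e1 := e 0 1
    have e2 := e 0 2
    have e3 := e 0 3
    simp [so] at e1 e2 e3
    funext i
    fin_cases i
    exacts [e1, e2, e3]
  have h := le_groupDim (G := orthGroup o etaNull) (LinearMap.range L) (by
    rintro _ ⟨v, rfl⟩ s
    exact exp_smul_mem_orthGroup o isUnit_det_etaNull (so_skew _ _ _ _ _ _) s)
  rw [LinearMap.finrank_range_of_inj hL] at h
  simp at h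
  omega

theorem groupDim_stabilizer_C₀ (hμ : μ ≠ 8 / 5) :
    groupDim {X ∈ orthGroup o etaNull | comp (C₀ κ μ) X = C₀ κ μ} = 2 := by
  have hL : Function.Injective nulL := by
    intro u v h
    have e : ∀ i j, nul (u 0) (u 1) i j = nul (v 0) (v 1) i j := fun i j =>
      congrFun (congrFun h i) j
    have e1 := e 0 2
    have e2 := e 1 2
    simp [nul] at e1 e2
    funext i
    fin_cases i
    exacts [e1, e2]
  have hf : Module.finrank ℝ (LinearMap.range nulL) = 2 := by
    rw [LinearMap.finrank_range_of_inj hL]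
    simp
  refine le_antisymm ?_ ?_
  · rw [← hf]
    refine groupDim_le _ fun A hA => ?_
    have hs := skew_of_exp_smul fun s => (hA s).1.1
    obtain ⟨h1, h2, h3, h4⟩ := eq_nul_of_act_C₀ hμ hs
      (act_eq_zero_of_comp_exp fun s => (hA s).2)
    exact ⟨![A 0 2, A 1 2], (eq_nul_of_skew hs h1 h2 h3 h4).symm⟩
  · rw [← hf]
    refine le_groupDim _ ?_
    rintro _ ⟨v, rfl⟩ s
    exact ⟨exp_smul_mem_orthGroup o isUnit_det_etaNull (nul_skew _ _) s,
      comp_exp_smul (act_nul_C₀ _ _) s⟩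

theorem groupDim_stabilizer_C₁ (hκ : 0 < κ) (hμ : μ ≠ 8 / 5) :
    groupDim {X ∈ orthGroup o etaNull | comp (C₀ κ μ) X = C₀ κ μ ∧ comp (C₁ κ μ) X = C₁ κ μ} =
      1 := by
  have hn : nul 0 1 ≠ 0 := fun h => by
    have := congrFun (congrFun h 1) 2
    simp [nul] at this
  have hf : Module.finrank ℝ (Submodule.span ℝ {nul 0 1}) = 1 := finrank_span_singleton hn
  have hs : ∀ y, nul 0 y = y • nul 0 1 := fun y => by
    ext i j
    fin_cases i <;> fin_cases j <;> simp [nul]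
  refine le_antisymm ?_ ?_
  · refine (groupDim_le (Submodule.span ℝ {nul 0 1}) fun A hA => ?_).trans hf.le
    have hsk := skew_of_exp_smul fun s => (hA s).1.1
    have a0 := act_eq_zero_of_comp_exp fun s => (hA s).2.1
    obtain ⟨h1, h2, h3, h4⟩ := eq_nul_of_act_C₀ hμ hsk a0
    rw [eq_nul_of_skew hsk h1 h2 h3 h4, act_C₁_apply_eq_zero hκ hμ hsk a0
      (act_eq_zero_of_comp_exp fun s => (hA s).2.2)]
    exact Submodule.mem_span_singleton.mpr ⟨_, (hs _).symm⟩
  · refine hf.ge.trans (le_groupDim (Submodule.span ℝ {nul 0 1}) fun A hA s => ?_)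
    obtain ⟨y, rfl⟩ := Submodule.mem_span_singleton.mp hA
    rw [← hs]
    exact ⟨exp_smul_mem_orthGroup o isUnit_det_etaNull (nul_skew _ _) s,
      comp_exp_smul (act_nul_C₀ _ _) s, comp_exp_smul (act_nul_C₁ _) s⟩

theorem groupDim_of_stabilizer_C₂ (hκ : 0 < κ) (hμ : μ ≠ 8 / 5)
    {G : Set (Matrix (Fin 4) (Fin 4) ℝ)} (hG : ∀ X ∈ G, X.transpose * etaNull * X = etaNull ∧
      comp (C₀ κ μ) X = C₀ κ μ ∧ comp (C₁ κ μ) X = C₁ κ μ ∧ comp (C₂ κ μ) X = C₂ κ μ) :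
    groupDim G = 0 := by
  refine groupDim_eq_zero_of_involutive fun X hX => ?_
  obtain ⟨h, h0, h1, h2⟩ := hG X hX
  obtain ⟨f, hf, rfl⟩ := stabilizer_C₂ hκ hμ h h0 h1 h2
  rw [Matrix.diagonal_mul_diagonal]
  ext i j
  rcases hf with rfl | rfl <;> fin_cases i <;> fin_cases j <;> simp [Matrix.diagonal]

end IsotropyDimensions

/-! ### Continuity of the residual sign -/

section LocallyConstant

theorem eventually_eq_of_diagonal {Y : MatField 4} {W : Set (Fin 4 → ℝ)} {x : Fin 4 → ℝ}
    (hW : IsOpen W) (hx : x ∈ W) (hY : SmoothOn Y W) (hu : IsUnit (Y x).det)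
    (h : ∀ y ∈ W, ∃ f : ℝ, (f = 1 ∨ f = -1) ∧ Y y = Matrix.diagonal ![1, f, f, f] * Y x) :
    ∀ᶠ y in 𝓝 x, Y y = Y x := by
  -- The reflection reverses this nonzero entry of the second row, which by continuity cannot happen
  -- near x.
  obtain ⟨b, hb⟩ : ∃ b, Y x 1 b ≠ 0 := by
    by_contra! hb
    exact hu.ne_zero (Matrix.det_eq_zero_of_row_eq_zero 1 hb)
  have hc : ContinuousAt (fun y => Y y 1 b) x :=
    (hY 1 b).continuousOn.continuousAt (hW.mem_nhds hx)
  have h1 : ∀ᶠ y in 𝓝 x, Y y 1 b ≠ -Y x 1 b := by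
    refine hc.eventually_ne ?_
    intro h
    apply hb
    linarith
  filter_upwards [h1, hW.mem_nhds hx] with y hy hyW
  obtain ⟨f, hf | hf, e⟩ := h y hyW
  · rw [e, hf]
    have : Matrix.diagonal ![(1 : ℝ), 1, 1, 1] = 1 := by
      ext i j
      fin_cases i <;> fin_cases j <;> simp [Matrix.diagonal]
    rw [this, Matrix.one_mul]
  · exfalso
    apply hy
    rw [e, hf, Matrix.diagonal_mul]
    simp

theorem fderiv_comp_mem_span {n k : ℕ} {T : (Fin n → ℝ) → Arr n k} {x : Fin n → ℝ}
    (hT : ∀ j, DifferentiableAt ℝ (fun y => T y j) x) (Y : Matrix (Fin n) (Fin n) ℝ)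
    (i : Fin k → Fin n) : DifferentiableAt ℝ (fun y => comp (T y) Y i) x ∧
      fderiv ℝ (fun y => comp (T y) Y i) x ∈
        Submodule.span ℝ {α | ∃ j, α = fderiv ℝ (fun y => T y j) x} := by
  have h : HasFDerivAt (fun y => comp (T y) Y i)
      (∑ j : Fin k → Fin n, (∏ m, Y (j m) (i m)) • fderiv ℝ (fun y => T y j) x) x :=
    HasFDerivAt.fun_sum fun j _ => (hT j).hasFDerivAt.const_mul _
  refine ⟨h.differentiableAt, ?_⟩
  rw [h.fderiv]
  exact Submodule.sum_mem _ fun j _ => Submodule.smul_mem _ _ (Submodule.subset_span ⟨j, rfl⟩)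

end LocallyConstant

/-! ### Arbitrary runs of the algorithm on the family -/

section Runs

variable {τ κ μ : ℝ} {J : Set ℝ} {F : ℝ → ℝ} {x : Fin 4 → ℝ} {W : Set (Fin 4 → ℝ)} {o : Bool}

theorem mem_permitted_iff {n : ℕ} {η : Matrix (Fin n) (Fin n) ℝ} {g : MatField n}
    {std : (q : ℕ) → Set (Arr n (4 + q))} {q : ℕ} {x : Fin n → ℝ} {e : Matrix (Fin n) (Fin n) ℝ} :
    e ∈ permitted o η g std q x ↔
      e ∈ orthFrames o η g x ∧ ∀ j < q, comp (nablaR g j x) e ∈ std j := by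
  induction q with
  | zero => simp [permitted]
  | succ q ih =>
    constructor
    · rintro ⟨h1, h2⟩
      obtain ⟨h3, h4⟩ := ih.mp h1
      refine ⟨h3, fun j hj => ?_⟩
      rcases Nat.lt_succ_iff_lt_or_eq.mp hj with h | rfl
      · exact h4 j h
      · exact h2
    · rintro ⟨h1, h2⟩
      exact ⟨ih.mpr ⟨h1, fun j hj => h2 j (Nat.lt_succ_of_lt hj)⟩, h2 q (Nat.lt_succ_self q)⟩

theorem exists_kappa (hA : Admissible τ μ J F) : ∃ κ : ℝ, 0 < κ ∧ 2 * κ ^ 2 = τ ^ 2 := by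
  refine ⟨|τ| / √2, div_pos (abs_pos.mpr hA.tau_ne) (Real.sqrt_pos.mpr two_pos), ?_⟩
  rw [div_pow, sq_abs, Real.sq_sqrt zero_le_two]
  ring

/-- The frame `frm` is positively oriented, and an η-orthogonal matrix has determinant ±1; so
positive orientation of the frame means determinant 1 of the relative matrix. -/
theorem mem_orthFrames_iff (hA : Admissible τ μ J F) (hκ : 2 * κ ^ 2 = τ ^ 2)
    (x : Fin 4 → ℝ) (Y : Matrix (Fin 4) (Fin 4) ℝ) :
    frm κ μ F x * Y ∈ orthFrames o etaNull (metric τ μ F) x ↔ Y ∈ orthGroup o etaNull := by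
  have h1 : (frm κ μ F x * Y).transpose * metric τ μ F x * (frm κ μ F x * Y) =
      Y.transpose * etaNull * Y := by
    rw [← frm_metric hA hκ x, Matrix.transpose_mul]
    simp only [Matrix.mul_assoc]
  have h2 : 0 < (frm κ μ F x * Y).det ↔ 0 < Y.det := by
    rw [Matrix.det_mul]
    exact mul_pos_iff_of_pos_left (det_frm_pos (kappa_ne hA hκ) x)
  constructor
  · rintro ⟨h, ho⟩
    rw [h1] at h
    refine ⟨h, fun h0 => ?_⟩
    have h3 := h2.mp (ho h0)
    rcases mul_self_eq_one_iff.mp (det_sq_of_preserves isUnit_det_etaNull h) with h4 | h4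
    · exact h4
    · rw [h4] at h3
      norm_num at h3
  · rintro ⟨h, ho⟩
    exact ⟨h1.trans h, fun h0 => h2.mpr (by rw [ho h0]; exact one_pos)⟩

theorem frm_mul_cof_mul (hκ : κ ≠ 0) (x : Fin 4 → ℝ) (e : Matrix (Fin 4) (Fin 4) ℝ) :
    frm κ μ F x * (cof κ μ F x * e) = e := by
  rw [← Matrix.mul_assoc, frm_mul_cof hκ, Matrix.one_mul]

theorem comp_nablaR_frm_mul (q : ℕ) (x : Fin 4 → ℝ) (Y : Matrix (Fin 4) (Fin 4) ℝ) :
    comp (nablaR (metric τ μ F) q x) (frm κ μ F x * Y) = comp (frameC τ κ μ F q x) Y :=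
  (comp_comp _ _ _).symm

theorem frameC_const (hA : Admissible τ μ J F) (hκ : 2 * κ ^ 2 = τ ^ 2) {q : ℕ} (hq : q ≤ 2) :
    ∃ C : Arr 4 (4 + q), ∀ x ∈ domain J, frameC τ κ μ F q x = C := by
  interval_cases q
  exacts [⟨_, fun x hx => frameC_zero hA hκ hx⟩, ⟨_, fun x hx => frameC_one hA hκ hx⟩,
    ⟨_, fun x hx => frameC_two hA hκ hx⟩]

/-- The span of the differentials of the components in a frame which is constant, near the point,
relative to `frm`. -/
theorem finrank_of_eventually_const (hA : Admissible τ μ J F) (hκ : 2 * κ ^ 2 = τ ^ 2)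
    (hκ0 : 0 < κ) (hx : x ∈ domain J) {e : MatField 4} {Y : Matrix (Fin 4) (Fin 4) ℝ}
    (hY : IsUnit Y.det) (he : ∀ᶠ y in 𝓝 x, e y = frm κ μ F y * Y) (q : ℕ) :
    Set.finrank ℝ {α : (Fin 4 → ℝ) →L[ℝ] ℝ | ∃ j ≤ q, ∃ i : Fin (4 + j) → Fin 4,
      α = fderiv ℝ (fun y => comp (nablaR (metric τ μ F) j y) (e y) i) x} = min (q - 2) 4 := by
  rw [← finrank_cspan hA hκ hκ0 hx q, Set.finrank]
  have hd : ∀ j i, DifferentiableAt ℝ (fun y => frameC τ κ μ F j y i) x := fun j i =>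
    differentiableAt_of_contDiffOn hA.isOpen_domain (contDiffOn_frameC hA j i) hx
  have hf : ∀ j i, fderiv ℝ (fun y => comp (nablaR (metric τ μ F) j y) (e y) i) x =
      fderiv ℝ (fun y => comp (frameC τ κ μ F j y) Y i) x := fun j i => by
    refine Filter.EventuallyEq.fderiv_eq ?_
    filter_upwards [he] with y hy
    rw [hy, comp_nablaR_frm_mul]
  have hc : ∀ j y, comp (comp (frameC τ κ μ F j y) Y) Y⁻¹ = frameC τ κ μ F j y := fun j y => by
    rw [comp_comp, Matrix.mul_nonsing_inv _ hY, comp_one]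
  suffices hs : Submodule.span ℝ {α : (Fin 4 → ℝ) →L[ℝ] ℝ | ∃ j ≤ q, ∃ i : Fin (4 + j) → Fin 4,
      α = fderiv ℝ (fun y => comp (nablaR (metric τ μ F) j y) (e y) i) x} = cspan τ κ μ F q x by
    rw [hs]
  refine le_antisymm (Submodule.span_le.mpr ?_) (Submodule.span_le.mpr ?_)
  · rintro _ ⟨j, hj, i, rfl⟩
    rw [hf]
    refine Submodule.span_mono ?_ (fderiv_comp_mem_span (hd j) Y i).2
    rintro _ ⟨i, rfl⟩
    exact ⟨j, hj, i, rfl⟩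
  · rintro _ ⟨j, hj, i, rfl⟩
    have h1 := (fderiv_comp_mem_span (fun i => (fderiv_comp_mem_span (hd j) Y i).1) Y⁻¹ i).2
    simp only [hc] at h1
    refine Submodule.span_mono ?_ h1
    rintro _ ⟨i, rfl⟩
    exact ⟨j, hj, i, (hf j i).symm⟩

variable (r : KarlhedeRun o etaNull (metric τ μ F) W)

theorem KarlhedeRun.rel_mem (hA : Admissible τ μ J F) (hκ : 2 * κ ^ 2 = τ ^ 2) {q : ℕ}
    (hq : q ≤ r.last) (hx : x ∈ W) : cof κ μ F x * r.frame q x ∈ orthGroup o etaNull := by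
  rw [← mem_orthFrames_iff hA hκ x, frm_mul_cof_mul (kappa_ne hA hκ)]
  exact (mem_permitted_iff.mp (r.frame_mem q hq x hx)).1

theorem KarlhedeRun.comp_frame (hA : Admissible τ μ J F) (hκ : 2 * κ ^ 2 = τ ^ 2) (q j : ℕ)
    (x : Fin 4 → ℝ) : comp (nablaR (metric τ μ F) j x) (r.frame q x) =
      comp (frameC τ κ μ F j x) (cof κ μ F x * r.frame q x) := by
  rw [← comp_nablaR_frm_mul, frm_mul_cof_mul (kappa_ne hA hκ)]

/-- Up to order 2 the components in `frm` are the same at all points. So the relative position of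
the run's frame at `y` is permitted at `x` too, and uniqueness of the standard form equates the
components. -/
theorem KarlhedeRun.comp_const (hA : Admissible τ μ J F) (hκ : 2 * κ ^ 2 = τ ^ 2)
    (hWJ : W ⊆ domain J) {q j : ℕ} (hq : q ≤ r.last) (hj : j ≤ q) (hj2 : j ≤ 2)
    {y : Fin 4 → ℝ} (hx : x ∈ W) (hy : y ∈ W) :
    comp (frameC τ κ μ F j x) (cof κ μ F y * r.frame q y) =
      comp (frameC τ κ μ F j x) (cof κ μ F x * r.frame q x) := by
  have hκ0 := kappa_ne hA hκ
  have hc : ∀ l ≤ j, frameC τ κ μ F l x = frameC τ κ μ F l y := fun l hl => by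
    obtain ⟨C, hC⟩ := frameC_const hA hκ (hl.trans hj2)
    rw [hC x (hWJ hx), hC y (hWJ hy)]
  have h1 := mem_permitted_iff.mp (r.frame_mem q hq y hy)
  have h2 : frm κ μ F x * (cof κ μ F y * r.frame q y) ∈
      permitted o etaNull (metric τ μ F) r.std (j + 1) x := by
    refine mem_permitted_iff.mpr ⟨(mem_orthFrames_iff hA hκ x _).mpr (r.rel_mem hA hκ hq hy),
      fun l hl => ?_⟩
    rw [comp_nablaR_frm_mul, hc l (by omega), ← r.comp_frame hA hκ]
    exact h1.2 l (by omega)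
  have h3 := r.std_unique j (hj.trans hq) x hx _ h2 _
    (permitted_anti r.std (show j + 1 ≤ q + 1 by omega) x (r.frame_mem q hq x hx))
  rwa [comp_nablaR_frm_mul, r.comp_frame hA hκ] at h3

/-- For q ≤ 2 the components in the run's frame are constant. For larger q the relative frame is
fixed by orders 0, 1, 2 up to the reflection, hence locally constant by smoothness, and the rank is
that found in `frm`. -/
theorem KarlhedeRun.t_eq (hA : Admissible τ μ J F) (hW : IsOpen W) (hne : W.Nonempty)
    (hWJ : W ⊆ domain J) {q : ℕ} (hq : q ≤ r.last) : r.t q = min (q - 2) 4 := by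
  obtain ⟨κ, hκ0, hκ⟩ := exists_kappa hA
  obtain ⟨x, hx⟩ := hne
  rw [← r.rank q hq x hx]
  rcases le_or_gt q 2 with h2 | h2
  · have h0 : {α : (Fin 4 → ℝ) →L[ℝ] ℝ | ∃ j ≤ q, ∃ i : Fin (4 + j) → Fin 4,
        α = fderiv ℝ (fun y => comp (nablaR (metric τ μ F) j y) (r.frame q y) i) x} ⊆ {0} := by
      rintro _ ⟨j, hj, i, rfl⟩
      obtain ⟨C, hC⟩ := frameC_const hA hκ (hj.trans h2)
      have : (fun y => comp (nablaR (metric τ μ F) j y) (r.frame q y) i) =ᶠ[𝓝 x]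
          fun _ => comp (frameC τ κ μ F j x) (cof κ μ F x * r.frame q x) i := by
        filter_upwards [hW.mem_nhds hx] with y hy
        rw [r.comp_frame hA hκ, ← r.comp_const hA hκ hWJ hq hj (hj.trans h2) hx hy,
          hC x (hWJ hx), hC y (hWJ hy)]
      rw [this.fderiv_eq]
      simp
    have h3 : Submodule.span ℝ {α : (Fin 4 → ℝ) →L[ℝ] ℝ | ∃ j ≤ q, ∃ i : Fin (4 + j) → Fin 4,
        α = fderiv ℝ (fun y => comp (nablaR (metric τ μ F) j y) (r.frame q y) i) x} = ⊥ :=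
      Submodule.span_eq_bot.mpr fun α hα => h0 hα
    rw [Set.finrank, h3, finrank_bot]
    omega
  · set Y : MatField 4 := fun y => cof κ μ F y * r.frame q y with hYdef
    have hYs : SmoothOn Y W := ((smoothOn_cof hA).mono hWJ).mul (r.frame_smooth q hq)
    have hYo : ∀ y ∈ W, Y y ∈ orthGroup o etaNull := fun y hy => r.rel_mem hA hκ hq hy
    have hYu : ∀ y ∈ W, IsUnit (Y y).det := fun y hy => isUnit_det_of_preserves (hYo y hy).1
    refine finrank_of_eventually_const hA hκ hκ0 (hWJ hx) (hYu x hx) ?_ q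
    have hZ : ∀ y ∈ W, ∃ f : ℝ, (f = 1 ∨ f = -1) ∧
        Y y = Matrix.diagonal ![1, f, f, f] * Y x := by
      intro y hy
      have hZp : (Y y * (Y x)⁻¹).transpose * etaNull * (Y y * (Y x)⁻¹) = etaNull := by
        have h1 : (Y x)⁻¹.transpose * (Y x).transpose = 1 := by
          rw [← Matrix.transpose_mul, Matrix.mul_nonsing_inv _ (hYu x hx), Matrix.transpose_one]
        calc _ = (Y x)⁻¹.transpose * ((Y y).transpose * etaNull * Y y) * (Y x)⁻¹ := by
              rw [Matrix.transpose_mul]; simp only [Matrix.mul_assoc]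
          _ = (Y x)⁻¹.transpose * ((Y x).transpose * etaNull * Y x) * (Y x)⁻¹ := by
              rw [(hYo y hy).1, (hYo x hx).1]
          _ = ((Y x)⁻¹.transpose * (Y x).transpose) * etaNull * (Y x * (Y x)⁻¹) := by
              simp only [Matrix.mul_assoc]
          _ = etaNull := by
              rw [h1, Matrix.mul_nonsing_inv _ (hYu x hx), Matrix.one_mul, Matrix.mul_one]
      have hc : ∀ j ≤ 2, comp (frameC τ κ μ F j x) (Y y * (Y x)⁻¹) = frameC τ κ μ F j x := by
        intro j hj
        rw [← comp_comp, r.comp_const hA hκ hWJ hq (hj.trans h2.le) hj hx hy, comp_comp,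
          Matrix.mul_nonsing_inv _ (hYu x hx), comp_one]
      have c0 := hc 0 (by omega)
      have c1 := hc 1 (by omega)
      have c2 := hc 2 (by omega)
      rw [frameC_zero hA hκ (hWJ hx)] at c0
      rw [frameC_one hA hκ (hWJ hx)] at c1
      rw [frameC_two hA hκ (hWJ hx)] at c2
      obtain ⟨f, hf, h⟩ := stabilizer_C₂ hκ0 hA.mu_ne hZp c0 c1 c2
      refine ⟨f, hf, ?_⟩
      rw [← h, Matrix.mul_assoc, Matrix.nonsing_inv_mul _ (hYu x hx), Matrix.mul_one]
    filter_upwards [eventually_eq_of_diagonal hW hx hYs (hYu x hx) hZ] with y hy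
    rw [← hy, frm_mul_cof_mul hκ0.ne']

/-- The recursive definition of the isotropy groups unfolds to a joint stabilizer, seen in the run's
frame instead of `frm`. Conjugation by the relative frame accounts for the difference. -/
theorem KarlhedeRun.G_eq (hA : Admissible τ μ J F) (hκ : 2 * κ ^ 2 = τ ^ 2) {q p : ℕ}
    (hp : p ≤ q) (hq : q ≤ r.last) (hx : x ∈ W) :
    r.G p = {X | cof κ μ F x * r.frame q x * X * (cof κ μ F x * r.frame q x)⁻¹ ∈
      {Z ∈ orthGroup o etaNull | ∀ j ≤ p, comp (frameC τ κ μ F j x) Z = frameC τ κ μ F j x}} := by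
  have hYo := r.rel_mem hA hκ hq hx
  have hc := fun j => r.comp_frame hA hκ q j x
  have hmem : ∀ j ≤ q, r.frame q x ∈ permitted o etaNull (metric τ μ F) r.std (j + 1) x :=
    fun j hj => permitted_anti r.std (by omega) x (r.frame_mem q hq x hx)
  set Y := cof κ μ F x * r.frame q x
  clear_value Y
  have hYu := isUnit_det_of_preserves hYo.1
  have hconj : ∀ j X, comp (comp (frameC τ κ μ F j x) Y) X = comp (frameC τ κ μ F j x) Y ↔
      comp (frameC τ κ μ F j x) (Y * X * Y⁻¹) = frameC τ κ μ F j x := by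
    intro j X
    rw [comp_comp]
    constructor
    · intro h
      rw [← comp_comp, h, comp_comp, Matrix.mul_nonsing_inv _ hYu, comp_one]
    · intro h
      conv_rhs => rw [← h]
      rw [comp_comp, Matrix.mul_assoc, Matrix.nonsing_inv_mul _ hYu, Matrix.mul_one]
  have hgrp : ∀ X, X ∈ orthGroup o etaNull ↔ Y * X * Y⁻¹ ∈ orthGroup o etaNull := by
    have hdet : ∀ X, (Y * X * Y⁻¹).det = X.det := fun X => by
      rw [Matrix.det_mul, Matrix.det_mul, mul_comm, ← mul_assoc, ← Matrix.det_mul,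
        Matrix.nonsing_inv_mul _ hYu, Matrix.det_one, one_mul]
    have h1 : Y⁻¹.transpose * etaNull * Y⁻¹ = etaNull := by
      conv_lhs => rw [← hYo.1]
      have h1 : Y⁻¹.transpose * Y.transpose = 1 := by
        rw [← Matrix.transpose_mul, Matrix.mul_nonsing_inv _ hYu, Matrix.transpose_one]
      calc _ = (Y⁻¹.transpose * Y.transpose) * etaNull * (Y * Y⁻¹) := by
            simp only [Matrix.mul_assoc]
        _ = etaNull := by rw [h1, Matrix.mul_nonsing_inv _ hYu, Matrix.one_mul, Matrix.mul_one]
    intro X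
    have h2 : (Y * X * Y⁻¹).transpose * etaNull * (Y * X * Y⁻¹) =
        Y⁻¹.transpose * (X.transpose * etaNull * X) * Y⁻¹ := by
      calc _ = Y⁻¹.transpose * (X.transpose * (Y.transpose * etaNull * Y) * X) * Y⁻¹ := by
            rw [Matrix.transpose_mul, Matrix.transpose_mul]
            simp only [Matrix.mul_assoc]
        _ = _ := by rw [hYo.1]
    constructor
    · rintro ⟨h, hd⟩
      exact ⟨by rw [h2, h, h1], fun ho => (hdet X).trans (hd ho)⟩
    · rintro ⟨h, hd⟩
      refine ⟨?_, fun ho => (hdet X).symm.trans (hd ho)⟩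
      rw [h2] at h
      have h3 := congrArg (fun M => Y.transpose * M * Y) h
      beta_reduce at h3
      rw [hYo.1] at h3
      have h4 : Y.transpose * Y⁻¹.transpose = 1 := by
        rw [← Matrix.transpose_mul, Matrix.nonsing_inv_mul _ hYu, Matrix.transpose_one]
      refine Eq.trans (Eq.symm ?_) h3
      calc _ = (Y.transpose * Y⁻¹.transpose) * (X.transpose * etaNull * X) * (Y⁻¹ * Y) := by
            simp only [Matrix.mul_assoc]
        _ = _ := by rw [h4, Matrix.nonsing_inv_mul _ hYu, Matrix.one_mul, Matrix.mul_one]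
  induction p with
  | zero =>
    rw [r.isotropy 0 (by omega) x hx _ (hmem 0 (by omega))]
    ext X
    simp only [before, Set.mem_ofPred_eq, hc, hconj, hgrp X]
    refine and_congr_right fun _ => ⟨fun h j hj => ?_, fun h => h 0 le_rfl⟩
    obtain rfl : j = 0 := by omega
    exact h
  | succ p ih =>
    rw [r.isotropy (p + 1) (by omega) x hx _ (hmem (p + 1) hp)]
    ext X
    simp only [before, Set.mem_ofPred_eq, hc, hconj, ih (by omega), and_assoc]
    refine and_congr_right fun _ => ⟨fun h j hj => ?_, fun h => ⟨fun j hj => h j (by omega),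
      h _ le_rfl⟩⟩
    rcases Nat.lt_or_ge p j with h' | h'
    · obtain rfl : j = p + 1 := by omega
      exact h.2
    · exact h.1 j h'

theorem KarlhedeRun.groupDim_eq (hA : Admissible τ μ J F) (hne : W.Nonempty)
    (hWJ : W ⊆ domain J) {q : ℕ} (hq : q ≤ r.last) : groupDim (r.G q) = 2 - q := by
  obtain ⟨κ, hκ0, hκ⟩ := exists_kappa hA
  obtain ⟨x, hx⟩ := hne
  rw [r.G_eq hA hκ le_rfl hq hx, groupDim_conj
    (isUnit_det_of_preserves (r.rel_mem hA hκ hq hx).1)]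
  have e0 := frameC_zero hA hκ (hWJ hx)
  have e1 := frameC_one hA hκ (hWJ hx)
  have e2 := frameC_two hA hκ (hWJ hx)
  rcases q with _ | _ | q
  · refine Eq.trans ?_ (groupDim_stabilizer_C₀ (κ := κ) (o := o) hA.mu_ne)
    congr 1
    ext Z
    refine and_congr_right fun _ => ⟨fun h => ?_, fun h j hj => ?_⟩
    · have := h 0 le_rfl
      rwa [e0] at this
    · obtain rfl : j = 0 := by omega
      rw [e0]
      exact h
  · refine Eq.trans ?_ (groupDim_stabilizer_C₁ (o := o) hκ0 hA.mu_ne)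
    congr 1
    ext Z
    refine and_congr_right fun _ => ⟨fun h => ⟨?_, ?_⟩, fun h j hj => ?_⟩
    · have := h 0 (by omega)
      rwa [e0] at this
    · have := h 1 (by omega)
      rwa [e1] at this
    · interval_cases j
      · rw [e0]
        exact h.1
      · rw [e1]
        exact h.2
  · refine (groupDim_of_stabilizer_C₂ hκ0 hA.mu_ne fun Z hZ => ?_).trans (by omega)
    refine ⟨hZ.1.1, ?_, ?_, ?_⟩
    · have := hZ.2 0 (by omega)
      rwa [e0] at this
    · have := hZ.2 1 (by omega)
      rwa [e1] at this
    · have := hZ.2 2 (by omega)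
      rwa [e2] at this

/-- The dimension drops at stages 0, 1, 2 and the rank grows at stages 3 to 6, so none of these can
terminate; stage 7 repeats the values of stage 6, so it cannot be passed. -/
theorem KarlhedeRun.last_eq (hA : Admissible τ μ J F) (hW : IsOpen W) (hne : W.Nonempty)
    (hWJ : W ⊆ domain J) : r.last = 7 := by
  have ht := fun q hq => r.t_eq hA hW hne hWJ (q := q) hq
  have hG := fun q hq => r.groupDim_eq hA hne hWJ (q := q) hq
  have hlt := r.terminates
  have h2 := two_lt_groupDim_orthGroup o
  refine le_antisymm (not_lt.mp fun h => ?_) (not_lt.mp fun h => ?_)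
  · have hc := r.continues 7 h
    simp only [before] at hc
    rw [hG 7 h.le, hG 6 (by omega), ht 7 h.le, ht 6 (by omega)] at hc
    norm_num at hc
  · rcases hl : r.last with _ | l
    · rw [hl] at hlt
      simp only [before] at hlt
      rw [hG 0 (by omega)] at hlt
      exact hlt (Or.inl h2)
    · rw [hl] at hlt h
      simp only [before] at hlt
      rw [hG (l + 1) (by omega), hG l (by omega), ht (l + 1) (by omega), ht l (by omega)] at hlt
      omega

end Runs

/-! ### Construction of a run -/

section Existence

variable {τ κ μ : ℝ} {J : Set ℝ} {F : ℝ → ℝ} {x : Fin 4 → ℝ} {W : Set (Fin 4 → ℝ)} {o : Bool}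

/-- Standard forms for the family of metrics. -/
def stdForms (o : Bool) (κ μ : ℝ) : (q : ℕ) → Set (Arr 4 (4 + q))
  | 0 => {C₀ κ μ}
  | 1 => {C₁ κ μ}
  | 2 => {C₂ κ μ}
  | 3 => {T | o = false → ∃ I > 0, T = C₃ κ μ I}
  | _ + 4 => Set.univ

/-- The isotropy groups of the standard forms. -/
def isoGroups (o : Bool) (κ μ : ℝ) : ℕ → Set (Matrix (Fin 4) (Fin 4) ℝ)
  | 0 => {X ∈ orthGroup o etaNull | comp (C₀ κ μ) X = C₀ κ μ}
  | 1 => {X ∈ orthGroup o etaNull | comp (C₀ κ μ) X = C₀ κ μ ∧ comp (C₁ κ μ) X = C₁ κ μ}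
  | 2 => {X ∈ orthGroup o etaNull | (comp (C₀ κ μ) X = C₀ κ μ ∧ comp (C₁ κ μ) X = C₁ κ μ) ∧
      comp (C₂ κ μ) X = C₂ κ μ}
  | _ + 3 => {1}

/-- The sign by which the frame is normalized. -/
def frameSign (o : Bool) (x : Fin 4 → ℝ) : ℝ := if o = true ∨ 0 < x 3 then 1 else -1

theorem frameSign_eq (o : Bool) (x : Fin 4 → ℝ) : frameSign o x = 1 ∨ frameSign o x = -1 := by
  unfold frameSign
  split_ifs <;> simp

theorem frameSign_eventually (hx : o = false → x 3 ≠ 0) :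
    ∀ᶠ y in 𝓝 x, frameSign o y = frameSign o x := by
  cases o
  · have hc : ContinuousAt (fun y : Fin 4 → ℝ => y 3) x := (continuous_apply 3).continuousAt
    rcases lt_or_gt_of_ne (hx rfl) with h | h
    · filter_upwards [hc.eventually_lt continuousAt_const h] with y hy
      simp [frameSign, not_lt.mpr h.le, not_lt.mpr hy.le]
    · filter_upwards [continuousAt_const.eventually_lt hc h] with y hy
      simp [frameSign, h, hy]
  · simp [frameSign]

theorem frameSign_mul_I₁_pos (hx : x 3 ≠ 0) : 0 < frameSign false x * I₁ x := by
  unfold frameSign I₁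
  have hE := Real.exp_pos (-3 * x 1)
  rcases lt_or_gt_of_ne hx with h | h
  · simp only [Bool.false_eq_true, false_or, not_lt.mpr h.le, if_false]
    nlinarith
  · simp only [Bool.false_eq_true, false_or, h, if_true]
    nlinarith

/-- The normalized frame. -/
def normFrame (o : Bool) (κ μ : ℝ) (F : ℝ → ℝ) : MatField 4 := fun x =>
  frm κ μ F x * Matrix.diagonal ![1, frameSign o x, frameSign o x, frameSign o x]

theorem smoothOn_normFrame (hA : Admissible τ μ J F) (hWJ : W ⊆ domain J)
    (ht : o = false → ∀ x ∈ W, x 3 ≠ 0) : SmoothOn (normFrame o κ μ F) W := by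
  intro i j x hx
  have h1 := (smoothOn_frm (κ := κ) hA).mul
    (SmoothOn.const (Matrix.diagonal ![1, frameSign o x, frameSign o x, frameSign o x])) i j x
    (hWJ hx)
  refine (h1.mono hWJ).congr_of_eventuallyEq ?_ rfl
  refine nhdsWithin_le_nhds ?_
  filter_upwards [frameSign_eventually fun ho => ht ho x hx] with y hy
  simp only [normFrame, hy]

theorem det_diagonal (f : ℝ) : (Matrix.diagonal ![1, f, f, f]).det = f ^ 3 := by
  rw [Matrix.det_diagonal]
  simp [Fin.prod_univ_four]
  ring

theorem diagonal_mem_orthGroup {f : ℝ} (hf : f = 1 ∨ f = -1) (ho : o = true → f = 1) :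
    Matrix.diagonal ![1, f, f, f] ∈ orthGroup o etaNull :=
  ⟨diagonal_preserves hf, fun h => by rw [det_diagonal, ho h, one_pow]⟩

theorem comp_frameC_diagonal (hA : Admissible τ μ J F) (hκ : 2 * κ ^ 2 = τ ^ 2)
    (hx : x ∈ domain J) {f : ℝ} (hf : f = 1 ∨ f = -1) :
    comp (frameC τ κ μ F 0 x) (Matrix.diagonal ![1, f, f, f]) = C₀ κ μ ∧
      comp (frameC τ κ μ F 1 x) (Matrix.diagonal ![1, f, f, f]) = C₁ κ μ ∧
      comp (frameC τ κ μ F 2 x) (Matrix.diagonal ![1, f, f, f]) = C₂ κ μ ∧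
      comp (frameC τ κ μ F 3 x) (Matrix.diagonal ![1, f, f, f]) = C₃ κ μ (f * I₁ x) := by
  obtain ⟨h0, h1, h2, h3⟩ := comp_diagonal (κ := κ) (μ := μ) hf
  rw [frameC_zero hA hκ hx, frameC_one hA hκ hx, frameC_two hA hκ hx, frameC_three hA hκ hx]
  exact ⟨h0, h1, h2, h3 _⟩

theorem normFrame_mem (hA : Admissible τ μ J F) (hκ : 2 * κ ^ 2 = τ ^ 2)
    (hx : x ∈ domain J) (ht : o = false → x 3 ≠ 0) (q : ℕ) :
    normFrame o κ μ F x ∈ permitted o etaNull (metric τ μ F) (stdForms o κ μ) q x := by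
  obtain ⟨h0, h1, h2, h3⟩ := comp_frameC_diagonal hA hκ hx (frameSign_eq o x)
  refine mem_permitted_iff.mpr ⟨(mem_orthFrames_iff hA hκ x _).mpr
    (diagonal_mem_orthGroup (frameSign_eq o x) fun ho => by simp [frameSign, ho]), fun j _ => ?_⟩
  rw [normFrame, comp_nablaR_frm_mul]
  rcases j with _ | _ | _ | _ | j
  · exact h0
  · exact h1
  · exact h2
  · intro ho
    subst ho
    exact ⟨_, frameSign_mul_I₁_pos (ht rfl), h3⟩
  · trivial

/-- After stage 3 only the reflection could remain. It has determinant -1, which excludes it for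
SO(η); for O(η) it would make the argument of `C₃` negative, against the standard form. -/
theorem eq_normFrame_of_mem (hA : Admissible τ μ J F) (hκ : 2 * κ ^ 2 = τ ^ 2) (hκ0 : 0 < κ)
    (hx : x ∈ domain J) (ht : o = false → x 3 ≠ 0) {q : ℕ} (hq : 4 ≤ q)
    {e : Matrix (Fin 4) (Fin 4) ℝ}
    (he : e ∈ permitted o etaNull (metric τ μ F) (stdForms o κ μ) q x) :
    e = normFrame o κ μ F x := by
  obtain ⟨h, hs⟩ := mem_permitted_iff.mp he
  rw [← frm_mul_cof_mul (μ := μ) (F := F) hκ0.ne' x e] at h hs ⊢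
  generalize cof κ μ F x * e = Y at h hs ⊢
  rw [mem_orthFrames_iff hA hκ] at h
  simp only [comp_nablaR_frm_mul] at hs
  have s0 := hs 0 (by omega)
  have s1 := hs 1 (by omega)
  have s2 := hs 2 (by omega)
  have s3 := hs 3 (by omega)
  rw [frameC_zero hA hκ hx] at s0
  rw [frameC_one hA hκ hx] at s1
  rw [frameC_two hA hκ hx] at s2
  rw [frameC_three hA hκ hx] at s3
  obtain ⟨f, hf, rfl⟩ := stabilizer_C₂ hκ0 hA.mu_ne h.1 s0 s1 s2
  suffices hfs : f = frameSign o x by rw [normFrame, hfs]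
  cases o
  · obtain ⟨I, hI, hC⟩ := s3 rfl
    rw [(comp_diagonal hf).2.2.2] at hC
    have h1 := C₃_injective hκ0 hA.mu_ne hC
    have h2 := frameSign_mul_I₁_pos (ht rfl)
    rcases hf with rfl | rfl <;> rcases frameSign_eq false x with h3 | h3 <;> rw [h3] at h2 ⊢ <;>
      nlinarith
  · have h1 := h.2 rfl
    rw [det_diagonal] at h1
    rcases hf with rfl | rfl
    · simp [frameSign]
    · norm_num at h1

theorem diagonal_one : Matrix.diagonal ![(1 : ℝ), 1, 1, 1] = 1 := by
  ext i j
  fin_cases i <;> fin_cases j <;> simp [Matrix.diagonal]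

theorem one_mem_isoGroups (q : ℕ) : 1 ∈ isoGroups o κ μ q := by
  have h : (1 : Matrix (Fin 4) (Fin 4) ℝ) ∈ orthGroup o etaNull := ⟨by simp, fun _ => by simp⟩
  rcases q with _ | _ | _ | q
  · exact ⟨h, comp_one _⟩
  · exact ⟨h, comp_one _, comp_one _⟩
  · exact ⟨h, ⟨comp_one _, comp_one _⟩, comp_one _⟩
  · rfl

/-- The only case with content is stage 3: for O(η) the reflection would fix `C₃` at a positive
argument, which injectivity forbids, and for SO(η) its determinant is wrong. -/
theorem isoGroups_succ (hA : Admissible τ μ J F) (hκ0 : 0 < κ)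
    (ht : o = false → x 3 ≠ 0) (q : ℕ) {e : Matrix (Fin 4) (Fin 4) ℝ}
    (he : e ∈ permitted o etaNull (metric τ μ F) (stdForms o κ μ) (q + 1) x) :
    isoGroups o κ μ q = {X ∈ before (orthGroup o etaNull) (isoGroups o κ μ) q |
      comp (comp (nablaR (metric τ μ F) q x) e) X = comp (nablaR (metric τ μ F) q x) e} := by
  have hs := (mem_permitted_iff.mp he).2 q (Nat.lt_succ_self q)
  rcases q with _ | _ | _ | q
  · rw [show comp (nablaR (metric τ μ F) 0 x) e = C₀ κ μ from hs]
    rfl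
  · rw [show comp (nablaR (metric τ μ F) 1 x) e = C₁ κ μ from hs]
    ext X
    simp only [isoGroups, before, Set.mem_ofPred_eq, and_assoc]
  · rw [show comp (nablaR (metric τ μ F) 2 x) e = C₂ κ μ from hs]
    ext X
    simp only [isoGroups, before, Set.mem_ofPred_eq, and_assoc]
  · rcases q with _ | q
    · ext X
      refine ⟨?_, fun ⟨hX, h⟩ => ?_⟩
      · rintro rfl
        exact ⟨one_mem_isoGroups 2, comp_one _⟩
      · obtain ⟨hX, ⟨s0, s1⟩, s2⟩ := hX
        obtain ⟨f, hf, rfl⟩ := stabilizer_C₂ hκ0 hA.mu_ne hX.1 s0 s1 s2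
        suffices hf1 : f = 1 by
          rw [hf1, diagonal_one]
          rfl
        cases o
        · obtain ⟨I, hI, hC⟩ := hs rfl
          erw [hC, (comp_diagonal hf).2.2.2] at h
          have h1 := C₃_injective hκ0 hA.mu_ne h
          rcases hf with h | rfl
          · exact h
          · linarith
        · have h1 := hX.2 rfl
          rw [det_diagonal] at h1
          rcases hf with h | rfl
          · exact h
          · norm_num at h1
    · ext X
      refine ⟨?_, fun h => h.1⟩
      rintro rfl
      exact ⟨rfl, comp_one _⟩

theorem groupDim_isoGroups (hκ : 0 < κ) (hμ : μ ≠ 8 / 5) (q : ℕ) :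
    groupDim (isoGroups o κ μ q) = 2 - q := by
  rcases q with _ | _ | _ | q
  · exact groupDim_stabilizer_C₀ hμ
  · exact groupDim_stabilizer_C₁ hκ hμ
  · exact groupDim_of_stabilizer_C₂ hκ hμ fun X hX => ⟨hX.1.1, hX.2.1.1, hX.2.1.2, hX.2.2⟩
  · refine (groupDim_eq_zero_of_involutive fun X hX => ?_).trans (by omega)
    rw [show X = 1 from hX, Matrix.one_mul]

/-- One normalized frame field serves at all stages. From stage 4 on no condition is imposed,
because the permitted frame is already unique. -/
theorem nonempty_run (hA : Admissible τ μ J F) (hWJ : W ⊆ domain J)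
    (ht : o = false → ∀ x ∈ W, x 3 ≠ 0) : Nonempty (KarlhedeRun o etaNull (metric τ μ F) W) := by
  obtain ⟨κ, hκ0, hκ⟩ := exists_kappa hA
  have hm := fun q (x : Fin 4 → ℝ) (hx : x ∈ W) =>
    normFrame_mem (o := o) hA hκ (hWJ hx) (fun ho => ht ho x hx) q
  have hd := fun q => groupDim_isoGroups (o := o) hκ0 hA.mu_ne q
  have h2 := two_lt_groupDim_orthGroup o
  exact ⟨{
    last := 7
    std := stdForms o κ μ
    G := isoGroups o κ μ
    frame := fun _ => normFrame o κ μ F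
    t := fun q => min (q - 2) 4
    frame_smooth := fun _ _ => smoothOn_normFrame hA hWJ ht
    frame_mem := fun q _ x hx => hm (q + 1) x hx
    std_unique := by
      intro q _ x hx e he e' he'
      have hs := (mem_permitted_iff.mp he).2 q (Nat.lt_succ_self q)
      have hs' := (mem_permitted_iff.mp he').2 q (Nat.lt_succ_self q)
      rcases q with _ | _ | _ | q
      · exact (show _ = C₀ κ μ from hs).trans (show _ = C₀ κ μ from hs').symm
      · exact (show _ = C₁ κ μ from hs).trans (show _ = C₁ κ μ from hs').symm
      · exact (show _ = C₂ κ μ from hs).trans (show _ = C₂ κ μ from hs').symm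
      · rw [eq_normFrame_of_mem hA hκ hκ0 (hWJ hx) (fun ho => ht ho x hx) (by omega) he,
          eq_normFrame_of_mem hA hκ hκ0 (hWJ hx) (fun ho => ht ho x hx) (by omega) he']
    isotropy := fun q _ x hx e he =>
      isoGroups_succ hA hκ0 (fun ho => ht ho x hx) q he
    rank := fun q _ x hx => by
      refine finrank_of_eventually_const hA hκ hκ0 (hWJ hx) (isUnit_det_of_preserves
        (diagonal_preserves (frameSign_eq o x))) ?_ q
      filter_upwards [frameSign_eventually fun ho => ht ho x hx] with y hy
      simp only [normFrame, hy]
    continues := fun q hq => by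
      rcases q with _ | q
      · left
        simp only [before, hd]
        exact h2
      · simp only [before, hd]
        omega
    terminates := by
      simp only [before, hd]
      norm_num }⟩

end Existence

/-! ### Invariants of a local isometry -/

section Isometries

variable {τ κ μ : ℝ} {J : Set ℝ} {F φ : ℝ → ℝ} {τ' κ' μ' : ℝ} {J' : Set ℝ} {F' φ' : ℝ → ℝ}
  {ψ : (Fin 4 → ℝ) → Fin 4 → ℝ} {U : Set (Fin 4 → ℝ)} {p x : Fin 4 → ℝ} {ε : ℝ}

theorem isUnit_det_jac_of_isometry (hA : Admissible τ μ J F)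
    (hiso : metric τ μ F x =
      (jac ψ x).transpose * metric τ' μ' F' (ψ x) * jac ψ x) : IsUnit (jac ψ x).det := by
  have h := isUnit_det_metric hA x
  rw [hiso, Matrix.det_mul] at h
  exact isUnit_of_mul_isUnit_right h

/-- A local isometry preserves the frame up to one sign. -/
theorem isometry_frame (hA : Admissible τ μ J F) (hA' : Admissible τ' μ' J' F') (hκ0 : 0 < κ)
    (hκ : 2 * κ ^ 2 = τ ^ 2) (hκ0' : 0 < κ') (hκ' : 2 * κ' ^ 2 = τ' ^ 2) (hU : IsOpen U)
    (hUJ : U ⊆ domain J) (hψ : ∀ k, ContDiffOn ℝ ∞ (fun y => ψ y k) U)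
    (hmaps : Set.MapsTo ψ U (domain J'))
    (hiso : ∀ x ∈ U, metric τ μ F x =
      (jac ψ x).transpose * metric τ' μ' F' (ψ x) * jac ψ x) (hp : p ∈ U) :
    κ = κ' ∧ μ = μ' ∧ ∃ ε : ℝ, (ε = 1 ∨ ε = -1) ∧ ∀ᶠ x in 𝓝 p, x ∈ U ∧
      cof κ' μ' F' (ψ x) * jac ψ x = Matrix.diagonal ![1, ε, ε, ε] * cof κ μ F x ∧
      I₁ (ψ x) = ε * I₁ x := by
  have hκn := hκ0.ne'
  have hκn' := hκ0'.ne'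
  -- The differential of the isometry expressed in the two frames: it is η-orthogonal and carries
  -- the components of each ∇^(q)R of the second metric to those of the first.
  set X : MatField 4 := fun x => cof κ' μ' F' (ψ x) * jac ψ x * frm κ μ F x with hXd
  have hXs : SmoothOn X U := by
    refine SmoothOn.mul (SmoothOn.mul (fun i j => ?_) fun k c => contDiffOn_pd hU (hψ k) c)
      ((smoothOn_frm hA).mono hUJ)
    exact (smoothOn_cof hA' i j).comp (contDiffOn_pi.mpr hψ) hmaps
  have hXη : ∀ x ∈ U, (X x).transpose * etaNull * X x = etaNull := fun x hx => by
    have h1 := frm_metric hA hκ x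
    rw [hiso x hx, metric_eq hκ' hA'.tau_ne] at h1
    refine Eq.trans ?_ h1
    simp only [hXd, Matrix.transpose_mul, Matrix.mul_assoc]
  have hXc : ∀ q, ∀ x ∈ U, comp (frameC τ' κ' μ' F' q (ψ x)) (X x) = frameC τ κ μ F q x :=
    fun q x hx => by
    have h := nablaR_natural hU hA'.isOpen_domain hψ hmaps ((smoothOn_metric hA).mono hUJ)
      (fun y _ => isUnit_det_metric hA y) (smoothOn_metric hA') (fun y _ => metric_isSymm hA' y)
      (fun y _ => isUnit_det_metric hA' y) (fun y hy => isUnit_det_jac_of_isometry hA (hiso y hy))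
      hiso q x hx
    rw [frameC, frameC, h, comp_comp, comp_comp]
    congr 1
    rw [hXd]
    simp only [Matrix.mul_assoc]
    rw [← Matrix.mul_assoc (frm κ' μ' F' (ψ x)), frm_mul_cof hκn', Matrix.one_mul]
  have h0 : ∀ x ∈ U, comp (C₀ κ' μ') (X x) = C₀ κ μ := fun x hx => by
    have := hXc 0 x hx
    rwa [frameC_zero hA hκ (hUJ hx), frameC_zero hA' hκ' (hmaps hx)] at this
  have h1 : ∀ x ∈ U, comp (C₁ κ' μ') (X x) = C₁ κ μ := fun x hx => by
    rw [← frameC_one hA hκ (hUJ hx), ← frameC_one hA' hκ' (hmaps hx)]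
    exact hXc 1 x hx
  have h2 : ∀ x ∈ U, comp (C₂ κ' μ') (X x) = C₂ κ μ := fun x hx => by
    rw [← frameC_two hA hκ (hUJ hx), ← frameC_two hA' hκ' (hmaps hx)]
    exact hXc 2 x hx
  have h3 : ∀ x ∈ U, comp (C₃ κ' μ' (I₁ (ψ x))) (X x) = C₃ κ μ (I₁ x) := fun x hx => by
    rw [← frameC_three hA hκ (hUJ hx), ← frameC_three hA' hκ' (hmaps hx)]
    exact hXc 3 x hx
  -- A single point suffices to identify the constants; afterwards both metrics share the arrays
  -- `C₀`, `C₁`, `C₂`.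
  obtain ⟨ek, em, -⟩ := stabilizer_C₁ hκ0' hκ0 hA'.mu_ne hA.mu_ne (hXη p hp) (h0 p hp) (h1 p hp)
  subst ek em
  refine ⟨rfl, rfl, ?_⟩
  have hs : ∀ x ∈ U, ∃ f : ℝ, (f = 1 ∨ f = -1) ∧ X x = Matrix.diagonal ![1, f, f, f] :=
    fun x hx => stabilizer_C₂ hκ0 hA.mu_ne (hXη x hx) (h0 x hx) (h1 x hx) (h2 x hx)
  obtain ⟨ε, hε, hXp⟩ := hs p hp
  refine ⟨ε, hε, ?_⟩
  have hc := eventually_eq_of_diagonal hU hp hXs (isUnit_det_of_preserves (hXη p hp))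
    fun y hy => by
      obtain ⟨f, hf, e⟩ := hs y hy
      refine ⟨f * ε, ?_, ?_⟩
      · rcases hf with rfl | rfl <;> rcases hε with rfl | rfl <;> simp
      · rw [e, hXp, Matrix.diagonal_mul_diagonal]
        congr 1
        funext i
        rcases hε with rfl | rfl <;> fin_cases i <;> simp
  filter_upwards [hc, hU.mem_nhds hp] with x hxe hx
  rw [hXp] at hxe
  refine ⟨hx, ?_, ?_⟩
  · rw [← hxe, hXd]
    simp only [Matrix.mul_assoc]
    rw [frm_mul_cof hκn, Matrix.mul_one]
  · have h := h3 x hx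
    rw [hxe, (comp_diagonal hε).2.2.2] at h
    have := C₃_injective hκ0 hA.mu_ne h
    rcases hε with rfl | rfl <;> linarith

/-- Chain rule in frames: by `hD` the differential of ψ sends each e_A to plus or minus the
corresponding vector of the second frame. -/
theorem HasFrameDeriv.transfer (hκ : κ ≠ 0) (hψ : ∀ k, DifferentiableAt ℝ (fun y => ψ y k) x)
    (hD : cof κ μ F' (ψ x) * jac ψ x = Matrix.diagonal ![1, ε, ε, ε] * cof κ μ F x)
    {f f' : (Fin 4 → ℝ) → ℝ} {d d' : Fin 4 → ℝ} {s : ℝ} (h : HasFrameDeriv κ μ F f d x)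
    (h' : HasFrameDeriv κ μ F' f' d' (ψ x)) (he : ∀ᶠ y in 𝓝 x, f' (ψ y) = s * f y) (A : Fin 4) :
    ![1, ε, ε, ε] A * d' A = s * d A := by
  have h1 : ∀ c, ∑ B, cof κ μ F x B c * (![1, ε, ε, ε] B * d' B) =
      s * ∑ B, cof κ μ F x B c * d B := fun c => by
    have e1 : pd c (fun y => f' (ψ y)) x = pd c (fun y => s * f y) x := by
      rw [pd, pd, Filter.EventuallyEq.fderiv_eq he]
    rw [pd_comp h'.differentiableAt hψ, (HasGrad.const_mul s h).pd] at e1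
    simp only [h'.pd, Pi.smul_apply, smul_eq_mul] at e1
    rw [← e1]
    have e2 : ∀ B, cof κ μ F x B c * ![1, ε, ε, ε] B =
        ∑ k, cof κ μ F' (ψ x) B k * pd c (fun y => ψ y k) x := fun B => by
      have := congrFun (congrFun hD B) c
      rw [Matrix.diagonal_mul, Matrix.mul_apply] at this
      rw [mul_comm, ← this]
      rfl
    simp only [← mul_assoc, e2, Finset.sum_mul, Finset.mul_sum]
    rw [Finset.sum_comm]
    exact Finset.sum_congr rfl fun _ _ => Finset.sum_congr rfl fun _ _ => by ring
  have e : ∀ v : Fin 4 → ℝ, ∑ c, frm κ μ F x c A * ∑ B, cof κ μ F x B c * v B = v A := fun v => by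
    simp only [Finset.mul_sum, ← mul_assoc]
    rw [Finset.sum_comm]
    simp only [← Finset.sum_mul, sum_frm_mul_cof hκ]
    simp
  have h2 := e fun B => ![1, ε, ε, ε] B * d' B
  simp only [h1] at h2
  rw [← h2]
  have h3 := e d
  rw [← h3]
  simp only [Finset.mul_sum]
  exact Finset.sum_congr rfl fun _ _ => Finset.sum_congr rfl fun _ _ => by ring

/-- The e₃-derivative of I₄ is F₂'e^{-b} and J^{-1/4} = F^{-1/4}e^b; the coordinate b cancels, so φ
expresses an invariant in terms of I₄. -/
theorem IsEssentialFunction.apply_I₄ (hA : Admissible τ μ J F) (hφ : IsEssentialFunction J F φ)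
    (hx : x ∈ domain J) : φ (I₄ F x) = dI₄ F x 2 * Jf F x ^ (-(1 / 4) : ℝ) := by
  have hp := hA.pos _ hx
  rw [I₄, ← hφ _ hx, Jf, Real.mul_rpow hp.le (Real.exp_pos _).le, ← Real.exp_mul]
  have e : -4 * x 1 * (-(1 / 4)) = x 1 := by ring
  have e2 : Real.exp (-x 1) * Real.exp (x 1) = 1 := by rw [← Real.exp_add]; simp
  simp only [dI₄, Matrix.cons_val]
  rw [e]
  linear_combination (-deriv (F₂ F) (x 2) * F (x 2) ^ (-(1 / 4) : ℝ)) * e2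

theorem Admissible.contDiffAt_F₂ (hA : Admissible τ μ J F) {s : ℝ} (hs : s ∈ J) :
    ContDiffAt ℝ ∞ (F₂ F) s := hA.contDiffOn_F₂.contDiffAt (hA.isOpen.mem_nhds hs)

theorem Admissible.map_nhds_F₂ (hA : Admissible τ μ J F) {s : ℝ} (hs : s ∈ J) :
    Filter.map (F₂ F) (𝓝 s) = 𝓝 (F₂ F s) :=
  ((hA.contDiffAt_F₂ hs).hasStrictDerivAt (by simp)).map_nhds_eq (hA.deriv_ne s hs)

/-- Vary only the coordinate s: since F₂' ≠ 0, the values of F₂ near s fill a neighbourhood. -/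
theorem eventually_nhds_I₄ (hA : Admissible τ μ J F) (hp : p ∈ domain J) {P : ℝ → Prop}
    (h : ∀ᶠ x in 𝓝 p, P (I₄ F x)) : ∀ᶠ y in 𝓝 (I₄ F p), P y := by
  rw [I₄, ← hA.map_nhds_F₂ hp, Filter.eventually_map]
  have hc : Filter.Tendsto (fun s => Function.update p 2 s) (𝓝 (p 2)) (𝓝 p) := by
    have : Continuous fun s => Function.update p 2 s := by fun_prop
    have := this.tendsto (p 2)
    rwa [Function.update_eq_self] at this
  filter_upwards [hc.eventually h] with s hs
  simpa [I₄] using hs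

/-- The conditions on the basic invariants at corresponding points of two metrics. -/
theorem invariants_of_isometry (hA : Admissible τ μ J F) (hA' : Admissible τ' μ J' F')
    (hκ0 : 0 < κ) (hφ : IsEssentialFunction J F φ) (hφ' : IsEssentialFunction J' F' φ')
    (hU : IsOpen U) (hUJ : U ⊆ domain J) (hψ : ∀ k, ContDiffOn ℝ ∞ (fun y => ψ y k) U)
    (hmaps : Set.MapsTo ψ U (domain J')) (hp : p ∈ U) (hε : ε = 1 ∨ ε = -1)
    (h : ∀ᶠ x in 𝓝 p, x ∈ U ∧
      cof κ μ F' (ψ x) * jac ψ x = Matrix.diagonal ![1, ε, ε, ε] * cof κ μ F x ∧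
      I₁ (ψ x) = ε * I₁ x) :
    Jf F' (ψ p) = Jf F p ∧ I₃ F' (ψ p) = ε * I₃ F p ∧ I₄ F' (ψ p) = I₄ F p ∧
      ∀ᶠ y in 𝓝 (I₄ F p), φ' y = ε * φ y := by
  have hκ := hκ0.ne'
  have hε2 : ε * ε = 1 := by rcases hε with rfl | rfl <;> norm_num
  have hεn : ε ≠ 0 := by rcases hε with rfl | rfl <;> norm_num
  have hψd : ∀ x ∈ U, ∀ k, DifferentiableAt ℝ (fun y => ψ y k) x := fun x hx k =>
    differentiableAt_of_contDiffOn hU (hψ k) hx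
  -- Here and below, the relation for one invariant, valid near p, is differentiated along e₃ and
  -- yields the relation for the next one; differentiating the last of them gives the relation for
  -- φ.
  have hJ : ∀ᶠ x in 𝓝 p, Jf F' (ψ x) = 1 * Jf F x := by
    filter_upwards [h.eventually_nhds] with x hx
    obtain ⟨hxU, hD, -⟩ := hx.self_of_nhds
    have := HasFrameDeriv.transfer hκ (hψd x hxU) hD (hasGrad_I₁ (F := F) hκ x)
      (hasGrad_I₁ hκ (ψ x)) (hx.mono fun y hy => hy.2.2) 2
    simp only [dI₁, Matrix.cons_val] at this
    have := mul_left_cancel₀ hεn this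
    linarith
  have h3 : ∀ᶠ x in 𝓝 p, I₃ F' (ψ x) = ε * I₃ F x := by
    filter_upwards [h.eventually_nhds, hJ.eventually_nhds] with x hx hxJ
    obtain ⟨hxU, hD, -⟩ := hx.self_of_nhds
    have := HasFrameDeriv.transfer hκ (hψd x hxU) hD (hasFrameDeriv_Jf hA hκ (hUJ hxU))
      (hasFrameDeriv_Jf hA' hκ (hmaps hxU)) hxJ 2
    simp only [dJf, Matrix.cons_val, hxJ.self_of_nhds] at this
    have hne := (Jf_pos hA (hUJ hxU)).ne'
    refine mul_left_cancel₀ (mul_ne_zero hεn hne) ?_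
    linear_combination this - Jf F x * I₃ F x * hε2
  have h4 : ∀ᶠ x in 𝓝 p, I₄ F' (ψ x) = 1 * I₄ F x := by
    filter_upwards [h.eventually_nhds, hJ, h3.eventually_nhds] with x hx hxJ hx3
    obtain ⟨hxU, hD, -⟩ := hx.self_of_nhds
    have := HasFrameDeriv.transfer hκ (hψd x hxU) hD (hasFrameDeriv_I₃ hA hκ (hUJ hxU))
      (hasFrameDeriv_I₃ hA' hκ (hmaps hxU)) hx3 2
    simp only [dI₃, Matrix.cons_val, hxJ, hx3.self_of_nhds, one_mul] at this
    have := mul_left_cancel₀ hεn this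
    have hne := (Real.sqrt_pos.mpr (Jf_pos hA (hUJ hxU))).ne'
    refine mul_right_cancel₀ hne ?_
    linear_combination this - I₃ F x ^ 2 / 8 * hε2
  have hφe : ∀ᶠ x in 𝓝 p, φ' (I₄ F x) = ε * φ (I₄ F x) := by
    filter_upwards [h, hJ, h4.eventually_nhds] with x ⟨hxU, hD, _⟩ hxJ hx4
    have := HasFrameDeriv.transfer hκ (hψd x hxU) hD (hasFrameDeriv_I₄ hA (hUJ hxU))
      (hasFrameDeriv_I₄ hA' (hmaps hxU)) hx4 2
    simp only [Matrix.cons_val] at this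
    rw [hφ.apply_I₄ hA (hUJ hxU), ← one_mul (I₄ F x), ← hx4.self_of_nhds,
      hφ'.apply_I₄ hA' (hmaps hxU), hxJ, one_mul]
    linear_combination (-dI₄ F' (ψ x) 2 * Jf F x ^ (-(1 / 4) : ℝ)) * hε2 +
      ε * Jf F x ^ (-(1 / 4) : ℝ) * this
  exact ⟨by simpa using hJ.self_of_nhds, h3.self_of_nhds, by simpa using h4.self_of_nhds,
    eventually_nhds_I₄ hA (hUJ hp) hφe⟩

theorem I₂_eq_log (hA : Admissible τ μ J F) (hx : x ∈ domain J) : I₂ F x = Real.log (Jf F x) := by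
  rw [Jf, Real.log_mul (hA.pos _ hx).ne' (Real.exp_pos _).ne', Real.log_exp, I₂]
  ring

/-- The condition on the second data for a local isometry from `p` to `p'`. -/
theorem LocallyIsometricAt.invariants (hA : Admissible τ μ J F) (hφ : IsEssentialFunction J F φ)
    (hA' : Admissible τ' μ' J' F') (hφ' : IsEssentialFunction J' F' φ') {p' : Fin 4 → ℝ}
    (h : LocallyIsometricAt (metric τ μ F) (domain J) p (metric τ' μ' F') (domain J') p') :
    τ ^ 2 = τ' ^ 2 ∧ μ = μ' ∧ ∃ ε : ℝ, (ε = 1 ∨ ε = -1) ∧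
      I₁ p' = ε * I₁ p ∧ I₂ F' p' = I₂ F p ∧ I₃ F' p' = ε * I₃ F p ∧ I₄ F' p' = I₄ F p ∧
      ∀ᶠ y in 𝓝 (I₄ F p), φ' y = ε * φ y := by
  obtain ⟨ψ, hp, hsJ, htJ, rfl, hs, -, hiso⟩ := h
  obtain ⟨κ, hκ0, hκ⟩ := exists_kappa hA
  obtain ⟨κ', hκ0', hκ'⟩ := exists_kappa hA'
  have hψ : ∀ k, ContDiffOn ℝ ∞ (fun y => ψ y k) ψ.source := contDiffOn_pi.mp hs
  have hmaps : Set.MapsTo ψ ψ.source (domain J') := fun x hx => htJ (ψ.map_source hx)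
  have hm : ∀ x ∈ ψ.source, metric τ μ F x =
      (jac ψ x).transpose * metric τ' μ' F' (ψ x) * jac ψ x := fun x hx => by
    ext i j
    rw [hiso x hx, Matrix.mul_assoc, Matrix.mul_apply]
    refine Finset.sum_congr rfl fun k _ => ?_
    rw [Matrix.mul_apply, Finset.mul_sum]
    refine Finset.sum_congr rfl fun l _ => ?_
    simp only [Matrix.transpose_apply, jac, Matrix.of_apply]
    ring
  obtain ⟨rfl, rfl, ε, hε, he⟩ := isometry_frame hA hA' hκ0 hκ hκ0' hκ' ψ.open_source hsJ hψ hmaps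
    hm hp
  obtain ⟨i2, i3, i4, hφe⟩ := invariants_of_isometry hA hA' hκ0 hφ hφ' ψ.open_source hsJ hψ hmaps
    hp hε he
  exact ⟨hκ.symm.trans hκ', rfl, ε, hε, he.self_of_nhds.2.2,
    by rw [I₂_eq_log hA (hsJ hp), I₂_eq_log hA' (hmaps hp), i2], i3, i4, hφe⟩

end Isometries

/-! ### Isometries constructed from the invariants -/

section Charts

variable {τ κ μ : ℝ} {J : Set ℝ} {F φ : ℝ → ℝ} {τ' μ' : ℝ} {J' : Set ℝ} {F' φ' : ℝ → ℝ}
  {ψ : (Fin 4 → ℝ) → Fin 4 → ℝ} {p p' x : Fin 4 → ℝ} {ε : ℝ}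

/-- The same triangular pattern read by rows: I₄ yields the component along e₃, J that along e₁, I₃
that along e₂, and I₁ that along e₄. -/
theorem eq_zero_of_dinv (hA : Admissible τ μ J F) (hκ : κ ≠ 0) (hx : x ∈ domain J)
    {u : Fin 4 → ℝ} (h : ∀ k, ∑ B, dinv κ μ F x k B * u B = 0) : u = 0 := by
  simp only [Fin.sum_univ_four] at h
  have h0 := h 0
  have h1 := h 1
  have h2 := h 2
  have h3 := h 3
  simp [dinv, dI₁, dJf, dI₃, dI₄] at h0 h1 h2 h3
  have u2 : u 2 = 0 := by simpa [hA.deriv_ne _ hx, Real.exp_ne_zero] using h3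
  rw [u2] at h0 h1 h2
  have u0 : u 0 = 0 := by simpa [hκ, (Jf_pos hA hx).ne'] using h1
  rw [u0] at h0 h2
  have u1 : u 1 = 0 := by simpa [hκ] using h2
  rw [u1] at h0
  have u3 : u 3 = 0 := by simpa using h0
  funext i
  fin_cases i
  exacts [u0, u1, u2, u3]

theorem exists_equiv_hasFDerivAt_inv (hA : Admissible τ μ J F) (hx : x ∈ domain J) :
    ∃ e : (Fin 4 → ℝ) ≃L[ℝ] (Fin 4 → ℝ), HasFDerivAt (fun y k => inv F k y)
      (e : (Fin 4 → ℝ) →L[ℝ] (Fin 4 → ℝ)) x := by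
  obtain ⟨κ, hκ0, hκ⟩ := exists_kappa hA
  have h := hasFrameDeriv_inv hA hκ0.ne' hx
  let L : (Fin 4 → ℝ) →L[ℝ] (Fin 4 → ℝ) := ContinuousLinearMap.pi fun k => fderiv ℝ (inv F k) x
  have hL : HasFDerivAt (fun y k => inv F k y) L x :=
    hasFDerivAt_pi.mpr fun k => (h k).differentiableAt.hasFDerivAt
  have hi : Function.Injective L := by
    rw [injective_iff_map_eq_zero]
    intro v hv
    have e : (cof κ μ F x).mulVec v = 0 := by
      refine eq_zero_of_dinv hA hκ0.ne' hx fun k => ?_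
      have e1 : fderiv ℝ (inv F k) x v = 0 := congrFun hv k
      rw [HasGrad.fderiv_apply (h k)] at e1
      rw [← e1]
      simp only [Matrix.mulVec, dotProduct, Finset.mul_sum]
      rw [Finset.sum_comm]
      exact Finset.sum_congr rfl fun _ _ => Finset.sum_congr rfl fun _ _ => by ring
    have e2 := congrArg (frm κ μ F x).mulVec e
    rwa [Matrix.mulVec_mulVec, frm_mul_cof hκ0.ne', Matrix.one_mulVec, Matrix.mulVec_zero] at e2
  exact ⟨(LinearEquiv.ofInjectiveEndo L.toLinearMap hi).toContinuousLinearEquiv, hL⟩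

theorem contDiffOn_inv (hA : Admissible τ μ J F) :
    ContDiffOn ℝ ∞ (fun y k => inv F k y) (domain J) := by
  have h1 := hA.contDiffOn_comp hA.smooth
  have h2 := hA.contDiffOn_comp hA.contDiffOn_F₁
  have h3 := hA.contDiffOn_comp hA.contDiffOn_F₂
  refine contDiffOn_pi.mpr fun k => ?_
  fin_cases k
  · change ContDiffOn ℝ ∞ (fun y : Fin 4 → ℝ => Real.exp (-3 * y 1) * y 3) _
    fun_prop
  · exact h1.mul (ContDiff.contDiffOn (by fun_prop))
  · exact (ContDiffOn.mul (ContDiff.contDiffOn (by fun_prop)) h2).sub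
      (ContDiff.contDiffOn (by fun_prop))
  · exact h3

/-- The basic invariants are local coordinates. -/
theorem exists_chart (hA : Admissible τ μ J F) (hp : p ∈ domain J) :
    ∃ Φ : OpenPartialHomeomorph (Fin 4 → ℝ) (Fin 4 → ℝ), p ∈ Φ.source ∧ Φ.source ⊆ domain J ∧
      (∀ x k, Φ x k = inv F k x) ∧ ContDiffOn ℝ ∞ Φ Φ.source ∧
      ContDiffOn ℝ ∞ Φ.symm Φ.target := by
  obtain ⟨e, he⟩ := exists_equiv_hasFDerivAt_inv hA hp
  have hc := (contDiffOn_inv hA).contDiffAt (hA.isOpen_domain.mem_nhds hp)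
  let Φ := (hc.toOpenPartialHomeomorph _ he (by simp)).restrOpen _ hA.isOpen_domain
  have hΦ : (Φ : (Fin 4 → ℝ) → Fin 4 → ℝ) = fun y k => inv F k y := rfl
  have hs : Φ.source ⊆ domain J := fun x hx => hx.2
  refine ⟨Φ, ⟨hc.mem_toOpenPartialHomeomorph_source he (by simp), hp⟩, hs, fun _ _ => rfl,
    (contDiffOn_inv hA).mono hs, fun y hy => ?_⟩
  have hy' := hs (Φ.map_target hy)
  obtain ⟨e', he'⟩ := exists_equiv_hasFDerivAt_inv hA hy'
  exact (Φ.contDiffAt_symm hy he'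
    ((contDiffOn_inv hA).contDiffAt (hA.isOpen_domain.mem_nhds hy'))).contDiffWithinAt

/-- The signs of the basic invariants under a change of orientation of the frame. -/
def signs (ε : ℝ) : Fin 4 → ℝ := ![ε, 1, ε, 1]

/-- The frame derivatives of I₁, J and I₃ are explicit functions of the four invariants; that of I₄
is recovered from φ and J by `IsEssentialFunction.apply_I₄`. -/
theorem dinv_signs (hε : ε = 1 ∨ ε = -1) (hA : Admissible τ μ J F) (hA' : Admissible τ' μ J' F')
    (hφ : IsEssentialFunction J F φ) (hφ' : IsEssentialFunction J' F' φ') (hx : x ∈ domain J)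
    {y : Fin 4 → ℝ} (hy : y ∈ domain J') (h : ∀ k, inv F' k y = signs ε k * inv F k x)
    (hφe : φ' (I₄ F x) = ε * φ (I₄ F x)) (k B : Fin 4) :
    dinv κ μ F' y k B * ![1, ε, ε, ε] B = signs ε k * dinv κ μ F x k B := by
  have h0 : I₁ y = ε * I₁ x := h 0
  have h1 : Jf F' y = Jf F x := (h 1).trans (one_mul _)
  have h2 : I₃ F' y = ε * I₃ F x := h 2
  have h3 : I₄ F' y = I₄ F x := (h 3).trans (one_mul _)
  rw [hφ.apply_I₄ hA hx, ← h3, hφ'.apply_I₄ hA' hy, h1, ← mul_assoc] at hφe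
  have h4 := mul_right_cancel₀ (Real.rpow_pos_of_pos (Jf_pos hA hx) _).ne' hφe
  simp only [dI₄, Matrix.cons_val] at h4
  rcases hε with rfl | rfl <;> fin_cases k <;> fin_cases B <;>
    simp [dinv, dI₁, dJf, dI₃, dI₄, signs, h0, h1, h2, h3, h4]

/-- The pulled-back coframe and the reflected original one give the same combinations with the frame
derivatives of the four invariants; as that matrix is injective, they coincide. The reflection
preserves η, so the metrics agree. -/
theorem metric_eq_of_inv (hε : ε = 1 ∨ ε = -1) (hA : Admissible τ μ J F)
    (hA' : Admissible τ' μ J' F') (hτ : τ ^ 2 = τ' ^ 2) (hφ : IsEssentialFunction J F φ)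
    (hφ' : IsEssentialFunction J' F' φ') (hx : x ∈ domain J) (hy : ψ x ∈ domain J')
    (hψ : ∀ k, DifferentiableAt ℝ (fun y => ψ y k) x)
    (h : ∀ᶠ y in 𝓝 x, ∀ k, inv F' k (ψ y) = signs ε k * inv F k y)
    (hφe : φ' (I₄ F x) = ε * φ (I₄ F x)) :
    metric τ μ F x = (jac ψ x).transpose * metric τ' μ F' (ψ x) * jac ψ x := by
  obtain ⟨κ, hκ0, hκ⟩ := exists_kappa hA
  have hκn := hκ0.ne'
  have hd := dinv_signs (κ := κ) hε hA hA' hφ hφ' hx hy h.self_of_nhds hφe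
  have e : cof κ μ F' (ψ x) * jac ψ x = Matrix.diagonal ![1, ε, ε, ε] * cof κ μ F x := by
    ext B c
    refine sub_eq_zero.mp (congrFun (eq_zero_of_dinv hA' hκn hy
      (u := fun B => (cof κ μ F' (ψ x) * jac ψ x) B c -
        (Matrix.diagonal ![1, ε, ε, ε] * cof κ μ F x) B c) fun k => ?_) B)
    have e1 : pd c (fun y => inv F' k (ψ y)) x = pd c (fun y => signs ε k * inv F k y) x := by
      rw [pd, pd, Filter.EventuallyEq.fderiv_eq (h.mono fun y hy => hy k)]
    have hF := hasFrameDeriv_inv hA hκn hx k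
    have hF' := hasFrameDeriv_inv hA' hκn hy k
    rw [pd_comp hF'.differentiableAt hψ, (HasGrad.const_mul (signs ε k) hF).pd] at e1
    simp only [hF'.pd, Pi.smul_apply, smul_eq_mul] at e1
    have e2 : ∑ B, dinv κ μ F' (ψ x) k B * (cof κ μ F' (ψ x) * jac ψ x) B c =
        signs ε k * ∑ B, cof κ μ F x B c * dinv κ μ F x k B := by
      rw [← e1]
      simp only [Matrix.mul_apply, Finset.mul_sum]
      rw [Finset.sum_comm]
      refine Finset.sum_congr rfl fun _ _ => Finset.sum_congr rfl fun _ _ => ?_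
      simp only [jac, Matrix.of_apply]
      ring
    simp only [mul_sub, Finset.sum_sub_distrib]
    rw [e2, sub_eq_zero, Finset.mul_sum]
    refine Finset.sum_congr rfl fun B _ => ?_
    rw [Matrix.diagonal_mul]
    linear_combination (-cof κ μ F x B c) * hd k B
  have e3 := diagonal_preserves hε
  rw [metric_eq hκ hA.tau_ne, metric_eq (hκ.trans hτ) hA'.tau_ne]
  calc _ = (cof κ μ F x).transpose * ((Matrix.diagonal ![1, ε, ε, ε]).transpose * etaNull *
        Matrix.diagonal ![1, ε, ε, ε]) * cof κ μ F x := by rw [e3]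
    _ = (Matrix.diagonal ![1, ε, ε, ε] * cof κ μ F x).transpose * etaNull *
        (Matrix.diagonal ![1, ε, ε, ε] * cof κ μ F x) := by
      simp only [Matrix.transpose_mul, Matrix.mul_assoc]
    _ = _ := by
      rw [← e]
      simp only [Matrix.transpose_mul, Matrix.mul_assoc]

/-- The homeomorphism `v ↦ (ε v₀, v₁, ε v₂, v₃)`. -/
def signsHomeomorph (hε : ε = 1 ∨ ε = -1) : (Fin 4 → ℝ) ≃ₜ (Fin 4 → ℝ) where
  toFun v k := signs ε k * v k
  invFun v k := signs ε k * v k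
  left_inv v := by
    funext k
    rcases hε with rfl | rfl <;> fin_cases k <;> simp [signs]
  right_inv v := by
    funext k
    rcases hε with rfl | rfl <;> fin_cases k <;> simp [signs]
  continuous_toFun := by fun_prop
  continuous_invFun := by fun_prop

theorem locallyIsometricAt_of_inv (hε : ε = 1 ∨ ε = -1) (hA : Admissible τ μ J F)
    (hA' : Admissible τ' μ J' F') (hτ : τ ^ 2 = τ' ^ 2) (hφ : IsEssentialFunction J F φ)
    (hφ' : IsEssentialFunction J' F' φ') (hp : p ∈ domain J) (hp' : p' ∈ domain J')
    (h : ∀ k, inv F' k p' = signs ε k * inv F k p)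
    (hφe : ∀ᶠ y in 𝓝 (I₄ F p), φ' y = ε * φ y) :
    LocallyIsometricAt (metric τ μ F) (domain J) p (metric τ' μ F') (domain J') p' := by
  obtain ⟨Φ, hpΦ, hΦs, hΦ, hΦc, hΦc'⟩ := exists_chart hA hp
  obtain ⟨Φ', hpΦ', hΦs', hΦ', hΨc, hΨc'⟩ := exists_chart hA' hp'
  have hI : ContinuousAt (I₄ F) p := (hA.contDiffOn_comp hA.contDiffOn_F₂).continuousOn.continuousAt
    (hA.isOpen_domain.mem_nhds hp)
  obtain ⟨O, hO, hOo, hpO⟩ := eventually_nhds_iff.mp (hI.eventually hφe)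
  let D := signsHomeomorph hε
  have hD : ∀ v k, D v k = signs ε k * v k := fun _ _ => rfl
  have hDc : ContDiff ℝ ∞ D := by
    change ContDiff ℝ ∞ fun (v : Fin 4 → ℝ) k => signs ε k * v k
    fun_prop
  have hDc' : ContDiff ℝ ∞ D.symm := hDc
  -- In the coordinates given by the invariants the isometry is the change of signs, restricted to
  -- points where φ' = εφ holds at I₄.
  let ψ := ((Φ.trans D.toOpenPartialHomeomorph).trans Φ'.symm).restrOpen O hOo
  have hψ : ∀ x, ψ x = Φ'.symm (D (Φ x)) := fun _ => rfl
  have hmem : ∀ x, x ∈ ψ.source ↔ (x ∈ Φ.source ∧ D (Φ x) ∈ Φ'.target) ∧ x ∈ O := by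
    intro x
    simp [ψ]
  have hpD : D (Φ p) = Φ' p' := by
    funext k
    rw [hD, hΦ', h k, hΦ]
  have hsm : ContDiffOn ℝ ∞ ψ ψ.source := by
    change ContDiffOn ℝ ∞ (fun x => Φ'.symm (D (Φ x))) _
    exact ContDiffOn.comp (t := Φ'.target) hΨc' (hDc.comp_contDiffOn
      (hΦc.mono fun x hx => ((hmem x).mp hx).1.1)) fun x hx => ((hmem x).mp hx).1.2
  refine ⟨ψ, (hmem p).mpr ⟨⟨hpΦ, by rw [hpD]; exact Φ'.map_source hpΦ'⟩, hpO⟩,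
    fun x hx => hΦs ((hmem x).mp hx).1.1, ?_, ?_, hsm, ?_, ?_⟩
  · intro y hy
    have h1 := (hmem _).mp (ψ.map_target hy)
    rw [← ψ.right_inv hy, hψ]
    exact hΦs' (Φ'.map_target h1.1.2)
  · rw [hψ, hpD, Φ'.left_inv hpΦ']
  · have ht : ∀ y ∈ ψ.target, y ∈ Φ'.source ∧ D.symm (Φ' y) ∈ Φ.target := fun y hy => by
      obtain ⟨⟨h1, h2⟩, -⟩ := (hmem _).mp (ψ.map_target hy)
      have e : y = Φ'.symm (D (Φ (ψ.symm y))) := (ψ.right_inv hy).symm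
      have e2 : Φ' y = D (Φ (ψ.symm y)) := by
        conv_lhs => rw [e]
        exact Φ'.right_inv h2
      refine ⟨?_, ?_⟩
      · rw [e]
        exact Φ'.map_target h2
      · rw [e2, D.symm_apply_apply]
        exact Φ.map_source h1
    change ContDiffOn ℝ ∞ (fun x => Φ.symm (D.symm (Φ' x))) _
    exact ContDiffOn.comp (t := Φ.target) hΦc' (hDc'.comp_contDiffOn
      (hΨc.mono fun y hy => (ht y hy).1)) fun y hy => (ht y hy).2
  · intro x hx i j
    have hx' := (hmem x).mp hx
    have hm := metric_eq_of_inv (ψ := ψ) hε hA hA' hτ hφ hφ' (hΦs hx'.1.1)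
      (by rw [hψ]; exact hΦs' (Φ'.map_target hx'.1.2))
      (fun k => differentiableAt_of_contDiffOn ψ.open_source (contDiffOn_pi.mp hsm k) hx)
      (by
        filter_upwards [ψ.open_source.mem_nhds hx] with y hy k
        rw [← hΦ', hψ, Φ'.right_inv ((hmem y).mp hy).1.2, hD, hΦ])
      (hO x hx'.2)
    rw [hm, Matrix.mul_assoc, Matrix.mul_apply]
    refine Finset.sum_congr rfl fun k _ => ?_
    rw [Matrix.mul_apply, Finset.mul_sum]
    refine Finset.sum_congr rfl fun l _ => ?_
    simp only [Matrix.transpose_apply, jac, Matrix.of_apply]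
    ring

end Charts

/-! ### The equivalence criterion -/

section Classification

variable {τ μ : ℝ} {J : Set ℝ} {F φ : ℝ → ℝ} {τ' μ' : ℝ} {J' : Set ℝ} {F' φ' : ℝ → ℝ}
  {p p' : Fin 4 → ℝ}

theorem locallyIsometricAt_iff (hA : Admissible τ μ J F) (hφ : IsEssentialFunction J F φ)
    (hA' : Admissible τ' μ' J' F') (hφ' : IsEssentialFunction J' F' φ')
    (hp : p ∈ domain J) (hp' : p' ∈ domain J') :
    LocallyIsometricAt (metric τ μ F) (domain J) p (metric τ' μ' F') (domain J') p' ↔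
      τ ^ 2 = τ' ^ 2 ∧ μ = μ' ∧ ∃ ε : ℝ, (ε = 1 ∨ ε = -1) ∧
        I₁ p' = ε * I₁ p ∧ I₂ F' p' = I₂ F p ∧ I₃ F' p' = ε * I₃ F p ∧ I₄ F' p' = I₄ F p ∧
        ∀ᶠ y in 𝓝 (I₄ F p), φ' y = ε * φ y := by
  refine ⟨fun h => h.invariants hA hφ hA' hφ', ?_⟩
  rintro ⟨hτ, rfl, ε, hε, h1, h2, h3, h4, hφe⟩
  refine locallyIsometricAt_of_inv hε hA hA' hτ hφ hφ' hp hp' (fun k => ?_) hφe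
  rw [I₂_eq_log hA hp, I₂_eq_log hA' hp'] at h2
  fin_cases k
  · exact h1
  · exact (Real.log_injOn_pos (Jf_pos hA' hp') (Jf_pos hA hp) h2).trans (one_mul _).symm
  · exact h3
  · exact h4.trans (one_mul _).symm

theorem exists_locallyIsometricAt_iff (hA : Admissible τ μ J F) (hφ : IsEssentialFunction J F φ)
    (hA' : Admissible τ' μ' J' F') (hφ' : IsEssentialFunction J' F' φ') :
    (∃ p ∈ domain J, ∃ p' ∈ domain J',
        LocallyIsometricAt (metric τ μ F) (domain J) p (metric τ' μ' F') (domain J') p') ↔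
      τ ^ 2 = τ' ^ 2 ∧ μ = μ' ∧ ∃ ε : ℝ, (ε = 1 ∨ ε = -1) ∧
        ∃ y ∈ F₂ F '' J ∩ F₂ F' '' J', ∀ᶠ z in 𝓝 y, φ' z = ε * φ z := by
  constructor
  · rintro ⟨p, hp, p', hp', h⟩
    obtain ⟨hτ, hμ, ε, hε, -, -, -, h4, hφe⟩ := h.invariants hA hφ hA' hφ'
    exact ⟨hτ, hμ, ε, hε, I₄ F p, ⟨⟨p 2, hp, rfl⟩, ⟨p' 2, hp', h4⟩⟩, hφe⟩
  · rintro ⟨hτ, hμ, ε, hε, y, ⟨⟨s, hs, rfl⟩, ⟨s', hs', h4⟩⟩, hφe⟩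
    -- The first point has a = b = t = 0. At the second one b is chosen to match I₂, the coordinate
    -- a to match I₃ up to the sign, and t = 0 makes both values of I₁ vanish.
    let b := (Real.log (F' s') - Real.log (F s)) / 4
    have hp : (![0, 0, s, 0] : Fin 4 → ℝ) ∈ domain J := hs
    have hp' : (![(Real.exp (-b) * F₁ F' s' - ε * F₁ F s) / 8, b, s', 0] : Fin 4 → ℝ) ∈
      domain J' := hs'
    refine ⟨_, hp, _, hp', (locallyIsometricAt_iff hA hφ hA' hφ' hp hp').mpr
      ⟨hτ, hμ, ε, hε, ?_, ?_, ?_, h4, hφe⟩⟩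
    · simp [I₁]
    · simp [I₂, b]
      ring
    · simp [I₃]
      ring

end Classification

/-! ### Existence and smoothness of the essential function -/

section EssentialFunction

variable {τ μ : ℝ} {J : Set ℝ} {F : ℝ → ℝ}

/-- Rolle's theorem on the interval `J`. -/
theorem Admissible.injOn_F₂ (hA : Admissible τ μ J F) : Set.InjOn (F₂ F) J := by
  have key : ∀ a ∈ J, ∀ b ∈ J, a < b → F₂ F a ≠ F₂ F b := by
    intro a ha b hb hab he
    have hs := hA.interval.out ha hb
    obtain ⟨c, hc, h⟩ := exists_deriv_eq_zero hab (hA.contDiffOn_F₂.continuousOn.mono hs) he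
    exact hA.deriv_ne c (hs ⟨hc.1.le, hc.2.le⟩) h
  intro a ha b hb he
  rcases lt_trichotomy a b with h | h | h
  exacts [absurd he (key a ha b hb h), h, absurd he.symm (key b hb a ha h)]

theorem Admissible.isOpen_image_F₂ (hA : Admissible τ μ J F) : IsOpen (F₂ F '' J) := by
  rw [isOpen_iff_mem_nhds]
  rintro _ ⟨s, hs, rfl⟩
  rw [← hA.map_nhds_F₂ hs]
  exact Filter.image_mem_map (hA.isOpen.mem_nhds hs)

/-- Global injectivity gives an inverse on the image; near each value it coincides with the smooth
local inverse. -/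
theorem Admissible.exists_inverse_F₂ (hA : Admissible τ μ J F) :
    ∃ σ : ℝ → ℝ, ContDiffOn ℝ ∞ σ (F₂ F '' J) ∧ ∀ s ∈ J, σ (F₂ F s) = s := by
  have hinv : ∀ s ∈ J, Function.invFunOn (F₂ F) J (F₂ F s) = s := fun s hs =>
    hA.injOn_F₂.leftInvOn_invFunOn hs
  refine ⟨Function.invFunOn (F₂ F) J, ?_, hinv⟩
  rintro _ ⟨s, hs, rfl⟩
  have hd : HasFDerivAt (F₂ F) ((ContinuousLinearEquiv.unitsEquivAut ℝ
      (Units.mk0 _ (hA.deriv_ne s hs)) : ℝ ≃L[ℝ] ℝ) : ℝ →L[ℝ] ℝ) s := by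
    refine (hA.hasDerivAt hA.contDiffOn_F₂ hs).hasFDerivAt.congr_fderiv ?_
    ext
    simp
  have hc := hA.contDiffAt_F₂ hs
  let e := hc.toOpenPartialHomeomorph _ hd (by simp)
  have hes : s ∈ e.source := hc.mem_toOpenPartialHomeomorph_source hd (by simp)
  have h1 : ContDiffAt ℝ ∞ e.symm (F₂ F s) := hc.to_localInverse hd (by simp)
  refine (h1.congr_of_eventuallyEq ?_).contDiffWithinAt
  have h2 : ∀ᶠ r in 𝓝 s, r ∈ e.source ∧ r ∈ J :=
    Filter.Eventually.and (e.open_source.mem_nhds hes) (hA.isOpen.mem_nhds hs)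
  rw [Filter.EventuallyEq, ← hA.map_nhds_F₂ hs, Filter.eventually_map]
  filter_upwards [h2] with r hr
  rw [hinv r hr.2]
  exact (e.left_inv hr.1).symm

theorem exists_essentialFunction (hA : Admissible τ μ J F) :
    ∃ φ : ℝ → ℝ, ContDiffOn ℝ ∞ φ (F₂ F '' J) ∧ IsEssentialFunction J F φ := by
  obtain ⟨σ, hσ, h⟩ := hA.exists_inverse_F₂
  refine ⟨fun y => deriv (F₂ F) (σ y) * F (σ y) ^ (-(1 / 4) : ℝ), ?_, fun s hs => by
    simp only [h s hs]⟩
  have hm : Set.MapsTo σ (F₂ F '' J) J := by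
    rintro _ ⟨s, hs, rfl⟩
    rwa [h s hs]
  exact ((hA.contDiffOn_F₂.deriv_of_isOpen hA.isOpen (by simp)).mul
    (hA.smooth.rpow_const_of_ne fun s hs => (hA.pos s hs).ne')).comp hσ hm

end EssentialFunction

/-! ### An example attaining the bound -/

section Sharpness

/-- For the exponential, F₁ = 1 and F₂ = -e^{-s/2}/8, whose derivative has no zero. -/
theorem admissible_exp : Admissible 1 0 Set.univ Real.exp := by
  have h1 : F₁ Real.exp = fun _ => 1 := by
    funext s
    rw [F₁, Real.deriv_exp, div_self (Real.exp_ne_zero s)]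
  have h2 : F₂ Real.exp = fun s => -(1 / 8) * Real.exp (-s / 2) := by
    funext s
    rw [F₂, h1, ← Real.exp_half, deriv_const, neg_div, Real.exp_neg]
    ring
  refine ⟨one_ne_zero, by norm_num, isOpen_univ, Set.univ_nonempty, Set.ordConnected_univ,
    Real.contDiff_exp.contDiffOn, fun s _ => Real.exp_pos s, fun s _ => ?_⟩
  have h3 : HasDerivAt (F₂ Real.exp) (-(1 / 8) * (Real.exp (-s / 2) * (-1 / 2))) s := by
    rw [h2]
    exact (((hasDerivAt_id s).neg.div_const 2).exp).const_mul _
  rw [h3.deriv]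
  have := Real.exp_ne_zero (-s / 2)
  simp

theorem isGreatest_typeNOrders (o : Bool) : IsGreatest (typeNOrders o) 7 := by
  refine ⟨?_, fun N hN => typeNOrders_le o hN⟩
  have hA := admissible_exp
  -- Keeping t > 0 makes runs available for O(η) as well as for SO(η).
  have hW : IsOpen {x : Fin 4 → ℝ | 0 < x 3} := isOpen_lt continuous_const (continuous_apply 3)
  have hne : {x : Fin 4 → ℝ | 0 < x 3}.Nonempty := ⟨fun _ => 1, one_pos (α := ℝ)⟩
  have hWJ : {x : Fin 4 → ℝ | 0 < x 3} ⊆ domain Set.univ := fun _ _ => trivial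
  obtain ⟨hm, hs⟩ := isMetricOn_metric hA
  obtain ⟨r⟩ := nonempty_run (o := o) hA hWJ fun _ x hx => (ne_of_gt hx : x 3 ≠ 0)
  refine ⟨_, _, hW, hne, ⟨hm.mono hWJ, fun x hx => hs x (hWJ hx)⟩, fun x hx => ?_, r,
    r.last_eq hA hW hne hWJ⟩
  obtain ⟨k, hk, -⟩ := exists_typeN_vector hA (hWJ hx)
  exact ⟨k, hk⟩

end Sharpness

end Karlhede

end

open Karlhede in
theorem mainTheorem1 :
    -- the curvature of the metrics and the Karlhede algorithm
    (∀ (τ μ : ℝ) (J : Set ℝ) (F : ℝ → ℝ), Admissible τ μ J F →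
      IsMetricOn etaNull (metric τ μ F) (domain J) ∧
      (∀ x ∈ domain J, ∃ k : Fin 4 → ℝ, IsTypeNAlong (metric τ μ F) x k ∧
        (∀ i, ((∑ j, metric τ μ F x i j * k j : ℝ) : ℂ) = coframe τ μ F x 2 i) ∧
        ∀ i j, ricci (metric τ μ F) x i j = -6 * τ ^ 2 * metric τ μ F x i j +
          (5 * μ - 8) * (∑ l, metric τ μ F x i l * k l) * (∑ l, metric τ μ F x j l * k l)) ∧
      ∀ W : Set (Fin 4 → ℝ), IsOpen W → W.Nonempty → W ⊆ domain J →
        Nonempty (KarlhedeRun true etaNull (metric τ μ F) W) ∧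
        ((∀ x ∈ W, x 3 ≠ 0) → Nonempty (KarlhedeRun false etaNull (metric τ μ F) W)) ∧
        ∀ (o : Bool) (r : KarlhedeRun o etaNull (metric τ μ F) W),
          r.last = 7 ∧
          (∀ q : Fin 8, r.t q = (![0, 0, 0, 1, 2, 3, 4, 4] : Fin 8 → ℕ) q) ∧
          (∀ q : Fin 8, groupDim (r.G q) = (![2, 1, 0, 0, 0, 0, 0, 0] : Fin 8 → ℕ) q)) ∧
    -- sharpness of the bound for type N
    (∀ o : Bool, IsGreatest (typeNOrders o) 7) ∧
    -- the essential function
    (∀ (τ μ : ℝ) (J : Set ℝ) (F : ℝ → ℝ), Admissible τ μ J F →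
      IsOpen (F₂ F '' J) ∧
      ∃ φ : ℝ → ℝ, ContDiffOn ℝ ∞ φ (F₂ F '' J) ∧ IsEssentialFunction J F φ) ∧
    -- classification by the essential constants and the essential function
    (∀ (τ μ : ℝ) (J : Set ℝ) (F φ : ℝ → ℝ) (τ' μ' : ℝ) (J' : Set ℝ) (F' φ' : ℝ → ℝ),
      Admissible τ μ J F → IsEssentialFunction J F φ →
      Admissible τ' μ' J' F' → IsEssentialFunction J' F' φ' →
      (∀ p ∈ domain J, ∀ p' ∈ domain J',
        (LocallyIsometricAt (metric τ μ F) (domain J) p (metric τ' μ' F') (domain J') p' ↔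
          τ ^ 2 = τ' ^ 2 ∧ μ = μ' ∧ ∃ ε : ℝ, (ε = 1 ∨ ε = -1) ∧
            I₁ p' = ε * I₁ p ∧ I₂ F' p' = I₂ F p ∧ I₃ F' p' = ε * I₃ F p ∧ I₄ F' p' = I₄ F p ∧
            ∀ᶠ y in 𝓝 (I₄ F p), φ' y = ε * φ y)) ∧
      ((∃ p ∈ domain J, ∃ p' ∈ domain J',
          LocallyIsometricAt (metric τ μ F) (domain J) p (metric τ' μ' F') (domain J') p') ↔
        τ ^ 2 = τ' ^ 2 ∧ μ = μ' ∧ ∃ ε : ℝ, (ε = 1 ∨ ε = -1) ∧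
          ∃ y ∈ F₂ F '' J ∩ F₂ F' '' J', ∀ᶠ z in 𝓝 y, φ' z = ε * φ z)) := by
  refine ⟨fun τ μ J F hA => ⟨isMetricOn_metric hA, fun x hx => exists_typeN_vector hA hx,
      fun W hW hne hWJ => ⟨nonempty_run hA hWJ nofun, fun ht => nonempty_run hA hWJ fun _ => ht,
        fun o r => ?_⟩⟩,
    isGreatest_typeNOrders, fun τ μ J F hA => ⟨hA.isOpen_image_F₂, exists_essentialFunction hA⟩,
    fun τ μ J F φ τ' μ' J' F' φ' hA hφ hA' hφ' =>
      ⟨fun p hp p' hp' => locallyIsometricAt_iff hA hφ hA' hφ' hp hp',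
        exists_locallyIsometricAt_iff hA hφ hA' hφ'⟩⟩
  have h7 := r.last_eq hA hW hne hWJ
  refine ⟨h7, fun q => ?_, fun q => ?_⟩
  · rw [r.t_eq hA hW hne hWJ (by omega)]
    fin_cases q <;> rfl
  · rw [r.groupDim_eq hA hne hWJ (by omega)]
    fin_cases q <;> rfl
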